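/- **Theorem.** Let $A=\mathbb{C}[x_1,\dots,x_N]$ and let $W\in A$ be weighted homogeneous, i.e. $W(\lambda^{q_1}x_1,\dots,\lambda^{q_N}x_N)=\lambda W(x_1,\dots,x_N)$ with rational weights $q_i>0$ (every monomial of $W$ has weight $1$), with an isolated critical point at the origin. Let $G$ be a subgroup of the group $G_W$ of all $(\lambda_1,\dots,\lambda_N)\in(\mathbb{C}^\times)^N$ with $W(\lambda_1x_1,\dots,\lambda_Nx_N)=W(x_1,\dots,x_N)$, and let $g=(\lambda_1,\dots,\lambda_N)\in G$, acting on $A$ by ${}^gx_i=\lambda_ix_i$. *Fixed locus.* Let $\mathrm{Fix}(g)\subset\mathbb{C}^N$ be the fixed subspace, $N_g=\dim\mathrm{Fix}(g)$, $A_g=\mathbb{C}[x_i:\lambda_i=1]$ its algebra of polynomial functions (also viewed inside $A$), $W_g=W|_{\mathrm{Fix}(g)}\in A_g$, $\mathrm{Jac}(W_g)=A_g/(\partial_jW_g)_j$, $m=N-N_g$, and let $i_1<\dots<i_m$ be the indices $i$ with $\lambda_i\ne1$. *Hochschild cohomology.* Let $C^p(A,Ag)=\mathrm{Hom}_{\mathbb{C}}(A^{\otimes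 p},A)\,g$ and $C_c(A,Ag)=\bigoplus_{p\ge0}C^p(A,Ag)$. For $\phi g\in C^p(A,Ag)$ let $$(\partial_H\phi)(a_1,\dots,a_{p+1})=a_1\phi(a_2,\dots,a_{p+1})+\sum_{i=1}^p(-1)^i\phi(\dots,a_ia_{i+1},\dots)+(-1)^{p+1}\phi(a_1,\dots,a_p)\,{}^ga_{p+1},$$ $$(\mathsf d_W\phi)(a_1,\dots,a_{p-1})=\sum_{i=1}^{p}(-1)^{i-1}\phi(a_1,\dots,a_{i-1},W,a_i,\dots,a_{p-1})$$ (with $\mathsf d_W=0$ on $C^0$). Then $\mathsf{HH}_c(A_W,A_Wg)$ is the cohomology of $(C_c(A,Ag),\partial_H+\mathsf d_W)$, with $\mathbb{Z}/2$-grading given by the parity of $p$. *The map $\Theta_g$.* For $a\in A_g$ let $\theta_g(a)\in C^m(A,Ag)$ be the $\partial_H$-cocycle $$\theta_g(a)(a_1,\dots,a_m)=a\prod_{k=1}^m\rho_{i_k}(g)\big(\partial^g_{x_{i_k}}a_k\big)\,g,$$ which corresponds to the Koszul cocycle $a\,e_{i_1}\cdots e_{i_m}g$; here $\rho_i(g)$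 is the algebra map with $x_j\mapsto\lambda_jx_j$ for $j<i$ and $x_j\mapsto x_j$ for $j\ge i$, and $\partial^g_{x_i}$ is the linear map sending $x^\gamma$ to $(1+\lambda_i+\dots+\lambda_i^{\gamma_i-1})\,x^\gamma/x_i$ if $\gamma_i>0$ and to $0$ if $\gamma_i=0$. Then for every $a\in A_g$ there is a $(\partial_H+\mathsf d_W)$-cocycle $\phi=\sum_{p\le m}\phi_p\in C_c(A,Ag)$ whose leading component $\phi_m$ is $\partial_H$-cohomologous to $\theta_g(a)$. The class $[\phi]\in\mathsf{HH}_c(A_W,A_Wg)$ depends only on the class of $a$ in $\mathrm{Jac}(W_g)$, and $[a]\mapsto[\phi]$ defines an isomorphism of $\mathbb{Z}/2$-graded vector spaces $$\Theta_g\colon\ \mathrm{Jac}(W_g)[N-N_g]\ \xrightarrow{\ \cong\ }\ \mathsf{HH}_c(A_W,A_Wg),$$ where $\mathrm{Jac}(W_g)$ is placed in even degree and $V[m]_s=V_{s+m}$ for $s\in\mathbb{Z}/2$. In particular, $\mathsf{HH}_c(A_W,A_Wg)$ is concentrated in parity $N-N_g$. -/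

import Mathlib

open MvPolynomial DirectSum Topology

namespace OrbifoldLG

noncomputable section

/-! ## The superpotential, its diagonal symmetries and their fixed loci -/

/-- The polynomial algebra `A = ℂ[x₁, …, x_N]`. -/
abbrev PolyAlg (N : ℕ) : Type := MvPolynomial (Fin N) ℂ

/-- The origin is a critical point of `W`, and it is isolated among the critical points. -/
def HasIsolatedCriticalPoint {N : ℕ} (W : PolyAlg N) : Prop :=
  (∀ i, eval (0 : Fin N → ℂ) (pderiv i W) = 0) ∧
    ∀ᶠ x in 𝓝[≠] (0 : Fin N → ℂ), ∃ i, eval x (pderiv i W) ≠ 0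

/-- The group `G_W` of all `(λ₁, …, λ_N) ∈ (ℂˣ)ᴺ` with `W(λ₁ x₁, …, λ_N x_N) = W(x₁, …, x_N)`. -/
def symmetryGroup {N : ℕ} (W : PolyAlg N) : Subgroup (Fin N → ℂˣ) where
  carrier := {g | ∀ x : Fin N → ℂ, eval (fun i => (g i : ℂ) * x i) W = eval x W}
  one_mem' := by simp
  mul_mem' := by
    intro a b ha hb x
    have h := ha (fun i => (b i : ℂ) * x i)
    rw [hb x] at h
    simpa [mul_assoc] using h
  inv_mem' := by
    intro a ha x
    have h := ha (fun i => ((a⁻¹) i : ℂ) * x i)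
    simpa using h.symm

/-- The action of a diagonal symmetry on polynomials, `ᵍxᵢ = λᵢ xᵢ`. -/
def act {N : ℕ} (g : Fin N → ℂˣ) : PolyAlg N →ₐ[ℂ] PolyAlg N :=
  aeval (fun i => C (g i : ℂ) * X i)

/-- The fixed locus `Fix(g) ⊆ ℂᴺ`. -/
def fixedLocus {N : ℕ} (g : Fin N → ℂˣ) : Submodule ℂ (Fin N → ℂ) where
  carrier := {v | ∀ i, (g i : ℂ) * v i = v i}
  add_mem' := by
    intro a b ha hb i
    simp [mul_add, ha i, hb i]
  zero_mem' := by simp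
  smul_mem' := by
    intro c v hv i
    simp [mul_left_comm, hv i]

/-- The algebra `A_g` of polynomial functions on `Fix(g)`, i.e. polynomials in the coordinates
`xᵢ` fixed by `g`. -/
abbrev FixedPoly {N : ℕ} (g : Fin N → ℂˣ) : Type := MvPolynomial {i : Fin N // g i = 1} ℂ

/-- Restriction `A → A_g` of polynomial functions to `Fix(g)`: the moving coordinates vanish. -/
def restrict {N : ℕ} (g : Fin N → ℂˣ) : PolyAlg N →ₐ[ℂ] FixedPoly g :=
  aeval (fun i => if h : g i = 1 then X ⟨i, h⟩ else 0)

/-- `restrict g f` takes the same values as `f` on `Fix(g)`. -/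
theorem eval_restrict {N : ℕ} (g : Fin N → ℂˣ) (f : PolyAlg N) (v : Fin N → ℂ)
    (hv : v ∈ fixedLocus g) :
    eval (fun i : {i : Fin N // g i = 1} => v i) (restrict g f) = eval v f := by
  have h0 : ∀ i, g i ≠ 1 → v i = 0 := by
    intro i hi
    have h1 : (g i : ℂ) * v i = v i := hv i
    by_contra h
    exact hi (Units.ext (by simpa using mul_right_cancel₀ h (h1.trans (one_mul _).symm)))
  induction f using MvPolynomial.induction_on with
  | C a => simp [restrict]
  | add p q hp hq => simp [hp, hq]
  | mul_X p i hp =>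
    rw [map_mul, map_mul, map_mul, hp]
    congr 1
    by_cases h : g i = 1
    · simp [restrict, h]
    · simp [restrict, h, h0 i h]

/-- The moving index set `I_g` of `g`: the indices `i` with `ᵍxᵢ ≠ xᵢ`. -/
def movingIndices {N : ℕ} (g : Fin N → ℂˣ) : Finset (Fin N) :=
  Finset.univ.filter (fun i => g i ≠ 1)

/-- The number `N - N_g` of moving indices. -/
def codimFix {N : ℕ} (g : Fin N → ℂˣ) : ℕ := (movingIndices g).card

/-- Here `N_g = dim Fix(g)`. -/
theorem finrank_add_codimFix {N : ℕ} (g : Fin N → ℂˣ) :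
    Module.finrank ℂ (fixedLocus g) + codimFix g = N := by
  have h0 : ∀ v ∈ fixedLocus g, ∀ i, g i ≠ 1 → v i = 0 := by
    intro v hv i hi
    have h1 : (g i : ℂ) * v i = v i := hv i
    by_contra h
    exact hi (Units.ext (by simpa using mul_right_cancel₀ h (h1.trans (one_mul _).symm)))
  let e : fixedLocus g ≃ₗ[ℂ] ({i : Fin N // g i = 1} → ℂ) :=
    { toFun := fun v i => v.1 i
      map_add' := fun _ _ => rfl
      map_smul' := fun _ _ => rfl
      invFun := fun w => ⟨fun i => if h : g i = 1 then w ⟨i, h⟩ else 0, fun i => by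
        by_cases h : g i = 1 <;> simp [h]⟩
      left_inv := fun v => by
        ext i; by_cases h : g i = 1 <;> simp [h, h0 v.1 v.2 i]
      right_inv := fun w => by ext i; simp [i.2] }
  rw [e.finrank_eq, Module.finrank_fintype_fun_eq_card, Fintype.card_subtype, codimFix,
    movingIndices, Finset.card_filter_add_card_filter_not]
  simp

/-- The Jacobian ring of a polynomial. -/
abbrev Jac {σ : Type} (f : MvPolynomial σ ℂ) : Type :=
  MvPolynomial σ ℂ ⧸ Ideal.span (Set.range (fun j => pderiv j f))

/-! ## Hochschild cochains with values in the sector `A g`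

A cochain in `Cᵖ(A, A g)` is `φ g` with `φ : A^{⊗ p} → A`; we store `φ`. The bimodule structure
of `A g` inside the crossed product `A[G]` is `a · (b g) · c = (a b ᵍc) g`. -/

/-- `Cᵖ(A, A g) = Hom(A^{⊗ p}, A) g`. -/
abbrev Cochain (N p : ℕ) : Type := MultilinearMap ℂ (fun _ : Fin p => PolyAlg N) (PolyAlg N)

/-! The usual vector space structure on cochains, with the additive monoid derived from the
additive group. -/

instance (N p : ℕ) : AddCommGroup (Cochain N p) := MultilinearMap.instAddCommGroup

instance (N p : ℕ) : AddCommMonoid (Cochain N p) := AddCommGroup.toAddCommMonoid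

instance (N p : ℕ) : Module ℂ (Cochain N p) := MultilinearMap.instModule

theorem contract_update {N p : ℕ} (i : Fin p) (a : Fin (p + 1) → PolyAlg N) (l : Fin (p + 1)) :
    ∃ (k : Fin p) (L : PolyAlg N →ₗ[ℂ] PolyAlg N), ∀ x,
      Fin.contractNth i.castSucc (· * ·) (Function.update a l x) =
        Function.update (Fin.contractNth i.castSucc (· * ·) a) k (L x) := by
  have key : ∀ k : Fin p, ∀ b : Fin (p + 1) → PolyAlg N,
      Fin.contractNth i.castSucc (· * ·) b k =
        if k < i then b k.castSucc else if k = i then b k.castSucc * b k.succ else b k.succ := by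
    intro k b
    simp only [Fin.contractNth, Fin.val_castSucc, Fin.lt_def, Fin.ext_iff]
  rcases lt_trichotomy l i.castSucc with h | h | h
  · refine ⟨⟨l, lt_trans h i.isLt⟩, LinearMap.id, fun x => ?_⟩
    funext k
    rw [Function.update_apply, key, key]
    simp only [Function.update_apply, Fin.lt_def, Fin.ext_iff, Fin.val_castSucc,
      Fin.val_succ, LinearMap.id_apply] at h ⊢
    split_ifs <;> first | rfl | omega
  · refine ⟨i, LinearMap.mulRight ℂ (a i.succ), fun x => ?_⟩
    funext k
    rw [Function.update_apply, key, key]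
    by_cases hk : k = i
    · subst hk; simp [h, Fin.ext_iff]
    · simp only [Function.update_apply, Fin.lt_def, Fin.ext_iff, Fin.val_castSucc,
        Fin.val_succ] at h hk ⊢
      split_ifs <;> first | rfl | omega
  · by_cases h2 : l = i.succ
    · refine ⟨i, LinearMap.mulLeft ℂ (a i.castSucc), fun x => ?_⟩
      funext k
      rw [Function.update_apply, key, key]
      by_cases hk : k = i
      · subst hk; simp [h2, Fin.ext_iff]
      · simp only [Function.update_apply, Fin.lt_def, Fin.ext_iff, Fin.val_castSucc,
          Fin.val_succ] at h h2 hk ⊢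
        split_ifs <;> first | rfl | omega
    · have hl := l.isLt
      refine ⟨⟨(l : ℕ) - 1, by omega⟩, LinearMap.id, fun x => ?_⟩
      funext k
      rw [Function.update_apply, key, key]
      simp only [Function.update_apply, Fin.lt_def, Fin.ext_iff, Fin.val_castSucc,
        Fin.val_succ, LinearMap.id_apply] at h h2 ⊢
      split_ifs <;> first | rfl | omega

/-- The inner face `φ ↦ ((a₀, …, a_p) ↦ φ(a₀, …, aᵢ aᵢ₊₁, …, a_p))`. -/
def innerFace {N p : ℕ} (i : Fin p) (φ : Cochain N p) : Cochain N (p + 1) :=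
  MultilinearMap.mk' (fun a => φ (Fin.contractNth i.castSucc (· * ·) a))
    (fun a l x y => by
      obtain ⟨k, L, h⟩ := contract_update i a l
      simp only [h, map_add, MultilinearMap.map_update_add])
    (fun a l c x => by
      obtain ⟨k, L, h⟩ := contract_update i a l
      simp only [h, map_smul, MultilinearMap.map_update_smul])

/-- The first face `φ ↦ ((a₀, …, a_p) ↦ a₀ φ(a₁, …, a_p))`. -/
def leftFace {N p : ℕ} (φ : Cochain N p) : Cochain N (p + 1) :=
  MultilinearMap.mk' (fun a => a 0 * φ (Fin.tail a))
    (fun a l x y => by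
      cases l using Fin.cases with
      | zero => simp [Fin.tail_update_zero, add_mul]
      | succ l => simp [Fin.tail_update_succ, mul_add, (Fin.succ_ne_zero l).symm])
    (fun a l c x => by
      cases l using Fin.cases with
      | zero => simp [Fin.tail_update_zero]
      | succ l => simp [Fin.tail_update_succ, (Fin.succ_ne_zero l).symm])

/-- The last face `φ ↦ ((a₀, …, a_p) ↦ φ(a₀, …, a_{p-1}) ᵍa_p)`. -/
def rightFace {N p : ℕ} (g : Fin N → ℂˣ) (φ : Cochain N p) : Cochain N (p + 1) :=
  MultilinearMap.mk' (fun a => φ (Fin.init a) * act g (a (Fin.last p)))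
    (fun a l x y => by
      cases l using Fin.lastCases with
      | last => simp [Fin.init_update_last, mul_add]
      | cast l => simp [Fin.init_update_castSucc, add_mul, (Fin.castSucc_lt_last l).ne'])
    (fun a l c x => by
      cases l using Fin.lastCases with
      | last => simp [Fin.init_update_last]
      | cast l => simp [Fin.init_update_castSucc, (Fin.castSucc_lt_last l).ne'])

/-- The Hochschild differential `∂_H : Cᵖ(A, A g) → Cᵖ⁺¹(A, A g)`. -/
def hochschild {N : ℕ} (g : Fin N → ℂˣ) (p : ℕ) : Cochain N p →ₗ[ℂ] Cochain N (p + 1) where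
  toFun φ := leftFace φ + ∑ i : Fin p, (-1 : ℂ) ^ ((i : ℕ) + 1) • innerFace i φ
    + (-1 : ℂ) ^ (p + 1) • rightFace g φ
  map_add' φ ψ := by
    ext1 a
    simp [leftFace, innerFace, rightFace, _root_.sum_apply, mul_add, add_mul,
      Finset.sum_add_distrib]
    ring
  map_smul' c φ := by
    ext1 a
    simp only [leftFace, innerFace, rightFace, _root_.sum_apply, _root_.add_apply,
      _root_.smul_apply, MultilinearMap.mk'_apply, RingHom.id_apply, smul_add,
      Finset.smul_sum, mul_smul_comm, smul_mul_assoc]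
    simp only [smul_comm c]

/-- The curving differential `d_W : Cᵖ⁺¹(A, A g) → Cᵖ(A, A g)`,
`(d_W φ)(a₁, …, a_p) = ∑ᵢ (-1)ⁱ φ(a₁, …, aᵢ, W, aᵢ₊₁, …, a_p)`. -/
def curving {N : ℕ} (W : PolyAlg N) (p : ℕ) : Cochain N (p + 1) →ₗ[ℂ] Cochain N p where
  toFun φ := ∑ i : Fin (p + 1), (-1 : ℂ) ^ (i : ℕ) • φ.curryMid i W
  map_add' φ ψ := by
    rw [← Finset.sum_add_distrib]
    refine Finset.sum_congr rfl fun i _ => ?_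
    rw [← smul_add]; rfl
  map_smul' c φ := by
    rw [RingHom.id_apply, Finset.smul_sum]
    refine Finset.sum_congr rfl fun i _ => ?_
    rw [smul_comm]; rfl

/-- The compact type cochains `C_c(A, A g) = ⨁ₚ Cᵖ(A, A g)`. -/
abbrev CompactCochain (N : ℕ) : Type := ⨁ p : ℕ, Cochain N p

/-- `∂_H` on compact type cochains. -/
def hochschildDiff {N : ℕ} (g : Fin N → ℂˣ) : CompactCochain N →ₗ[ℂ] CompactCochain N :=
  DirectSum.toModule ℂ ℕ _ fun p =>
    DirectSum.lof ℂ ℕ (fun p => Cochain N p) (p + 1) ∘ₗ hochschild g p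

/-- `d_W` on compact type cochains; it vanishes on `C⁰`. -/
def curvingDiff {N : ℕ} (W : PolyAlg N) : CompactCochain N →ₗ[ℂ] CompactCochain N :=
  DirectSum.toModule ℂ ℕ _ fun p =>
    match p with
    | 0 => 0
    | p + 1 => DirectSum.lof ℂ ℕ (fun p => Cochain N p) p ∘ₗ curving W p

/-- The curved Hochschild differential `∂_H + d_W`. -/
def curvedDiff {N : ℕ} (g : Fin N → ℂˣ) (W : PolyAlg N) : CompactCochain N →ₗ[ℂ] CompactCochain N :=
  hochschildDiff g + curvingDiff W

/-- The cocycles of `(C_c(A, A g), ∂_H + d_W)`. -/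
def cocycles {N : ℕ} (g : Fin N → ℂˣ) (W : PolyAlg N) : Submodule ℂ (CompactCochain N) :=
  LinearMap.ker (curvedDiff g W)

/-- The compact type Hochschild cohomology `HH_c(A_W, A_W g)`: cocycles modulo coboundaries. -/
abbrev HHc {N : ℕ} (g : Fin N → ℂˣ) (W : PolyAlg N) : Type :=
  cocycles g W ⧸ (LinearMap.range (curvedDiff g W)).submoduleOf (cocycles g W)

/-- The class of a cocycle. -/
def HHc.cls {N : ℕ} {g : Fin N → ℂˣ} {W : PolyAlg N} (φ : cocycles g W) : HHc g W :=
  Submodule.Quotient.mk φ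

/-- The part of `HH_c(A_W, A_W g)` of parity `s`: classes of cocycles all of whose components
have degree congruent to `s` modulo `2`. -/
def HHc.parityPart {N : ℕ} (g : Fin N → ℂˣ) (W : PolyAlg N) (s : ZMod 2) : Submodule ℂ (HHc g W) where
  carrier := {c | ∃ φ : cocycles g W,
    (∀ p : ℕ, (p : ZMod 2) ≠ s → (φ : CompactCochain N) p = 0) ∧ HHc.cls φ = c}
  add_mem' := by
    rintro _ _ ⟨φ, hφ, rfl⟩ ⟨ψ, hψ, rfl⟩
    exact ⟨φ + ψ, fun p hp => by simp [hφ p hp, hψ p hp], rfl⟩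
  zero_mem' := ⟨0, fun p _ => rfl, rfl⟩
  smul_mem' := by
    rintro c _ ⟨φ, hφ, rfl⟩
    exact ⟨c • φ, fun p hp => by simp [DirectSum.smul_apply, hφ p hp], rfl⟩

/-! ## `ℤ/2`-gradings -/

/-- The `ℤ/2`-grading on `V` for which all of `V` is even. -/
def evenGrading (V : Type) [AddCommGroup V] [Module ℂ V] (s : ZMod 2) : Submodule ℂ V :=
  if s = 0 then ⊤ else ⊥

/-- The degree shift `V[m]`, with `V[m]_s = V_{s + m}`. -/
def shift {V : Type} [AddCommGroup V] [Module ℂ V] (𝒱 : ZMod 2 → Submodule ℂ V) (m : ZMod 2)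
    (s : ZMod 2) : Submodule ℂ V :=
  𝒱 (s + m)

/-! ## The map `Θ_g` -/

/-- `ρᵢ(g)`: act by `g` on the variables before `xᵢ` only. -/
def rho {N : ℕ} (g : Fin N → ℂˣ) (i : Fin N) : PolyAlg N →ₐ[ℂ] PolyAlg N :=
  aeval (fun j => if j < i then C (g j : ℂ) * X j else X j)

/-- The quantum differential operator `∂ᵍ_{xᵢ}`: it sends the monomial `x^γ` to
`(1 + λᵢ + ⋯ + λᵢ^{γᵢ - 1}) x^{γ - eᵢ}`, and to `0` if `γᵢ = 0`. -/
def qderiv {N : ℕ} (g : Fin N → ℂˣ) (i : Fin N) : PolyAlg N →ₗ[ℂ] PolyAlg N :=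
  (basisMonomials (Fin N) ℂ).constr ℂ fun γ =>
    monomial (γ - Finsupp.single i 1) (∑ k ∈ Finset.range (γ i), (g i : ℂ) ^ k)

/-- The increasing enumeration `i₁ < ⋯ < i_{N - N_g}` of the moving indices. -/
def movingIndex {N : ℕ} (g : Fin N → ℂˣ) (k : Fin (codimFix g)) : Fin N :=
  (movingIndices g).orderEmbOfFin rfl k

/-- The Hochschild cochain representing `Θ_g(a)`, for a function `a` on `Fix(g)`: the image of the
Koszul cochain `a e_{i₁} ⋯ e_{i_m} g`, where `m = N - N_g` and `i₁ < ⋯ < i_m` are the moving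
indices, in the Hochschild complex, i.e.
`(a₁, …, a_m) ↦ a ∏ₖ ρ_{iₖ}(g)(∂ᵍ_{x_{iₖ}} aₖ)`. -/
def thetaCochain {N : ℕ} (g : Fin N → ℂˣ) (a : FixedPoly g) : Cochain N (codimFix g) :=
  (rename Subtype.val a : PolyAlg N) •
    (MultilinearMap.mkPiAlgebra ℂ (Fin (codimFix g)) (PolyAlg N)).compLinearMap
      (fun k => (rho g (movingIndex g k)).toLinearMap ∘ₗ qderiv g (movingIndex g k))

/-- The cochain `φ` has no component of degree above `N - N_g`, and its component of degree
`N - N_g` is cohomologous to the representative of `Θ_g(a)` for the differential `∂_H`. -/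
def HasLeadingTerm {N : ℕ} (g : Fin N → ℂˣ) (a : FixedPoly g) (φ : CompactCochain N) : Prop :=
  (∀ p, codimFix g < p → φ p = 0) ∧
    DirectSum.lof ℂ ℕ (fun p => Cochain N p) (codimFix g) (φ (codimFix g) - thetaCochain g a) ∈
      LinearMap.range (hochschildDiff g)

end

end OrbifoldLG
open OrbifoldLG

/-! The argument is a spectral sequence run by hand: `∂_H`-cohomology is computed first, then the
differential that `d_W` induces on it. Write `m = N - N_g`.

The `∂_H`-cohomology with values in `A g` is that of the Koszul complex `A ⊗ Λ(e₁, …, e_N)` with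
differential `∑ (1 - λᵢ) xᵢ eᵢ ∧ -`. Antisymmetrised evaluation on the variables (`toKoszul`) and
iterated cup products with the twisted derivations `ρᵢ(g) ∂ᵍ_{xᵢ}` (`ofKoszul`) are chain maps, and
the composite Koszul → Hochschild → Koszul is the identity in each degree. No homotopy is
constructed for the other composite: `exists_bimodDiff_eq` shows instead, by dimension shifting,
that a closed cochain of positive degree with zero Koszul part is exact. An Euler operator in the
moving directions then contracts the Koszul complex onto `A_g ⊗ Λ(fixed eⱼ) ∧ e_{i₁} ⋯ e_{i_m}`
(`exists_koszulDiff_twistedCommutator_eq`). So the class of a closed cochain of degree `p` is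
recorded by its `leadingPart`, a Koszul cochain on `Fix(g)` of degree `p - m`.

On leading parts of closed cochains `d_W` becomes contraction with `±dW_g` (`leadingPart_curving`):
`ofKoszul` turns `d_W` into contraction with the coefficients `ρⱼ(g) ∂ᵍ_{xⱼ} W`, which restrict to
`∂ⱼ W_g` for fixed `j`. This contraction is exact in positive degree. Indeed, by invariance of `W`,
critical points of `W_g` are critical for `W`; the positive weights contract any critical point to
the origin, so isolatedness leaves only the origin; the Nullstellensatz puts powers of all fixed
coordinates into the Jacobian ideal; and an ideal containing a regular sequence as long as the
number of coordinates has exact contraction complex (`mulCon_exact`). In degree zero the cokernel is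
`Jac(W_g)`.

To assemble these facts, exactness in positive degree removes the components of a cocycle above
degree `m`, starting from the top; this terminates because compact type cochains have finitely many
components. Below degree `m` there are no leading parts, so cocycles living there are exact. Hence
the cocycles of degree at most `m` surject both onto `Jac(W_g)`, by their leading value, and onto
`HH_c`, with the same kernel. This gives `Θ_g` without any choice of representatives. The parity
statement follows because the leading value sees only the component of degree `m`. -/

namespace OrbifoldLG

noncomputable section

/-! ## Koszul cochains -/

section Koszul

variable {ι : Type*} [LinearOrder ι]

/-- The sign `(-1)^{#{l ∈ I : l < i}}`. -/
def koszulSign (i : ι) (I : Finset ι) : ℤ := (-1) ^ (I.filter (· < i)).card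

theorem koszulSign_mul_self (i : ι) (I : Finset ι) : koszulSign i I * koszulSign i I = 1 := by
  rw [koszulSign, ← mul_pow]; simp

theorem koszulSign_insert_of_le {i j : ι} (h : i ≤ j) (I : Finset ι) :
    koszulSign i (insert j I) = koszulSign i I := by
  simp [koszulSign, Finset.filter_insert, not_lt.2 h]

theorem koszulSign_insert_of_lt {i j : ι} (h : j < i) {I : Finset ι} (hj : j ∉ I) :
    koszulSign i (insert j I) = -koszulSign i I := by
  simp [koszulSign, Finset.filter_insert, h, hj, pow_succ]

theorem koszulSign_erase_self (i : ι) (I : Finset ι) :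
    koszulSign i (I.erase i) = koszulSign i I := by
  by_cases h : i ∈ I
  · conv_rhs => rw [← Finset.insert_erase h]
    rw [koszulSign_insert_of_le le_rfl]
  · rw [Finset.erase_eq_of_notMem h]

theorem koszulSign_union (i : ι) {I J : Finset ι} (h : Disjoint I J) :
    koszulSign i (I ∪ J) = koszulSign i I * koszulSign i J := by
  rw [koszulSign, koszulSign, koszulSign, Finset.filter_union, Finset.card_union_of_disjoint, pow_add]
  exact Finset.disjoint_filter_filter h

/-- Only the larger of the two indices counts the other one, so exactly one sign changes. All
anticommutation relations below come from this. -/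
theorem koszulSign_swap {i j : ι} (hij : i ≠ j) {I : Finset ι} (hi : i ∉ I) (hj : j ∉ I) :
    koszulSign i (insert j I) * koszulSign j I = -(koszulSign j (insert i I) * koszulSign i I) := by
  rcases lt_or_gt_of_ne hij with h | h
  · rw [koszulSign_insert_of_le h.le, koszulSign_insert_of_lt h hi]; ring
  · rw [koszulSign_insert_of_le h.le, koszulSign_insert_of_lt h hj]; ring

variable (R : Type*) [CommRing R] {M M' : Type*} [AddCommGroup M] [Module R M]
  [AddCommGroup M'] [Module R M']

/-- Exterior multiplication by `eᵢ`. -/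
def ext (i : ι) : (Finset ι → M) →ₗ[R] (Finset ι → M) where
  toFun k I := if i ∈ I then koszulSign i I • k (I.erase i) else 0
  map_add' k k' := by ext I; by_cases h : i ∈ I <;> simp [h]
  map_smul' c k := by ext I; by_cases h : i ∈ I <;> simp [h, smul_comm c]

/-- Contraction with the covector dual to `eᵢ`. -/
def con (i : ι) : (Finset ι → M) →ₗ[R] (Finset ι → M) where
  toFun k I := if i ∈ I then 0 else koszulSign i I • k (insert i I)
  map_add' k k' := by ext I; by_cases h : i ∈ I <;> simp [h]
  map_smul' c k := by ext I; by_cases h : i ∈ I <;> simp [h, smul_comm c]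

variable {R}

theorem ext_apply (i : ι) (k : Finset ι → M) (I : Finset ι) :
    ext R i k I = if i ∈ I then koszulSign i I • k (I.erase i) else 0 := rfl

theorem con_apply (i : ι) (k : Finset ι → M) (I : Finset ι) :
    con R i k I = if i ∈ I then 0 else koszulSign i I • k (insert i I) := rfl

theorem ext_comp (f : M →ₗ[R] M') (i : ι) (k : Finset ι → M) :
    ext R i (f ∘ k) = f ∘ ext R i k := by
  ext I; by_cases h : i ∈ I <;> simp [ext_apply, h]

theorem con_comp (f : M →ₗ[R] M') (i : ι) (k : Finset ι → M) :
    con R i (f ∘ k) = f ∘ con R i k := by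
  ext I; by_cases h : i ∈ I <;> simp [con_apply, h]

/-- Together with `con_ext_of_ne`, `ext_ext` and `con_con`, these are the canonical anticommutation
relations of the exterior algebra, for coefficients in an arbitrary module. -/
theorem con_ext_self (i : ι) (k : Finset ι → M) :
    con R i (ext R i k) + ext R i (con R i k) = k := by
  ext I
  by_cases h : i ∈ I
  · simp [con_apply, ext_apply, h, smul_smul, koszulSign_erase_self, koszulSign_mul_self]
  · simp [con_apply, ext_apply, h, smul_smul, koszulSign_insert_of_le, koszulSign_mul_self]

theorem con_ext_of_ne {i j : ι} (hij : i ≠ j) (k : Finset ι → M) :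
    con R j (ext R i k) + ext R i (con R j k) = 0 := by
  ext I
  by_cases hi : i ∈ I
  · by_cases hj : j ∈ I
    · simp [con_apply, ext_apply, hi, hj, hij.symm]
    · obtain ⟨I, hi', rfl⟩ : ∃ I', i ∉ I' ∧ I = insert i I' :=
        ⟨I.erase i, by simp, by simp [hi]⟩
      have hj' : j ∉ I := fun h => hj (by simp [h])
      have := koszulSign_swap hij hi' hj'
      simp only [con_apply, ext_apply, hj, Pi.add_apply, Pi.zero_apply]
      rw [Finset.insert_comm, Finset.erase_insert (by simp [hij, hi']), Finset.erase_insert hi']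
      simp only [Finset.mem_insert_self, if_true, hj', if_false, smul_smul, ← add_smul]
      rw [koszulSign_insert_of_le le_rfl, koszulSign_insert_of_le le_rfl]
      convert zero_smul ℤ _
      linear_combination (koszulSign i (insert j I) * koszulSign i I) * this
        - (koszulSign j I * koszulSign i I) * koszulSign_mul_self i (insert j I)
        - (koszulSign j (insert i I) * koszulSign i (insert j I)) * koszulSign_mul_self i I
  · by_cases hj : j ∈ I <;> simp [con_apply, ext_apply, hi, hj, hij]

theorem ext_ext (i j : ι) (k : Finset ι → M) :
    ext R i (ext R j k) = -ext R j (ext R i k) := by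
  ext I
  by_cases hij : i = j
  · subst hij; simp [ext_apply]
  by_cases hi : i ∈ I
  · by_cases hj : j ∈ I
    · obtain ⟨I, hi', hj', rfl⟩ : ∃ I', i ∉ I' ∧ j ∉ I' ∧ I = insert i (insert j I') :=
        ⟨(I.erase i).erase j, by simp, by simp, by
          rw [Finset.insert_erase (by simp [hj, Ne.symm hij]), Finset.insert_erase hi]⟩
      have := koszulSign_swap hij hi' hj'
      simp only [ext_apply, Pi.neg_apply]
      have e1 : (insert i (insert j I)).erase i = insert j I :=
        Finset.erase_insert (by simp [hij, hi'])
      have e2 : (insert i (insert j I)).erase j = insert i I := by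
        rw [Finset.insert_comm, Finset.erase_insert (by simp [Ne.symm hij, hj'])]
      simp only [hi, hj, if_true, e1, e2, Finset.mem_insert_self, Finset.erase_insert hi',
        Finset.erase_insert hj', smul_smul, ← neg_smul]
      congr 1
      rw [← koszulSign_erase_self i (insert i _), ← koszulSign_erase_self j (insert j I),
        ← koszulSign_erase_self i (insert i I), ← koszulSign_erase_self j (insert i (insert j I)), e1, e2,
        Finset.erase_insert hi', Finset.erase_insert hj']
      linear_combination this
    · simp [ext_apply, hj]
  · simp [ext_apply, hi]

theorem con_con (i j : ι) (k : Finset ι → M) :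
    con R i (con R j k) = -con R j (con R i k) := by
  ext I
  by_cases hij : i = j
  · subst hij; simp [con_apply]
  by_cases hi : i ∈ I
  · simp [con_apply, hi]
  by_cases hj : j ∈ I
  · simp [con_apply, hj]
  have := koszulSign_swap hij hi hj
  simp only [con_apply, hi, hj, if_false, Finset.mem_insert, hij, Ne.symm hij, or_false, smul_smul,
    Pi.neg_apply, ← neg_smul, Finset.insert_comm i j]
  congr 1
  linear_combination this

/-- `k` is concentrated in degree `p`. -/
def IsHomogeneousOfDegree (p : ℕ) (k : Finset ι → M) : Prop := ∀ I, k I ≠ 0 → I.card = p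

theorem IsHomogeneousOfDegree.con {p : ℕ} {k : Finset ι → M} (hk : IsHomogeneousOfDegree (p + 1) k)
    (i : ι) : IsHomogeneousOfDegree p (con R i k) := by
  intro I hI
  rw [con_apply] at hI
  split_ifs at hI with h
  · exact absurd rfl hI
  · have := hk _ (fun h0 => hI (by rw [h0, smul_zero]))
    rw [Finset.card_insert_of_notMem h] at this
    omega

theorem IsHomogeneousOfDegree.con_eq_zero {k : Finset ι → M} (hk : IsHomogeneousOfDegree 0 k)
    (i : ι) : OrbifoldLG.con R i k = 0 := by
  ext I
  rw [con_apply]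
  split_ifs with h
  · rfl
  · by_contra h0
    have := hk (insert i I) (fun h1 => h0 (by simp [h1]))
    simp at this

theorem IsHomogeneousOfDegree.ext {p : ℕ} {k : Finset ι → M} (hk : IsHomogeneousOfDegree p k)
    (i : ι) : IsHomogeneousOfDegree (p + 1) (ext R i k) := by
  intro I hI
  rw [ext_apply] at hI
  split_ifs at hI with h
  · have := hk _ (fun h0 => hI (by rw [h0, smul_zero]))
    rw [Finset.card_erase_of_mem h] at this
    have := Finset.card_pos.2 ⟨i, h⟩
    omega
  · exact absurd rfl hI

omit [LinearOrder ι] in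
theorem IsHomogeneousOfDegree.comp {p : ℕ} {k : Finset ι → M} (hk : IsHomogeneousOfDegree p k)
    (f : M →ₗ[R] M') : IsHomogeneousOfDegree p (f ∘ k) :=
  fun I hI => hk I fun h => hI (by simp [h])

omit [LinearOrder ι] in
theorem IsHomogeneousOfDegree.sum {p : ℕ} {α : Type*} {s : Finset α} {k : α → Finset ι → M}
    (hk : ∀ a ∈ s, IsHomogeneousOfDegree p (k a)) : IsHomogeneousOfDegree p (∑ a ∈ s, k a) := by
  intro I hI
  rw [Finset.sum_apply] at hI
  obtain ⟨a, ha, h⟩ := Finset.exists_ne_zero_of_sum_ne_zero hI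
  exact hk a ha I h

/-! ### Koszul differentials and contractions for families of operators -/

section Euler

variable [Fintype ι] (T H : ι → Module.End R M)

/-- The Koszul differential `∑ᵢ Tᵢ eᵢ ∧ -` of a family of operators. -/
def koszulDiff : (Finset ι → M) →ₗ[R] (Finset ι → M) :=
  ∑ i, (T i).compLeft (Finset ι) ∘ₗ ext R i

/-- The contraction `∑ᵢ Hᵢ eᵢ^* ⌟ -` with a family of operators. -/
def koszulCon : (Finset ι → M) →ₗ[R] (Finset ι → M) :=
  ∑ i, (H i).compLeft (Finset ι) ∘ₗ con R i

theorem koszulDiff_apply (k : Finset ι → M) (I : Finset ι) :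
    koszulDiff T k I = ∑ i ∈ I, koszulSign i I • T i (k (I.erase i)) := by
  simp only [koszulDiff, LinearMap.sum_apply, Finset.sum_apply, LinearMap.comp_apply,
    LinearMap.compLeft_apply, Function.comp_apply, ext_apply]
  rw [← Finset.sum_subset (Finset.subset_univ I) (fun i _ hi => by simp [hi])]
  exact Finset.sum_congr rfl fun i hi => by simp [hi]

theorem koszulCon_apply (k : Finset ι → M) (I : Finset ι) :
    koszulCon H k I = ∑ i ∈ Iᶜ, koszulSign i I • H i (k (insert i I)) := by
  simp only [koszulCon, LinearMap.sum_apply, Finset.sum_apply, LinearMap.comp_apply,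
    LinearMap.compLeft_apply, Function.comp_apply, con_apply]
  rw [← Finset.sum_subset (Finset.subset_univ Iᶜ) (fun i _ hi => by
    rw [Finset.notMem_compl] at hi; simp [hi])]
  exact Finset.sum_congr rfl fun i hi => by rw [Finset.mem_compl] at hi; simp [hi]

/-- The terms `(i, j)` and `(j, i)` cancel, as the operators commute and the `eᵢ` anticommute; the
diagonal terms contain `eᵢ ∧ eᵢ`. -/
theorem koszulDiff_koszulDiff (hT : ∀ i j, T i * T j = T j * T i) (k : Finset ι → M) :
    koszulDiff T (koszulDiff T k) = 0 := by
  simp only [koszulDiff, LinearMap.sum_apply, LinearMap.comp_apply, map_sum]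
  rw [← Fintype.sum_prod_type']
  have key : ∀ i j, T i ∘ ext R i (T j ∘ ext R j k) + T j ∘ ext R j (T i ∘ ext R i k) = 0 := by
    intro i j
    rw [ext_comp, ext_comp, ext_ext]
    funext I
    have := LinearMap.congr_fun (hT i j) (ext R j (ext R i k) I)
    simp only [Module.End.mul_apply] at this
    simp [this]
  refine Finset.sum_involution (fun a _ => a.swap) (fun a _ => key _ _) (fun a _ ha h => ?_)
    (fun _ _ => Finset.mem_univ _) (fun _ _ => rfl)
  obtain ⟨i, j⟩ := a
  obtain rfl : j = i := congrArg Prod.fst h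
  refine ha ?_
  change T j ∘ ext R j (T j ∘ ext R j k) = 0
  rw [ext_comp]
  funext I
  simp [ext_apply]

theorem koszulCon_koszulCon (hH : ∀ i j, H i * H j = H j * H i) (k : Finset ι → M) :
    koszulCon H (koszulCon H k) = 0 := by
  simp only [koszulCon, LinearMap.sum_apply, LinearMap.comp_apply, map_sum]
  rw [← Fintype.sum_prod_type']
  have key : ∀ i j, H i ∘ con R i (H j ∘ con R j k) + H j ∘ con R j (H i ∘ con R i k) = 0 := by
    intro i j
    rw [con_comp, con_comp, con_con]
    funext I
    have := LinearMap.congr_fun (hH i j) (con R j (con R i k) I)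
    simp only [Module.End.mul_apply] at this
    simp [this]
  refine Finset.sum_involution (fun a _ => a.swap) (fun a _ => key _ _) (fun a _ ha h => ?_)
    (fun _ _ => Finset.mem_univ _) (fun _ _ => rfl)
  obtain ⟨i, j⟩ := a
  obtain rfl : j = i := congrArg Prod.fst h
  refine ha ?_
  change H j ∘ con R j (H j ∘ con R j k) = 0
  rw [con_comp]
  funext I
  simp [con_apply]

theorem IsHomogeneousOfDegree.koszulDiff {p : ℕ} {k : Finset ι → M}
    (hk : IsHomogeneousOfDegree p k) : IsHomogeneousOfDegree (p + 1) (koszulDiff T k) := by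
  rw [OrbifoldLG.koszulDiff, LinearMap.sum_apply]
  exact .sum fun i _ => (hk.ext i).comp (T i)

theorem IsHomogeneousOfDegree.koszulCon {p : ℕ} {k : Finset ι → M}
    (hk : IsHomogeneousOfDegree (p + 1) k) : IsHomogeneousOfDegree p (koszulCon H k) := by
  rw [OrbifoldLG.koszulCon, LinearMap.sum_apply]
  exact .sum fun i _ => (hk.con i).comp (H i)

theorem IsHomogeneousOfDegree.koszulCon_eq_zero {k : Finset ι → M}
    (hk : IsHomogeneousOfDegree 0 k) : OrbifoldLG.koszulCon H k = 0 := by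
  rw [OrbifoldLG.koszulCon, LinearMap.sum_apply]
  refine Finset.sum_eq_zero fun i _ => ?_
  rw [LinearMap.comp_apply, hk.con_eq_zero, map_zero]

/-- The operator `eᵢ ∧ (eᵢ^* ⌟ -)` is the projection onto the components whose index set contains
`i`. -/
theorem sum_ext_con (c : ι → R) (k : Finset ι → M) (I : Finset ι) :
    ∑ i, c i • ext R i (con R i k) I = (∑ i ∈ I, c i) • k I := by
  rw [← Finset.sum_subset (Finset.subset_univ I) (fun i _ hi => by simp [ext_apply, hi]),
    Finset.sum_smul]
  refine Finset.sum_congr rfl fun i hi => ?_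
  simp [ext_apply, con_apply, hi, smul_smul, koszulSign_erase_self, koszulSign_mul_self]

/-- The Euler operator of a family `Tᵢ` with canonically conjugate `Hᵢ`. -/
theorem koszulDiff_koszulCon (c : ι → R)
    (hTH : ∀ i j, T i * H j = H j * T i + if i = j then algebraMap R (Module.End R M) (c i) else 0)
    (k : Finset ι → M) (I : Finset ι) :
    (koszulDiff T (koszulCon H k) + koszulCon H (koszulDiff T k)) I =
      ∑ i, H i (T i (k I)) + (∑ i ∈ I, c i) • k I := by
  -- Off the diagonal the operators commute while `eᵢ` and `eⱼ^*` anticommute, so nothing survives;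
  -- on the diagonal the commutator `cᵢ` of `Tᵢ` and `Hᵢ` is left over.
  have h1 : ∀ i j, T i ∘ ext R i (H j ∘ con R j k) + H j ∘ con R j (T i ∘ ext R i k) =
      if i = j then H i ∘ T i ∘ k + c i • ext R i (con R i k) else 0 := by
    intro i j
    rw [ext_comp, con_comp]
    funext J
    have h := LinearMap.congr_fun (hTH i j) (ext R i (con R j k) J)
    split_ifs at h ⊢ with hij
    · subst hij
      have h3 := congrFun (con_ext_self (R := R) i k) J
      simp only [Module.End.mul_apply, LinearMap.add_apply, Module.algebraMap_end_apply] at h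
      simp only [Pi.add_apply, Function.comp_apply, Pi.smul_apply] at h3 ⊢
      rw [h, ← h3, map_add, map_add]
      abel
    · have h3 := congrFun (con_ext_of_ne (R := R) hij k) J
      simp only [Module.End.mul_apply, add_zero] at h
      simp only [Pi.add_apply, Function.comp_apply, Pi.zero_apply] at h3 ⊢
      rw [h, add_comm, ← map_add, ← map_add, h3, map_zero, map_zero]
  have h2 : koszulDiff T (koszulCon H k) + koszulCon H (koszulDiff T k) =
      ∑ i, ∑ j, (T i ∘ ext R i (H j ∘ con R j k) + H j ∘ con R j (T i ∘ ext R i k)) := by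
    simp only [koszulDiff, koszulCon, LinearMap.sum_apply, LinearMap.comp_apply, map_sum,
      Finset.sum_add_distrib]
    congr 1
    exact Finset.sum_comm
  rw [h2]
  simp only [h1, Finset.sum_ite_eq, Finset.mem_univ, if_true, Finset.sum_apply, Pi.add_apply,
    Finset.sum_add_distrib, Pi.smul_apply, sum_ext_con, Function.comp_apply]

/-- A closed Koszul cochain in the range of the Euler operator is exact. -/
theorem exists_koszulDiff_eq (hT : ∀ i j, T i * T j = T j * T i) {k v : Finset ι → M}
    (hk : koszulDiff T k = 0)
    (hv : koszulDiff T (koszulCon H v) + koszulCon H (koszulDiff T v) = k)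
    (hinj : koszulDiff T (koszulCon H (koszulDiff T v)) = 0 → koszulDiff T v = 0) :
    koszulDiff T (koszulCon H v) = k := by
  -- Applying the differential to `hv` gives exactly the premise of `hinj`; so `v` is itself closed
  -- and the second term of `hv` drops out.
  rw [← hv, map_add, koszulDiff_koszulDiff T hT, zero_add] at hk
  rw [← hv, hinj hk, map_zero, add_zero]

end Euler
end Koszul

/-! ## Hochschild cochains with values in a bimodule -/

section HochschildCochains

variable {k A M M' : Type*} [Field k] [CommRing A] [Algebra k A] [AddCommGroup M] [Module k M]
  [AddCommGroup M'] [Module k M']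

variable (k A M) in
/-- Hochschild cochains of degree `p`. -/
abbrev HC (p : ℕ) : Type _ := MultilinearMap k (fun _ : Fin p => A) M

/-- Currying the first variable. -/
def cur (p : ℕ) : HC k A M (p + 1) ≃ₗ[k] (A →ₗ[k] HC k A M p) :=
  multilinearCurryLeftEquiv k (fun _ : Fin (p + 1) => A) M

/-- Cochains of degree zero are elements of the bimodule. -/
def const : M ≃ₗ[k] HC k A M 0 := MultilinearMap.constLinearEquivOfIsEmpty k k (fun _ => A) M

theorem cur_apply (p : ℕ) (φ : HC k A M (p + 1)) (a : A) (v : Fin p → A) :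
    cur p φ a v = φ (Fin.cons a v) := rfl

theorem cur_ext {p : ℕ} {φ ψ : HC k A M (p + 1)} (h : ∀ a, cur p φ a = cur p ψ a) : φ = ψ :=
  (cur p).injective (LinearMap.ext h)

theorem cur_zsmul (p : ℕ) (n : ℤ) (φ : HC k A M (p + 1)) (a : A) :
    cur p (n • φ) a = n • cur p φ a := rfl

/-- Composition of a cochain with a linear map of coefficients. -/
def push (h : M →ₗ[k] M') (p : ℕ) : HC k A M p →ₗ[k] HC k A M' p where
  toFun φ := h.compMultilinearMap φ
  map_add' φ ψ := by ext; simp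
  map_smul' t φ := by ext; simp

@[simp] theorem push_apply (h : M →ₗ[k] M') (p : ℕ) (φ : HC k A M p) (v : Fin p → A) :
    push h p φ v = h (φ v) := rfl

@[simp] theorem cur_push (h : M →ₗ[k] M') (p : ℕ) (φ : HC k A M (p + 1)) (a : A) :
    cur p (push h (p + 1) φ) a = push h p (cur p φ a) := rfl

@[simp] theorem push_const (h : M →ₗ[k] M') (m : M) :
    push h 0 (const m : HC k A M 0) = const (h m) := rfl

/-- Multiplication of the first variable by `a`. -/
def mulFirst (p : ℕ) (a : A) : HC k A M (p + 1) →ₗ[k] HC k A M (p + 1) :=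
  (cur p).symm.toLinearMap ∘ₗ LinearMap.lcomp k _ (LinearMap.mulLeft k a) ∘ₗ (cur p).toLinearMap

@[simp] theorem cur_mulFirst (p : ℕ) (a b : A) (φ : HC k A M (p + 1)) :
    cur p (mulFirst p a φ) b = cur p φ (a * b) := by
  simp [mulFirst]

theorem mulFirst_add (p : ℕ) (a b : A) (φ : HC k A M (p + 1)) :
    mulFirst p (a + b) φ = mulFirst p a φ + mulFirst p b φ :=
  cur_ext fun c => by simp [add_mul]

theorem mulFirst_smul (p : ℕ) (t : k) (a : A) (φ : HC k A M (p + 1)) :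
    mulFirst p (t • a) φ = t • mulFirst p a φ :=
  cur_ext fun c => by simp

/-- The part of the Hochschild differential which does not involve the left action, up to sign. -/
def rightPart (r : A →ₗ[k] Module.End k M) : ∀ p, HC k A M p →ₗ[k] HC k A M (p + 1)
  | 0 => (cur 0).symm.toLinearMap ∘ₗ
      (LinearMap.mk₂ k (fun m a => const (r a m)) (by simp) (by simp) (by simp) (by simp)) ∘ₗ
      (const (k := k) (A := A) (M := M)).symm.toLinearMap
  | p + 1 => (cur (p + 1)).symm.toLinearMap ∘ₗ
      LinearMap.mk₂ k (fun φ a => mulFirst p a φ - rightPart r p (cur p φ a))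
        (fun φ ψ a => by simp only [map_add, LinearMap.add_apply]; abel)
        (fun t φ a => by simp only [map_smul, LinearMap.smul_apply, smul_sub])
        (fun φ a b => by simp only [mulFirst_add, map_add]; abel)
        (fun t φ a => by simp only [mulFirst_smul, map_smul, smul_sub])

@[simp] theorem cur_rightPart_zero (r : A →ₗ[k] Module.End k M) (m : M) (a : A) :
    cur 0 (rightPart r 0 (const m)) a = const (r a m) := by
  simp [rightPart]

@[simp] theorem cur_rightPart_succ (r : A →ₗ[k] Module.End k M) (p : ℕ) (φ : HC k A M (p + 1))
    (a : A) : cur (p + 1) (rightPart r (p + 1) φ) a = mulFirst p a φ - rightPart r p (cur p φ a) := by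
  simp [rightPart]

/-- The Hochschild differential with values in a bimodule. -/
def bimodDiff (l r : A →ₗ[k] Module.End k M) (p : ℕ) : HC k A M p →ₗ[k] HC k A M (p + 1) :=
  (cur p).symm.toLinearMap ∘ₗ
    LinearMap.mk₂ k (fun φ a => push (l a) p φ) (by simp) (by simp)
      (fun φ a b => by ext v; simp) (fun t φ a => by ext v; simp) - rightPart r p

@[simp] theorem cur_bimodDiff (l r : A →ₗ[k] Module.End k M) (p : ℕ) (φ : HC k A M p) (a : A) :
    cur p (bimodDiff l r p φ) a = push (l a) p φ - cur p (rightPart r p φ) a := by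
  simp [bimodDiff]

/-- Alternating insertion of `w`. -/
def insertion (w : A) : ∀ p, HC k A M (p + 1) →ₗ[k] HC k A M p
  | 0 => LinearMap.applyₗ w ∘ₗ (cur 0).toLinearMap
  | p + 1 => LinearMap.applyₗ w ∘ₗ (cur (p + 1)).toLinearMap -
      (cur p).symm.toLinearMap ∘ₗ LinearMap.compRight k (insertion w p) ∘ₗ (cur (p + 1)).toLinearMap

theorem insertion_zero (w : A) (φ : HC k A M 1) : insertion w 0 φ = cur 0 φ w := rfl

@[simp] theorem cur_insertion_succ (w : A) (p : ℕ) (φ : HC k A M (p + 2)) (a : A) :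
    cur p (insertion w (p + 1) φ) a = cur p (cur (p + 1) φ w) a - insertion w p (cur (p + 1) φ a) := by
  simp [insertion]

/-- Cup product with a cochain of degree one. -/
def cup (c : A →ₗ[k] Module.End k M) : ∀ p, HC k A M p →ₗ[k] HC k A M (p + 1)
  | 0 => (cur 0).symm.toLinearMap ∘ₗ
      (LinearMap.mk₂ k (fun m a => const (c a m)) (by simp) (by simp) (by simp) (by simp)) ∘ₗ
      (const (k := k) (A := A) (M := M)).symm.toLinearMap
  | p + 1 => (cur (p + 1)).symm.toLinearMap ∘ₗ LinearMap.compRight k (cup c p) ∘ₗ (cur p).toLinearMap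

@[simp] theorem cur_cup_zero (c : A →ₗ[k] Module.End k M) (m : M) (a : A) :
    cur 0 (cup c 0 (const m)) a = const (c a m) := by
  simp [cup]

@[simp] theorem cur_cup_succ (c : A →ₗ[k] Module.End k M) (p : ℕ) (φ : HC k A M (p + 1)) (a : A) :
    cur (p + 1) (cup c (p + 1) φ) a = cup c p (cur p φ a) := by
  simp [cup]

theorem exists_const (φ : HC k A M 0) : ∃ m, φ = const m :=
  ⟨const.symm φ, by simp⟩

variable (l r r' c : A →ₗ[k] Module.End k M)

theorem rightPart_push {r' : A →ₗ[k] Module.End k M'} (h : M →ₗ[k] M')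
    (hr : ∀ a m, h (r a m) = r' a (h m)) (p : ℕ) (φ : HC k A M p) :
    rightPart r' p (push h p φ) = push h (p + 1) (rightPart r p φ) := by
  induction p with
  | zero =>
    obtain ⟨m, rfl⟩ := exists_const φ
    exact cur_ext fun a => by simp [hr]
  | succ p ih =>
    refine cur_ext fun a => ?_
    simp only [cur_rightPart_succ, cur_push, ih, map_sub]
    rfl

theorem bimodDiff_push {l' r' : A →ₗ[k] Module.End k M'} (h : M →ₗ[k] M')
    (hl : ∀ a m, h (l a m) = l' a (h m)) (hr : ∀ a m, h (r a m) = r' a (h m)) (p : ℕ)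
    (φ : HC k A M p) :
    bimodDiff l' r' p (push h p φ) = push h (p + 1) (bimodDiff l r p φ) := by
  refine cur_ext fun a => ?_
  simp only [cur_bimodDiff, cur_push, rightPart_push r h hr, map_sub]
  congr 1
  ext v
  simp [hl]

theorem insertion_push (h : M →ₗ[k] M') (w : A) (p : ℕ) (φ : HC k A M (p + 1)) :
    insertion w p (push h (p + 1) φ) = push h p (insertion w p φ) := by
  induction p with
  | zero => rfl
  | succ p ih => exact cur_ext fun a => by simp [ih]

/-- The assignment `φ · a := cur (rightPart φ) a` is a right action of `A` on cochains. With `push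
(l a)` as left action, the Hochschild differential is the inner derivation `a ↦ a φ - φ · a`. -/
theorem rightPart_rightPart (hr : ∀ a b m, r (a * b) m = r b (r a m)) (p : ℕ) (φ : HC k A M p)
    (a b : A) : cur p (rightPart r p φ) (a * b) =
      cur p (rightPart r p (cur p (rightPart r p φ) a)) b := by
  induction p generalizing a b with
  | zero =>
    obtain ⟨m, rfl⟩ := exists_const φ
    simp [hr]
  | succ p ih =>
    refine cur_ext fun c => ?_
    simp only [cur_rightPart_succ, map_sub, LinearMap.sub_apply, cur_mulFirst, mul_assoc, ih]
    abel

/-- In the curried picture this says that an inner derivation satisfies the Leibniz rule. -/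
theorem bimodDiff_bimodDiff (hl : ∀ a b m, l (a * b) m = l a (l b m))
    (hr : ∀ a b m, r (a * b) m = r b (r a m)) (hlr : ∀ a b m, l a (r b m) = r b (l a m)) (p : ℕ)
    (φ : HC k A M p) : bimodDiff l r (p + 1) (bimodDiff l r p φ) = 0 := by
  refine cur_ext fun a => cur_ext fun b => ?_
  have h1 : push (l (a * b)) p φ = push (l a) p (push (l b) p φ) := by ext v; simp [hl]
  simp only [cur_bimodDiff, cur_rightPart_succ, map_sub, LinearMap.sub_apply, cur_mulFirst, map_zero,
    LinearMap.zero_apply, cur_push, h1, rightPart_rightPart r hr,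
    rightPart_push r (l a) (hlr a)]
  abel

/-- Inserting `w` just before and just after an argument `a` produces the products `w a` and `a w`
with opposite signs; they cancel because `A` is commutative. Only `w` in the last slot, acting from
the right, survives. -/
theorem insertion_rightPart (w : A) (p : ℕ) (φ : HC k A M (p + 1)) :
    insertion w (p + 1) (rightPart r (p + 1) φ) + rightPart r p (insertion w p φ) =
      push (r w) (p + 1) φ := by
  induction p with
  | zero =>
    refine cur_ext fun a => ?_
    obtain ⟨m, hm⟩ := exists_const (cur 0 φ w)
    obtain ⟨m', hm'⟩ := exists_const (cur 0 φ a)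
    simp [insertion_zero, hm, hm', mul_comm]
  | succ p ih =>
    refine cur_ext fun a => ?_
    rw [cur_push, ← ih (cur (p + 1) φ a)]
    refine cur_ext fun c => ?_
    simp only [map_add, LinearMap.add_apply, cur_insertion_succ, cur_rightPart_succ, map_sub,
      LinearMap.sub_apply, cur_mulFirst, mul_comm w a]
    abel

theorem insertion_rightPart_zero (w : A) (φ : HC k A M 0) :
    insertion w 0 (rightPart r 0 φ) = push (r w) 0 φ := by
  obtain ⟨m, rfl⟩ := exists_const φ
  simp [insertion_zero]

/-- The anticommutator of the two differentials is the commutator with `w`. It vanishes as soon as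
`w` acts in the same way from both sides, which is where invariance of `W` enters. -/
theorem insertion_bimodDiff (w : A) (p : ℕ) (φ : HC k A M (p + 1)) :
    insertion w (p + 1) (bimodDiff l r (p + 1) φ) + bimodDiff l r p (insertion w p φ) =
      push (l w) (p + 1) φ - push (r w) (p + 1) φ := by
  rw [← insertion_rightPart r]
  refine cur_ext fun a => ?_
  simp only [map_add, LinearMap.add_apply, cur_insertion_succ, cur_bimodDiff, cur_push, map_sub,
      LinearMap.sub_apply, insertion_push]
  abel

theorem insertion_bimodDiff_zero (w : A) (φ : HC k A M 0) :
    insertion w 0 (bimodDiff l r 0 φ) = push (l w) 0 φ - push (r w) 0 φ := by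
  rw [insertion_zero, cur_bimodDiff, ← insertion_zero, insertion_rightPart_zero]

theorem insertion_insertion (w : A) (p : ℕ) (φ : HC k A M (p + 2)) :
    insertion w p (insertion w (p + 1) φ) = 0 := by
  induction p with
  | zero => rw [insertion_zero, cur_insertion_succ, insertion_zero, sub_self]
  | succ p ih =>
    refine cur_ext fun a => ?_
    simp [ih]

theorem insertion_cup (w : A) (p : ℕ) (φ : HC k A M (p + 1)) :
    insertion w (p + 1) (cup c (p + 1) φ) =
      cup c p (insertion w p φ) + (-1 : ℤ) ^ (p + 1) • push (c w) (p + 1) φ := by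
  induction p with
  | zero =>
    refine cur_ext fun a => ?_
    obtain ⟨m, hm⟩ := exists_const (cur 0 φ w)
    obtain ⟨m', hm'⟩ := exists_const (cur 0 φ a)
    simp [insertion_zero, hm, hm', sub_eq_add_neg]
  | succ p ih =>
    refine cur_ext fun a => ?_
    simp only [map_add, LinearMap.add_apply, cur_insertion_succ, cur_cup_succ, ih, map_sub,
      map_neg, LinearMap.neg_apply, cur_zsmul, cur_push, pow_succ _ (p + 1), mul_neg_one, neg_smul]
    abel

theorem insertion_cup_zero (w : A) (φ : HC k A M 0) :
    insertion w 0 (cup c 0 φ) = push (c w) 0 φ := by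
  obtain ⟨m, rfl⟩ := exists_const φ
  simp [insertion_zero]

theorem push_cup (h : M →ₗ[k] M) (hc : ∀ a m, h (c a m) = c a (h m)) (p : ℕ) (φ : HC k A M p) :
    push h (p + 1) (cup c p φ) = cup c p (push h p φ) := by
  induction p with
  | zero =>
    obtain ⟨m, rfl⟩ := exists_const φ
    exact cur_ext fun a => by simp [hc]
  | succ p ih => exact cur_ext fun a => by simp [ih]

/-- The map `c` is a twisted derivation between two different right actions, so the cup product with
`c` is a chain map that changes the bimodule from `r` to `r'`. -/
theorem rightPart_cup (hc : ∀ a b m, c (a * b) m = c b (r a m) + r' b (c a m)) (p : ℕ)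
    (φ : HC k A M p) : rightPart r' (p + 1) (cup c p φ) = cup c (p + 1) (rightPart r p φ) := by
  induction p with
  | zero =>
    obtain ⟨m, rfl⟩ := exists_const φ
    refine cur_ext fun a => cur_ext fun b => ?_
    simp [hc]
  | succ p ih =>
    refine cur_ext fun a => ?_
    simp only [cur_cup_succ, cur_rightPart_succ, map_sub, ih]
    congr 1

theorem bimodDiff_cup (hc : ∀ a b m, c (a * b) m = c b (r a m) + r' b (c a m))
    (hl : ∀ a b m, l a (c b m) = c b (l a m)) (p : ℕ) (φ : HC k A M p) :
    bimodDiff l r' (p + 1) (cup c p φ) = cup c (p + 1) (bimodDiff l r p φ) := by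
  refine cur_ext fun a => ?_
  rw [cur_cup_succ, cur_bimodDiff, cur_bimodDiff, rightPart_cup r r' c hc, cur_cup_succ, map_sub,
    push_cup c (l a) (hl a)]

/-- The right action occurs only in the last face, and that face is a cup product up to sign. -/
theorem bimodDiff_change (hrr : ∀ a m, r a m - r' a m = c a m) (p : ℕ) (φ : HC k A M p) :
    bimodDiff l r' p φ = bimodDiff l r p φ + (-1 : ℤ) ^ p • cup c p φ := by
  have key : rightPart r p φ - rightPart r' p φ = (-1 : ℤ) ^ p • cup c p φ := by
    induction p with
    | zero =>
      obtain ⟨m, rfl⟩ := exists_const φ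
      refine cur_ext fun a => ?_
      simp [← hrr]
    | succ p ih =>
      refine cur_ext fun a => ?_
      simp only [map_sub, LinearMap.sub_apply, cur_rightPart_succ, map_neg, LinearMap.neg_apply, cur_zsmul,
        cur_cup_succ, pow_succ, mul_neg_one, neg_smul, ← ih (cur p φ a)]
      abel
  rw [← key]
  refine cur_ext fun a => ?_
  simp only [map_add, map_sub, LinearMap.add_apply, LinearMap.sub_apply, cur_bimodDiff]
  abel

theorem cup_apply (p : ℕ) (φ : HC k A M p) (v : Fin (p + 1) → A) :
    cup c p φ v = c (v (Fin.last p)) (φ (Fin.init v)) := by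
  induction p with
  | zero =>
    obtain ⟨m, rfl⟩ := exists_const φ
    rw [← Fin.cons_self_tail v, ← cur_apply, cur_cup_zero]
    rfl
  | succ p ih =>
    rw [← Fin.cons_self_tail v, ← cur_apply, cur_cup_succ, ih, cur_apply]
    congr 2
    ext i
    cases i using Fin.cases <;> rfl

/-- This unrolls the recursion on the first variable, in order to match the recursive differential
with the face-by-face one of the statement. -/
theorem rightPart_apply (p : ℕ) (φ : HC k A M p) (v : Fin (p + 1) → A) :
    rightPart r p φ v =
      ∑ i : Fin p, (-1 : ℤ) ^ (i : ℕ) • φ (Fin.contractNth i.castSucc (· * ·) v) +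
        (-1 : ℤ) ^ p • r (v (Fin.last p)) (φ (Fin.init v)) := by
  induction p with
  | zero =>
    obtain ⟨m, rfl⟩ := exists_const φ
    rw [← Fin.cons_self_tail v, ← cur_apply, cur_rightPart_zero]
    simp [const]
  | succ p ih =>
    rw [← Fin.cons_self_tail v, ← cur_apply, cur_rightPart_succ, Fin.sum_univ_succ]
    have h0 : mulFirst p (v 0) φ (Fin.tail v) =
        φ (Fin.contractNth (0 : Fin (p + 1)).castSucc (· * ·) (Fin.cons (v 0) (Fin.tail v))) := by
      rw [← Fin.cons_self_tail (Fin.tail v), ← cur_apply, cur_mulFirst, cur_apply]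
      congr 1
      ext i
      cases i using Fin.cases <;> simp [Fin.contractNth, Fin.tail]
    have h1 : ∀ i : Fin p, Fin.contractNth i.succ.castSucc (· * ·) (Fin.cons (v 0) (Fin.tail v)) =
        (Fin.cons (v 0) (Fin.contractNth i.castSucc (· * ·) (Fin.tail v)) : Fin (p + 1) → A) := by
      intro i
      ext j
      cases j using Fin.cases with
      | zero => simp [Fin.contractNth]
      | succ j => simp [Fin.contractNth, Fin.tail]
    have h2 : Fin.init (Fin.cons (v 0) (Fin.tail v) : Fin (p + 2) → A) =
        Fin.cons (v 0) (Fin.init (Fin.tail v)) := by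
      ext j
      cases j using Fin.cases <;> rfl
    rw [_root_.sub_apply, h0, ih, h2]
    simp only [h1, cur_apply, Fin.val_succ, pow_succ, mul_neg_one, neg_smul,
      Finset.sum_neg_distrib, Fin.val_zero, pow_zero, one_smul]
    rw [sub_eq_add_neg, neg_add]
    exact (add_assoc _ _ _).symm

theorem insertion_apply (w : A) (p : ℕ) (φ : HC k A M (p + 1)) (v : Fin p → A) :
    insertion w p φ v = ∑ i : Fin (p + 1), (-1 : ℤ) ^ (i : ℕ) • φ (i.insertNth w v) := by
  induction p with
  | zero =>
    rw [insertion_zero, cur_apply]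
    simp
  | succ p ih =>
    rw [← Fin.cons_self_tail v, ← cur_apply, cur_insertion_succ, Fin.sum_univ_succ,
      _root_.sub_apply, ih]
    have h : ∀ i : Fin (p + 1), (i.succ.insertNth w (Fin.cons (v 0) (Fin.tail v)) : Fin (p + 2) → A) =
        Fin.cons (v 0) (i.insertNth w (Fin.tail v)) :=
      fun i => Fin.insertNth_succ_cons i w (v 0) (Fin.tail v)
    simp only [h, cur_apply, Fin.val_succ, pow_succ, mul_neg_one, neg_smul,
      Finset.sum_neg_distrib, Fin.val_zero, pow_zero, one_smul, sub_eq_add_neg]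
    rw [Fin.insertNth_zero']

end HochschildCochains

/-! ## Comparison of Hochschild and Koszul cochains -/

section Comparison

variable {ι : Type*} [LinearOrder ι]

/-- A strictly decreasing list which contains all predecessors of its members. -/
def IsInitial (L : List ι) : Prop := L.Pairwise (· > ·) ∧ ∀ j ∈ L, ∀ j' < j, j' ∈ L

theorem IsInitial.mem_iff {i : ι} {L : List ι} (h : IsInitial (i :: L)) (j : ι) :
    j ∈ L ↔ j < i := by
  have h1 := (List.pairwise_cons.1 h.1).1
  refine ⟨fun hj => h1 j hj, fun hj => ?_⟩
  rcases List.mem_cons.1 (h.2 i (by simp) j hj) with rfl | h2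
  · exact absurd hj (lt_irrefl _)
  · exact h2

theorem IsInitial.of_cons {i : ι} {L : List ι} (h : IsInitial (i :: L)) : IsInitial L :=
  ⟨(List.pairwise_cons.1 h.1).2, fun j hj j' hj' =>
    (h.mem_iff j').2 (hj'.trans ((h.mem_iff j).1 hj))⟩

theorem IsInitial.notMem {i : ι} {L : List ι} (h : IsInitial (i :: L)) : i ∉ L :=
  fun hi => lt_irrefl _ ((h.mem_iff i).1 hi)

variable {k A M M' : Type*} [Field k] [CommRing A] [Algebra k A] [AddCommGroup M] [Module k M]
  [AddCommGroup M'] [Module k M']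

/-- The antisymmetrised value of a cochain on the elements `xᵢ`, for `i ∈ I` occurring in a list. -/
def antisymm (x : ι → A) (I : Finset ι) : List ι → ∀ p, HC k A M p →ₗ[k] M
  | [], 0 => const.symm.toLinearMap
  | [], _ + 1 => 0
  | i :: L, 0 => if i ∈ I then 0 else antisymm x I L 0
  | i :: L, p + 1 => if i ∈ I then (-1 : ℤ) ^ p • (antisymm x I L p ∘ₗ insertion (x i) p)
      else antisymm x I L (p + 1)

/-- The Koszul cochain `m eᵢ₁ ⋯ eᵢₚ` as an iterated cup product. -/
def koszulCochain (c : ι → A →ₗ[k] Module.End k M) (I : Finset ι) :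
    List ι → ∀ p, M →ₗ[k] HC k A M p
  | [], 0 => const.toLinearMap
  | [], _ + 1 => 0
  | i :: L, 0 => if i ∈ I then 0 else koszulCochain c I L 0
  | i :: L, p + 1 => if i ∈ I then cup (c i) p ∘ₗ koszulCochain c I L p
      else koszulCochain c I L (p + 1)

theorem antisymm_congr (x : ι → A) {I J : Finset ι} (L : List ι) (h : ∀ i ∈ L, i ∈ I ↔ i ∈ J)
    (p : ℕ) : (antisymm x I L p : HC k A M p →ₗ[k] M) = antisymm x J L p := by
  induction L generalizing p with
  | nil => cases p <;> rfl
  | cons i L ih =>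
    have h1 := ih fun j hj => h j (List.mem_cons_of_mem _ hj)
    have h2 := h i (by simp)
    cases p <;> simp only [antisymm, h1, h2]

theorem koszulCochain_congr (c : ι → A →ₗ[k] Module.End k M) {I J : Finset ι} (L : List ι)
    (h : ∀ i ∈ L, i ∈ I ↔ i ∈ J) (p : ℕ) : koszulCochain c I L p = koszulCochain c J L p := by
  induction L generalizing p with
  | nil => cases p <;> rfl
  | cons i L ih =>
    have h1 := ih fun j hj => h j (List.mem_cons_of_mem _ hj)
    have h2 := h i (by simp)
    cases p <;> simp only [koszulCochain, h1, h2]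

theorem card_filter_cons {i : ι} {L : List ι} (h : i ∉ L) (I : Finset ι) :
    (I.filter (· ∈ i :: L)).card = (I.filter (· ∈ L)).card + if i ∈ I then 1 else 0 := by
  split_ifs with hi
  · rw [← Finset.card_insert_of_notMem (a := i) (by simp [h])]
    congr 1
    ext j
    by_cases hj : j = i <;> simp [hj, hi]
  · rw [add_zero]
    congr 1
    ext j
    by_cases hj : j = i <;> simp [hj, hi]

theorem antisymm_eq_zero (x : ι → A) {I : Finset ι} {L : List ι} (hL : IsInitial L) {p : ℕ}
    (h : (I.filter (· ∈ L)).card ≠ p) : (antisymm x I L p : HC k A M p →ₗ[k] M) = 0 := by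
  induction L generalizing p with
  | nil =>
    cases p with
    | zero => simp at h
    | succ p => rfl
  | cons i L ih =>
    rw [card_filter_cons hL.notMem] at h
    cases p with
    | zero =>
      simp only [antisymm]
      split_ifs at h ⊢ with hi
      · rfl
      · exact ih hL.of_cons h
    | succ p =>
      simp only [antisymm]
      split_ifs at h ⊢ with hi
      · rw [ih hL.of_cons (by omega), LinearMap.zero_comp, smul_zero]
      · exact ih hL.of_cons h

theorem koszulCochain_eq_zero (c : ι → A →ₗ[k] Module.End k M) {I : Finset ι} {L : List ι}
    (hL : IsInitial L) {p : ℕ} (h : (I.filter (· ∈ L)).card ≠ p) :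
    koszulCochain c I L p = 0 := by
  induction L generalizing p with
  | nil =>
    cases p with
    | zero => simp at h
    | succ p => rfl
  | cons i L ih =>
    rw [card_filter_cons hL.notMem] at h
    cases p with
    | zero =>
      simp only [koszulCochain]
      split_ifs at h ⊢ with hi
      · rfl
      · exact ih hL.of_cons h
    | succ p =>
      simp only [koszulCochain]
      split_ifs at h ⊢ with hi
      · rw [ih hL.of_cons (by omega), LinearMap.comp_zero]
      · exact ih hL.of_cons h

theorem koszulSign_eq_of_isInitial {i : ι} {L : List ι} (hL : IsInitial (i :: L)) (I : Finset ι) :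
    koszulSign i I = (-1) ^ (I.filter (· ∈ L)).card := by
  simp only [koszulSign, hL.mem_iff]

/-- The value vanishes unless exactly `p` members of `I` precede `i`, so the sign depending on `I`
may be traded for one depending only on the degree. -/
theorem koszulSign_smul_antisymm (x : ι → A) {i : ι} {L : List ι} (hL : IsInitial (i :: L))
    (I : Finset ι) (p : ℕ) (φ : HC k A M p) :
    koszulSign i I • antisymm x I L p φ = (-1 : ℤ) ^ p • antisymm x I L p φ := by
  by_cases h : (I.filter (· ∈ L)).card = p
  · rw [koszulSign_eq_of_isInitial hL, h]
  · simp [antisymm_eq_zero x hL.of_cons h]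

theorem koszulSign_smul_koszulCochain (c : ι → A →ₗ[k] Module.End k M) {i : ι} {L : List ι}
    (hL : IsInitial (i :: L)) (I : Finset ι) (p : ℕ) (m : M) :
    koszulSign i I • koszulCochain c I L p m = (-1 : ℤ) ^ p • koszulCochain c I L p m := by
  by_cases h : (I.filter (· ∈ L)).card = p
  · rw [koszulSign_eq_of_isInitial hL, h]
  · simp [koszulCochain_eq_zero c hL.of_cons h]

theorem antisymm_push (x : ι → A) (h : M →ₗ[k] M') (I : Finset ι) (L : List ι) (p : ℕ)
    (φ : HC k A M p) : antisymm x I L p (push h p φ) = h (antisymm x I L p φ) := by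
  induction L generalizing p with
  | nil =>
    cases p with
    | zero => rfl
    | succ p => simp [antisymm]
  | cons i L ih =>
    cases p with
    | zero =>
      simp only [antisymm]
      split_ifs <;> simp [ih]
    | succ p =>
      simp only [antisymm]
      split_ifs <;> simp [ih, insertion_push]

theorem push_koszulCochain (c : ι → A →ₗ[k] Module.End k M) (h : M →ₗ[k] M)
    (hc : ∀ i a m, h (c i a m) = c i a (h m)) (I : Finset ι) (L : List ι) (p : ℕ) (m : M) :
    push h p (koszulCochain c I L p m) = koszulCochain c I L p (h m) := by
  induction L generalizing p with
  | nil =>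
    cases p with
    | zero => rfl
    | succ p => simp [koszulCochain]
  | cons i L ih =>
    cases p with
    | zero =>
      simp only [koszulCochain]
      split_ifs <;> simp [ih]
    | succ p =>
      simp only [koszulCochain]
      split_ifs <;> simp [ih, push_cup (c i) h (hc i)]

/-- The indices are peeled off from the largest downwards. Each insertion of `xᵢ` anticommutes with
the differential up to `l (xᵢ) - r (xᵢ)`, which is the coefficient of the Koszul differential. -/
theorem antisymm_bimodDiff (x : ι → A) (l r : A →ₗ[k] Module.End k M) (I : Finset ι) {L : List ι}
    (hL : IsInitial L) (p : ℕ) (φ : HC k A M p) :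
    antisymm x I L (p + 1) (bimodDiff l r p φ) =
      ∑ j ∈ L.toFinset, if j ∈ I then
        koszulSign j I • (l (x j) - r (x j)) (antisymm x (I.erase j) L p φ) else 0 := by
  induction L generalizing p with
  | nil => simp [antisymm]
  | cons i L ih =>
    rw [List.toFinset_cons, Finset.sum_insert (by simpa using hL.notMem)]
    have hne : ∀ j ∈ L.toFinset, i ≠ j := by
      rintro j hj rfl
      exact hL.notMem (by simpa using hj)
    by_cases hi : i ∈ I
    · have h1 : koszulSign i I • (l (x i) - r (x i)) (antisymm x (I.erase i) (i :: L) p φ) =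
          (-1 : ℤ) ^ p • (l (x i) - r (x i)) (antisymm x I L p φ) := by
        have : (antisymm x (I.erase i) (i :: L) p : HC k A M p →ₗ[k] M) = antisymm x I L p := by
          rw [← antisymm_congr x (I := I.erase i) (J := I) L
            (fun j hj => by simp [(hne j (by simpa using hj)).symm])]
          cases p <;> simp [antisymm]
        rw [this, ← map_zsmul, koszulSign_smul_antisymm x hL, map_zsmul]
      rw [if_pos hi, h1]
      cases p with
      | zero =>
        rw [Finset.sum_eq_zero, add_zero]
        · simp only [antisymm, hi, if_true, LinearMap.smul_apply, LinearMap.comp_apply,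
            insertion_bimodDiff_zero, map_sub, antisymm_push, LinearMap.sub_apply]
        · intro j hj
          simp [antisymm, hi, hne j hj]
      | succ p =>
        have h2 := insertion_bimodDiff l r (x i) p φ
        rw [← eq_sub_iff_add_eq] at h2
        simp only [antisymm, hi, if_true, LinearMap.smul_apply, LinearMap.comp_apply, h2, map_sub,
          antisymm_push, LinearMap.sub_apply, ih hL.of_cons, smul_sub, pow_succ]
        rw [sub_eq_add_neg, ← smul_neg, ← Finset.sum_neg_distrib, Finset.smul_sum]
        congr 1
        refine Finset.sum_congr rfl fun j hj => ?_
        by_cases hj' : j ∈ I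
        · have hij : i ∈ I.erase j := by simp [hi, hne j hj]
          simp only [hj', hij, if_true, LinearMap.smul_apply, LinearMap.comp_apply, map_zsmul,
            smul_smul, ← smul_sub, ← LinearMap.sub_apply]
          rw [smul_neg, ← neg_smul, smul_smul]
          congr 1
          ring
        · simp [hj']
    · rw [if_neg hi, zero_add]
      simp only [antisymm, hi, if_false, ih hL.of_cons]
      refine Finset.sum_congr rfl fun j hj => ?_
      split_ifs with hj'
      · congr 2
        cases p <;> simp [antisymm, hi]
      · rfl

/-- The right action `r L` is twisted only in the variables of `L`, and variables are switched on
one at a time. If `i ∈ I`, the cup product with `cᵢ` carries cochains for `r L` to cochains for `r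
(i :: L)`; if `i ∉ I`, changing the action creates the new term `eᵢ ∧ -` with coefficient `tᵢ`. With
no variable twisted the two actions agree and there is no differential. -/
theorem bimodDiff_koszulCochain (c : ι → A →ₗ[k] Module.End k M) (l : A →ₗ[k] Module.End k M)
    (r : List ι → A →ₗ[k] Module.End k M) (t : ι → Module.End k M) (hr0 : r [] = l)
    (hr : ∀ i L, IsInitial (i :: L) → ∀ a m, r L a m - r (i :: L) a m = c i a (t i m))
    (hc : ∀ i L, IsInitial (i :: L) → ∀ a b m,
      c i (a * b) m = c i b (r L a m) + r (i :: L) b (c i a m))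
    (hl : ∀ i a b m, l a (c i b m) = c i b (l a m))
    (ht : ∀ i j a m, t i (c j a m) = c j a (t i m))
    (I : Finset ι) {L : List ι} (hL : IsInitial L) (p : ℕ) (m : M) :
    bimodDiff l (r L) p (koszulCochain c I L p m) =
      ∑ j ∈ L.toFinset, if j ∈ I then 0 else
        koszulSign j I • koszulCochain c (insert j I) L (p + 1) (t j m) := by
  induction L generalizing p with
  | nil =>
    cases p with
    | zero =>
      refine cur_ext fun a => ?_
      simp [koszulCochain, hr0]
    | succ p => simp [koszulCochain]
  | cons i L ih =>
    rw [List.toFinset_cons, Finset.sum_insert (by simpa using hL.notMem)]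
    have hne : ∀ j ∈ L.toFinset, i ≠ j := by
      rintro j hj rfl
      exact hL.notMem (by simpa using hj)
    by_cases hi : i ∈ I
    · rw [if_pos hi, zero_add]
      cases p with
      | zero =>
        simp only [koszulCochain, hi, if_true, LinearMap.zero_apply, map_zero]
        refine (Finset.sum_eq_zero fun j hj => ?_).symm
        by_cases hj' : j ∈ I
        · simp [hj']
        · have h0 : koszulCochain c (insert j I) L 0 = 0 :=
            koszulCochain_eq_zero c hL.of_cons
              (Finset.card_ne_zero_of_mem (a := j) (by simpa using hj))
          simp [hi, h0]
      | succ p =>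
        simp only [koszulCochain, hi, if_true, LinearMap.comp_apply]
        rw [bimodDiff_cup l (r L) (r (i :: L)) (c i) (hc i L hL) (hl i), ih hL.of_cons, map_sum]
        refine Finset.sum_congr rfl fun j hj => ?_
        split_ifs <;> simp_all
    · rw [if_neg hi]
      have h1 : koszulCochain c I (i :: L) p m = koszulCochain c I L p m := by
        cases p <;> simp [koszulCochain, hi]
      have h2 : cup (c i ) p (push (t i) p (koszulCochain c I L p m)) =
          koszulCochain c (insert i I) (i :: L) (p + 1) (t i m) := by
        rw [push_koszulCochain c (t i) (ht i)]
        simp only [koszulCochain, Finset.mem_insert_self, if_true, LinearMap.comp_apply]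
        rw [koszulCochain_congr c L fun j hj => ?_]
        simp [(hne j (by simpa using hj)).symm]
      have h3 : bimodDiff l (r (i :: L)) p (koszulCochain c I L p m) =
          bimodDiff l (r L) p (koszulCochain c I L p m) +
            (-1 : ℤ) ^ p • cup (c i) p (push (t i) p (koszulCochain c I L p m)) := by
        -- The difference of the two right actions factors as `cᵢ a ∘ tᵢ`, so the correction is a
        -- cup product with `cᵢ` after applying `tᵢ` to the values.
        rw [bimodDiff_change l (r L) (r (i :: L)) (r L - r (i :: L)) (fun _ _ => rfl)]
        congr 2
        ext v
        rw [cup_apply, cup_apply, push_apply, ← hr i L hL]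
        rfl
      rw [h1, h3, ih hL.of_cons]
      refine (add_comm _ _).trans ?_
      congr 1
      · rw [← h2, ← map_zsmul, ← map_zsmul, ← koszulSign_smul_koszulCochain c hL, map_zsmul,
          map_zsmul]
      · refine Finset.sum_congr rfl fun j hj => ?_
        split_ifs
        · rfl
        · simp [koszulCochain, hi, hne j hj]

/-- Inserting `w` into the factor with `cⱼ` removes `eⱼ` and leaves the coefficient `cⱼ(w)`, which
can be moved to the front because the `c` commute. So the curving becomes contraction. -/
theorem insertion_koszulCochain (c : ι → A →ₗ[k] Module.End k M) (w : A)
    (hcc : ∀ i j a b m, c i a (c j b m) = c j b (c i a m))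
    (I : Finset ι) {L : List ι} (hL : IsInitial L) (p : ℕ) (m : M) :
    insertion w p (koszulCochain c I L (p + 1) m) =
      ∑ j ∈ L.toFinset, if j ∈ I then
        koszulSign j I • koszulCochain c (I.erase j) L p (c j w m) else 0 := by
  induction L generalizing p with
  | nil => simp [koszulCochain]
  | cons i L ih =>
    rw [List.toFinset_cons, Finset.sum_insert (by simpa using hL.notMem)]
    have hne : ∀ j ∈ L.toFinset, i ≠ j := by
      rintro j hj rfl
      exact hL.notMem (by simpa using hj)
    by_cases hi : i ∈ I
    · have h1 : koszulSign i I • koszulCochain c (I.erase i) (i :: L) p (c i w m) =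
          (-1 : ℤ) ^ p • push (c i w) p (koszulCochain c I L p m) := by
        rw [push_koszulCochain c _ (fun j a m => hcc _ _ _ _ _), ← koszulSign_smul_koszulCochain c hL]
        congr 1
        rw [koszulCochain_congr c (I := I) (J := I.erase i) L
            (fun j hj => by simp [(hne j (by simpa using hj)).symm])]
        cases p <;> simp [koszulCochain]
      rw [if_pos hi, h1]
      simp only [koszulCochain, hi, if_true, LinearMap.comp_apply]
      cases p with
      | zero =>
        rw [insertion_cup_zero, pow_zero, one_smul, Finset.sum_eq_zero, add_zero]
        intro j hj
        simp [koszulCochain, hi, hne j hj]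
      | succ p =>
        rw [insertion_cup, ih hL.of_cons, map_sum]
        refine (add_comm _ _).trans ?_
        congr 1
        refine Finset.sum_congr rfl fun j hj => ?_
        split_ifs <;> simp [hi, hne j hj, koszulCochain]
    · rw [if_neg hi, zero_add]
      simp only [koszulCochain, hi, if_false, ih hL.of_cons]
      refine Finset.sum_congr rfl fun j hj => ?_
      split_ifs
      · congr 1
        cases p <;> simp [koszulCochain, hi]
      · rfl

theorem insertion_koszulCochain_eq_zero (c : ι → A →ₗ[k] Module.End k M) (w : A) (I : Finset ι)
    (L : List ι) (hw : ∀ j ∈ L, c j w = 0) (p : ℕ) (m : M) :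
    insertion w p (koszulCochain c I L (p + 1) m) = 0 := by
  induction L generalizing p with
  | nil => simp [koszulCochain]
  | cons i L ih =>
    simp only [koszulCochain]
    have h1 := ih fun j hj => hw j (List.mem_cons_of_mem _ hj)
    split_ifs
    · cases p with
      | zero => ext; simp [insertion_cup_zero, hw]
      | succ p => ext; simp [insertion_cup, hw, h1]
    · exact h1 p

theorem antisymm_cup_eq_zero (x : ι → A) (c : A →ₗ[k] Module.End k M) (I : Finset ι) (L : List ι)
    (hc : ∀ j ∈ L, c (x j) = 0) (p : ℕ) (φ : HC k A M p) :
    antisymm x I L (p + 1) (cup c p φ) = 0 := by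
  induction L generalizing p with
  | nil => simp [antisymm]
  | cons i L ih =>
    have h1 := ih fun j hj => hc j (List.mem_cons_of_mem _ hj)
    have h2 : ∀ p φ, push (c (x i)) p (φ : HC k A M p) = 0 := by
      intro p φ; ext; simp [hc]
    simp only [antisymm]
    split_ifs
    · cases p with
      | zero => simp [insertion_cup_zero, h2]
      | succ p => simp [insertion_cup, h2, h1]
    · exact h1 p φ

/-- Since `cᵢ(xⱼ) = δᵢⱼ`, evaluating on the `xᵢ`, `i ∈ I`, pairs each variable with its own factor.
The sign in the definition of `antisymm` cancels the one from `insertion_cup`. -/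
theorem antisymm_koszulCochain (x : ι → A) (c : ι → A →ₗ[k] Module.End k M)
    (hx : ∀ i j, c i (x j) = if i = j then 1 else 0) (I J : Finset ι) {L : List ι}
    (hL : IsInitial L) (p : ℕ) (m : M) :
    antisymm x I L p (koszulCochain c J L p m) =
      if (∀ i ∈ L, i ∈ I ↔ i ∈ J) ∧ (J.filter (· ∈ L)).card = p then m else 0 := by
  induction L generalizing p with
  | nil =>
    cases p with
    | zero => simp [antisymm, koszulCochain]
    | succ p => simp [antisymm]
  | cons i L ih =>
    have h0 : ∀ j ∈ L, j ≠ i := fun j hj h => hL.notMem (h ▸ hj)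
    have h1 : ∀ j ∈ L, c i (x j) = 0 := fun j hj => by simp [hx, (h0 j hj).symm]
    have h2 : ∀ j ∈ L, c j (x i) = 0 := fun j hj => by simp [hx, h0 j hj]
    have h3 : c i (x i) = 1 := by simp [hx]
    have h4 : ∀ p φ, push (1 : Module.End k M) p (φ : HC k A M p) = φ := fun p φ => by ext; simp
    rw [card_filter_cons hL.notMem]
    simp only [List.forall_mem_cons]
    by_cases hi : i ∈ I <;> by_cases hj : i ∈ J
    · cases p with
      | zero => simp [antisymm, koszulCochain, hi, hj]
      | succ p =>
        simp only [antisymm, koszulCochain, hi, hj, if_true, LinearMap.smul_apply,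
          LinearMap.comp_apply, true_and, Nat.add_right_cancel_iff]
        rw [← ih hL.of_cons]
        cases p with
        | zero => simp [insertion_cup_zero, h3, h4]
        | succ p =>
          simp [insertion_cup, h3, h4, antisymm_cup_eq_zero x (c i) I L h1, smul_smul, ← mul_pow]
    · cases p with
      | zero => simp [antisymm, hi, hj]
      | succ p =>
        simp [antisymm, koszulCochain, hi, hj, insertion_koszulCochain_eq_zero c (x i) J L h2]
    · cases p with
      | zero => simp [koszulCochain, hi, hj]
      | succ p =>
        simp [antisymm, koszulCochain, hi, hj, antisymm_cup_eq_zero x (c i) I L h1]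
    · simp only [hi, hj, iff_self, true_and, if_false, add_zero, ← ih hL.of_cons]
      cases p <;> simp [antisymm, koszulCochain, hi, hj]

end Comparison

/-! ### Chain maps between Hochschild and Koszul cochains -/

section KoszulComparison

variable (ι : Type) [LinearOrder ι] [Fintype ι]

/-- All indices, in decreasing order. -/
def decreasingList : List ι := Finset.univ.sort (· ≥ ·)

theorem isInitial_decreasingList : IsInitial (decreasingList ι) := by
  refine ⟨?_, fun j _ j' _ => by simp [decreasingList]⟩
  exact (Finset.sortedGT_sort _).pairwise

theorem toFinset_decreasingList : (decreasingList ι).toFinset = Finset.univ := by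
  ext; simp [decreasingList]

variable {ι} {k A M M' : Type} [Field k] [CommRing A] [Algebra k A] [AddCommGroup M] [Module k M]
  [AddCommGroup M'] [Module k M']

/-- Restriction of Hochschild cochains to Koszul cochains. -/
def toKoszul (x : ι → A) (p : ℕ) : HC k A M p →ₗ[k] (Finset ι → M) :=
  LinearMap.pi fun I => antisymm x I (decreasingList ι) p

/-- The Hochschild cochain attached to a Koszul cochain. -/
def ofKoszul (c : ι → A →ₗ[k] Module.End k M) (p : ℕ) : (Finset ι → M) →ₗ[k] HC k A M p :=
  ∑ I, koszulCochain c I (decreasingList ι) p ∘ₗ LinearMap.proj I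

theorem ofKoszul_apply (c : ι → A →ₗ[k] Module.End k M) (p : ℕ) (u : Finset ι → M) :
    ofKoszul c p u = ∑ I, koszulCochain c I (decreasingList ι) p (u I) := by
  simp [ofKoszul]

theorem filter_mem_decreasingList (I : Finset ι) : I.filter (· ∈ decreasingList ι) = I := by
  simp [decreasingList]

theorem isHomogeneousOfDegree_toKoszul (x : ι → A) (p : ℕ) (φ : HC k A M p) :
    IsHomogeneousOfDegree p (toKoszul x p φ) := by
  intro I hI
  by_contra h
  rw [← filter_mem_decreasingList I] at h
  exact hI (LinearMap.congr_fun (antisymm_eq_zero x (isInitial_decreasingList ι) h) φ)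

theorem toKoszul_push (x : ι → A) (h : M →ₗ[k] M') (p : ℕ) (φ : HC k A M p) :
    toKoszul x p (push h p φ) = h ∘ toKoszul x p φ :=
  funext fun I => antisymm_push x h I _ p φ

theorem toKoszul_bimodDiff (x : ι → A) (l r : A →ₗ[k] Module.End k M) (p : ℕ) (φ : HC k A M p) :
    toKoszul x (p + 1) (bimodDiff l r p φ) =
      koszulDiff (fun i => l (x i) - r (x i)) (toKoszul x p φ) := by
  funext I
  rw [koszulDiff_apply]
  refine (antisymm_bimodDiff x l r I (isInitial_decreasingList ι) p φ).trans ?_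
  rw [toFinset_decreasingList, ← Finset.sum_filter]
  simp [toKoszul]

theorem toKoszul_ofKoszul (x : ι → A) (c : ι → A →ₗ[k] Module.End k M)
    (hx : ∀ i j, c i (x j) = if i = j then 1 else 0) {p : ℕ} {u : Finset ι → M}
    (hu : IsHomogeneousOfDegree p u) : toKoszul x p (ofKoszul c p u) = u := by
  funext I
  rw [ofKoszul_apply, map_sum, Finset.sum_apply, Finset.sum_eq_single I]
  · refine (antisymm_koszulCochain x c hx I I (isInitial_decreasingList ι) p (u I)).trans ?_
    rw [filter_mem_decreasingList]
    by_cases h : u I = 0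
    · simp [h]
    · simp [hu I h]
  · intro J _ hJ
    refine (antisymm_koszulCochain x c hx I J (isInitial_decreasingList ι) p (u J)).trans ?_
    rw [if_neg]
    rintro ⟨h, -⟩
    exact hJ (Finset.ext fun i => (h i (by simp [decreasingList])).symm)
  · simp

/-- Inserting and erasing `j` are inverse bijections between the sets avoiding `j` and those
containing it; this exchanges exterior multiplication and contraction inside sums over all `I`. -/
theorem sum_insert_erase {X : Type*} [AddCommMonoid X] (j : ι) (F : Finset ι → Finset ι → X) :
    ∑ I, (if j ∈ I then 0 else F (insert j I) I) = ∑ I, if j ∈ I then F I (I.erase j) else 0 := by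
  have h : ∀ I : Finset ι, (if j ∈ I then 0 else F (insert j I) I) =
      if j ∉ I then F (insert j I) I else 0 := fun I => by split_ifs <;> rfl
  simp only [h]
  rw [← Finset.sum_filter, ← Finset.sum_filter]
  refine Finset.sum_bij' (fun I _ => insert j I) (fun I _ => I.erase j) ?_ ?_ ?_ ?_ ?_
  · simp
  · simp
  · intro I hI
    exact Finset.erase_insert (by simpa using hI)
  · intro I hI
    exact Finset.insert_erase (by simpa using hI)
  · intro I hI
    rw [Finset.erase_insert (by simpa using hI)]

theorem bimodDiff_ofKoszul (c : ι → A →ₗ[k] Module.End k M) (l : A →ₗ[k] Module.End k M)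
    (r : List ι → A →ₗ[k] Module.End k M) (t : ι → Module.End k M) (hr0 : r [] = l)
    (hr : ∀ i L, IsInitial (i :: L) → ∀ a m, r L a m - r (i :: L) a m = c i a (t i m))
    (hc : ∀ i L, IsInitial (i :: L) → ∀ a b m,
      c i (a * b) m = c i b (r L a m) + r (i :: L) b (c i a m))
    (hl : ∀ i a b m, l a (c i b m) = c i b (l a m))
    (ht : ∀ i j a m, t i (c j a m) = c j a (t i m)) (p : ℕ) (u : Finset ι → M) :
    bimodDiff l (r (decreasingList ι)) p (ofKoszul c p u) =
      ofKoszul c (p + 1) (koszulDiff t u) := by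
  simp only [ofKoszul_apply, map_sum]
  rw [Finset.sum_congr rfl fun I _ => bimodDiff_koszulCochain c l r t hr0 hr hc hl ht I
    (isInitial_decreasingList ι) p (u I), Finset.sum_comm, toFinset_decreasingList]
  rw [Finset.sum_congr rfl fun j _ => sum_insert_erase j fun I J =>
    koszulSign j J • koszulCochain c I (decreasingList ι) (p + 1) (t j (u J)), Finset.sum_comm]
  refine Finset.sum_congr rfl fun I _ => ?_
  rw [koszulDiff_apply, map_sum, ← Finset.sum_filter]
  simp [koszulSign_erase_self]

theorem insertion_ofKoszul (c : ι → A →ₗ[k] Module.End k M) (w : A)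
    (hcc : ∀ i j a b m, c i a (c j b m) = c j b (c i a m)) (p : ℕ) (u : Finset ι → M) :
    insertion w p (ofKoszul c (p + 1) u) = ofKoszul c p (koszulCon (fun i => c i w) u) := by
  simp only [ofKoszul_apply, map_sum]
  rw [Finset.sum_congr rfl fun I _ => insertion_koszulCochain c w hcc I
    (isInitial_decreasingList ι) p (u I), Finset.sum_comm, toFinset_decreasingList]
  rw [Finset.sum_congr rfl fun j _ => (sum_insert_erase j fun I J =>
    koszulSign j I • koszulCochain c J (decreasingList ι) p (c j w (u I))).symm, Finset.sum_comm]
  refine Finset.sum_congr rfl fun I _ => ?_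
  rw [koszulCon_apply, map_sum, ← Finset.sum_subset (Finset.subset_univ Iᶜ)
    (fun j _ hj => by rw [Finset.notMem_compl] at hj; simp [hj])]
  refine Finset.sum_congr rfl fun j hj => ?_
  rw [Finset.mem_compl] at hj
  rw [if_neg hj, koszulSign_insert_of_le le_rfl, map_zsmul]

end KoszulComparison

/-! ## Coinduced bimodules -/

section Coinduced

variable {k A M : Type} [Field k] [CommRing A] [Algebra k A] [AddCommGroup M] [Module k M]

/-- Commuting unital left and right actions. -/
structure IsBimod (l r : A →ₗ[k] Module.End k M) : Prop where
  left_one : ∀ m, l 1 m = m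
  right_one : ∀ m, r 1 m = m
  left_mul : ∀ a b m, l (a * b) m = l a (l b m)
  right_mul : ∀ a b m, r (a * b) m = r b (r a m)
  comm : ∀ a b m, l a (r b m) = r b (l a m)

/-- The left action `(a f)(c) = f(c a)` on `Hom(A, M)`. -/
def coindLeft : A →ₗ[k] Module.End k (A →ₗ[k] M) :=
  (LinearMap.llcomp k A A M).flip ∘ₗ (LinearMap.mul k A).flip

@[simp] theorem coindLeft_apply (a c : A) (f : A →ₗ[k] M) : coindLeft a f c = f (c * a) := rfl

/-- The right action `(f b)(c) = f(c) b` on `Hom(A, M)`. -/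
def coindRight (r : A →ₗ[k] Module.End k M) : A →ₗ[k] Module.End k (A →ₗ[k] M) :=
  LinearMap.llcomp k A M M ∘ₗ r

@[simp] theorem coindRight_apply (r : A →ₗ[k] Module.End k M) (b c : A) (f : A →ₗ[k] M) :
    coindRight r b f c = r b (f c) := rfl

theorem IsBimod.coind {l r : A →ₗ[k] Module.End k M} (h : IsBimod l r) :
    IsBimod (coindLeft : A →ₗ[k] Module.End k (A →ₗ[k] M)) (coindRight r) where
  left_one f := by ext; simp
  right_one f := by ext; simp [h.right_one]
  left_mul a b f := by ext; simp [mul_assoc]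
  right_mul a b f := by ext; simp [h.right_mul]
  comm a b f := by ext; simp

end Coinduced

/-! ### Acyclicity of the Koszul complex of a coinduced bimodule -/

section CoinducedKoszul

variable {ι k M : Type} [LinearOrder ι] [Fintype ι] [Field k] [CharZero k] [AddCommGroup M]
  [Module k M]

/-- The operator dual to `∂/∂xᵢ` on `Hom(A, M)`. -/
def coderiv (i : ι) : Module.End k (MvPolynomial ι k →ₗ[k] M) :=
  LinearMap.lcomp k M (pderiv i).toLinearMap

omit [LinearOrder ι] [Fintype ι] [CharZero k] in
@[simp] theorem coderiv_apply (i : ι) (f : MvPolynomial ι k →ₗ[k] M) (c : MvPolynomial ι k) :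
    coderiv i f c = f (pderiv i c) := rfl

variable (r : MvPolynomial ι k →ₗ[k] Module.End k M)

/-- The difference of the left and the right action of `xᵢ` on `Hom(A, M)`. -/
def coindDiff (i : ι) : Module.End k (MvPolynomial ι k →ₗ[k] M) :=
  coindLeft (X i) - coindRight r (X i)

/-- The Euler operator on `Hom(A, M)`. -/
def coindEuler (p : ℕ) : Module.End k (MvPolynomial ι k →ₗ[k] M) :=
  ∑ i, coderiv i * coindDiff r i + (p : k) • 1

omit [LinearOrder ι] [Fintype ι] [CharZero k] in
theorem pderiv_monomial_one (i : ι) (γ : ι →₀ ℕ) : pderiv i (monomial γ (1 : k)) =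
    (γ i : k) • monomial (γ - Finsupp.single i 1) 1 := by
  rw [pderiv_monomial, smul_monomial]; simp

omit [LinearOrder ι] [Fintype ι] [CharZero k] in
theorem monomial_sub_mul_X {i : ι} {γ : ι →₀ ℕ} (h : γ i ≠ 0) (t : k) :
    monomial (γ - Finsupp.single i 1) t * X i = monomial γ t := by
  rw [X, monomial_mul, tsub_add_cancel_of_le, mul_one]
  simpa [Nat.one_le_iff_ne_zero] using h

-- The Euler operator is triangular for the total degree of monomials, with diagonal entries `|γ| +
-- p`. In characteristic zero these are invertible once `p > 0`, so a functional can be recovered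
-- degree by degree.
omit [LinearOrder ι] in
theorem coindEuler_monomial (p : ℕ) (f : MvPolynomial ι k →ₗ[k] M) (γ : ι →₀ ℕ) :
    coindEuler r p f (monomial γ 1) = ((∑ i, γ i + p : ℕ) : k) • f (monomial γ 1) -
      ∑ i, (γ i : k) • r (X i) (f (monomial (γ - Finsupp.single i 1) 1)) := by
  have h2 : ∀ i, (γ i : k) • f (monomial (γ - Finsupp.single i 1) (1 : k) * X i) =
      (γ i : k) • f (monomial γ 1) := fun i => by
    by_cases hi : γ i = 0
    · simp [hi]
    · rw [monomial_sub_mul_X hi]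
  simp only [coindEuler, coindDiff, LinearMap.add_apply, LinearMap.sum_apply, Module.End.mul_apply,
    coderiv_apply, LinearMap.sub_apply, coindLeft_apply, coindRight_apply, pderiv_monomial_one, h2,
    map_smul, smul_sub,
    LinearMap.smul_apply, Module.End.one_apply, Finset.sum_sub_distrib, Nat.cast_add, add_smul,
    Nat.cast_sum, Finset.sum_smul]
  abel

theorem sum_sub_single_add_one {i : ι} {γ : ι →₀ ℕ} (h : γ i ≠ 0) :
    ∑ j, (γ - Finsupp.single i 1 : ι →₀ ℕ) j + 1 = ∑ j, γ j := by
  have h1 : γ = (γ - Finsupp.single i 1) + Finsupp.single i 1 := by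
    rw [tsub_add_cancel_of_le]
    simpa [Nat.one_le_iff_ne_zero] using h
  conv_rhs => rw [h1]
  simp [Finset.sum_add_distrib, Finsupp.single_apply]

omit [LinearOrder ι] [Fintype ι] [CharZero k] in
theorem ext_monomial {f g : MvPolynomial ι k →ₗ[k] M}
    (h : ∀ γ, f (monomial γ 1) = g (monomial γ 1)) : f = g :=
  (basisMonomials ι k).ext fun γ => by simpa using h γ

theorem coindEuler_injective {p : ℕ} (hp : p ≠ 0) {f : MvPolynomial ι k →ₗ[k] M}
    (hf : coindEuler r p f = 0) : f = 0 := by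
  have key : ∀ n : ℕ, ∀ γ : ι →₀ ℕ, ∑ i, γ i = n → f (monomial γ 1) = 0 := by
    intro n
    induction n with
    | zero =>
      intro γ hγ
      have h := coindEuler_monomial r p f γ
      have h0 : ∀ i, γ i = 0 := by simpa using hγ
      simpa [hf, h0, hp] using h.symm
    | succ n ih =>
      intro γ hγ
      have h := coindEuler_monomial r p f γ
      rw [hf, Finset.sum_eq_zero (s := Finset.univ)
        (f := fun i => (γ i : k) • r (X i) (f (monomial (γ - Finsupp.single i 1) 1))), sub_zero,
        LinearMap.zero_apply, eq_comm, smul_eq_zero] at h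
      · refine h.resolve_left ?_
        rw [Nat.cast_eq_zero]
        omega
      · intro i _
        by_cases hi : γ i = 0
        · simp [hi]
        · rw [ih _ (by have := sum_sub_single_add_one hi; omega), map_zero, smul_zero]
  exact ext_monomial fun γ => key _ γ rfl

/-- Approximate values on monomials of a preimage under the Euler operator. -/
def eulerPreimage (p : ℕ) (f : MvPolynomial ι k →ₗ[k] M) : ℕ → (ι →₀ ℕ) → M
  | 0, _ => 0
  | n + 1, γ => ((∑ i, γ i + p : ℕ) : k)⁻¹ • (f (monomial γ 1) +
      ∑ i, (γ i : k) • r (X i) (eulerPreimage p f n (γ - Finsupp.single i 1)))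

theorem coindEuler_surjective {p : ℕ} (hp : p ≠ 0) (f : MvPolynomial ι k →ₗ[k] M) :
    ∃ g, coindEuler r p g = f := by
  -- Depth `|γ| + 1` is exactly what the recursion needs: the values it uses at `γ - eᵢ` have depth
  -- `|γ|`, which is again the degree plus one. If `γ i = 0` the truncated subtraction does no harm,
  -- as the term has coefficient zero.
  let g : MvPolynomial ι k →ₗ[k] M :=
    (basisMonomials ι k).constr k fun γ => eulerPreimage r p f (∑ i, γ i + 1) γ
  have hg : ∀ γ, g (monomial γ 1) = eulerPreimage r p f (∑ i, γ i + 1) γ := fun γ => by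
    have := (basisMonomials ι k).constr_basis k
      (fun γ => eulerPreimage r p f (∑ i, γ i + 1) γ) γ
    simpa using this
  refine ⟨g, ext_monomial fun γ => ?_⟩
  rw [coindEuler_monomial, hg, eulerPreimage, smul_smul, mul_inv_cancel₀, one_smul, add_sub_assoc,
    ← Finset.sum_sub_distrib, Finset.sum_eq_zero, add_zero]
  · intro i _
    by_cases hi : γ i = 0
    · simp [hi]
    · rw [hg, sum_sub_single_add_one hi, sub_self]
  · rw [Nat.cast_ne_zero]
    omega

/-- The operators `xᵢ · - · xᵢ` and the duals of `∂/∂xᵢ` satisfy the Heisenberg relations on `Hom(A,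
M)`. The anticommutator of the Koszul differential and the contraction is thus the Euler operator,
bijective in positive degree. -/
theorem koszulDiff_coindDiff_exact (hr : ∀ i j m, r (X i) (r (X j) m) = r (X j) (r (X i) m)) (p : ℕ)
    {u : Finset ι → (MvPolynomial ι k →ₗ[k] M)} (hu : IsHomogeneousOfDegree (p + 1) u)
    (hu0 : koszulDiff (coindDiff r) u = 0) :
    ∃ v, IsHomogeneousOfDegree p v ∧ koszulDiff (coindDiff r) v = u := by
  have hT : ∀ i j, coindDiff r i * coindDiff r j = coindDiff r j * coindDiff r i := by
    intro i j
    refine LinearMap.ext fun f => LinearMap.ext fun c => ?_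
    simp only [coindDiff, Module.End.mul_apply, LinearMap.sub_apply, coindLeft_apply,
      coindRight_apply, map_sub, hr i j, mul_right_comm c (X i) (X j)]
    abel
  have hE : ∀ (q : ℕ) (w : Finset ι → (MvPolynomial ι k →ₗ[k] M)), IsHomogeneousOfDegree q w →
      koszulDiff (coindDiff r) (koszulCon coderiv w) + koszulCon coderiv (koszulDiff (coindDiff r) w) =
        coindEuler r q ∘ w := by
    intro q w hw
    funext I
    rw [koszulDiff_koszulCon (c := fun _ => (1 : k))]
    · simp only [coindEuler, Function.comp_apply, LinearMap.add_apply, LinearMap.sum_apply,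
        Module.End.mul_apply, LinearMap.smul_apply, Module.End.one_apply]
      by_cases h : w I = 0
      · simp [h]
      · simp [hw I h]
    · intro i j
      refine LinearMap.ext fun f => LinearMap.ext fun c => ?_
      split_ifs with h
      · subst h
        simp [coindDiff, mul_comm _ (X i)]
        abel
      · simp [coindDiff, h, mul_comm _ (X i)]
  choose g hg using coindEuler_surjective r (Nat.succ_ne_zero p)
  let v : Finset ι → (MvPolynomial ι k →ₗ[k] M) := g ∘ u
  -- The map `g` is merely a chosen preimage; injectivity is what gives `g 0 = 0` and so keeps the
  -- support inside that of `u`.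
  have hv : IsHomogeneousOfDegree (p + 1) v := fun I hI => hu I fun h =>
    hI (coindEuler_injective r (Nat.succ_ne_zero p) ((hg _).trans h))
  have hv' : coindEuler r (p + 1) ∘ v = u := funext fun I => hg _
  refine ⟨koszulCon coderiv v, hv.koszulCon _, exists_koszulDiff_eq _ _ hT hu0 ?_ ?_⟩
  · rw [hE _ _ hv, hv']
  · intro h
    have h1 := hE _ _ (hv.koszulDiff (coindDiff r))
    rw [koszulDiff_koszulDiff _ hT, map_zero, add_zero, h] at h1
    funext I
    exact coindEuler_injective r (Nat.succ_ne_zero (p + 1)) (congrFun h1 I).symm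

end CoinducedKoszul

/-! ## Vanishing of closed cochains with trivial restriction to Koszul cochains -/

section DimensionShift

variable {ι k : Type} [LinearOrder ι] [Fintype ι] [Field k] [CharZero k]

omit [CharZero k] in
/-- The bimodule embedding `M → Hom(A, M)`. -/
theorem isBimod_quotient {A M : Type} [CommRing A] [Algebra k A] [AddCommGroup M] [Module k M]
    {l r : A →ₗ[k] Module.End k M} (h : IsBimod l r) (S : Submodule k M)
    (hl : ∀ a, S ≤ S.comap (l a)) (hr : ∀ a, S ≤ S.comap (r a)) :
    ∃ l' r' : A →ₗ[k] Module.End k (M ⧸ S), IsBimod l' r' ∧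
      (∀ a m, S.mkQ (l a m) = l' a (S.mkQ m)) ∧ ∀ a m, S.mkQ (r a m) = r' a (S.mkQ m) := by
  have hs : ∀ m : M ⧸ S, ∃ n, S.mkQ n = m := S.mkQ_surjective
  let l' : A →ₗ[k] Module.End k (M ⧸ S) :=
    { toFun := fun a => S.mapQ S (l a) (hl a)
      map_add' := fun a b => by ext; simp
      map_smul' := fun t a => by ext; simp }
  let r' : A →ₗ[k] Module.End k (M ⧸ S) :=
    { toFun := fun a => S.mapQ S (r a) (hr a)
      map_add' := fun a b => by ext; simp
      map_smul' := fun t a => by ext; simp }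
  have h1 : ∀ a m, l' a (S.mkQ m) = S.mkQ (l a m) := fun a m => rfl
  have h2 : ∀ a m, r' a (S.mkQ m) = S.mkQ (r a m) := fun a m => rfl
  refine ⟨l', r', ⟨?_, ?_, ?_, ?_, ?_⟩, fun _ _ => rfl, fun _ _ => rfl⟩
  · intro m
    obtain ⟨n, rfl⟩ := hs m
    rw [h1, h.left_one]
  · intro m
    obtain ⟨n, rfl⟩ := hs m
    rw [h2, h.right_one]
  · intro a b m
    obtain ⟨n, rfl⟩ := hs m
    rw [h1, h1, h1, h.left_mul]
  · intro a b m
    obtain ⟨n, rfl⟩ := hs m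
    rw [h2, h2, h2, h.right_mul]
  · intro a b m
    obtain ⟨n, rfl⟩ := hs m
    rw [h2, h1, h1, h2, h.comm]

omit [Fintype ι] [CharZero k] in
theorem antisymm_degree_zero {A M : Type} [CommRing A] [Algebra k A] [AddCommGroup M] [Module k M]
    (x : ι → A) {I : Finset ι} {L : List ι} (h : ∀ i ∈ L, i ∉ I) (φ : HC k A M 0) :
    antisymm x I L 0 φ = const.symm φ := by
  induction L with
  | nil => rfl
  | cons i L ih =>
    rw [antisymm, if_neg (h i (by simp)), ih fun j hj => h j (List.mem_cons_of_mem _ hj)]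

omit [Fintype ι] [CharZero k] in
theorem antisymm_singleton {A M : Type} [CommRing A] [Algebra k A] [AddCommGroup M] [Module k M]
    (x : ι → A) {i : ι} {L : List ι} (hL : IsInitial L) (hi : i ∈ L) (φ : HC k A M 1) :
    antisymm x {i} L 1 φ = const.symm (cur 0 φ (x i)) := by
  induction L with
  | nil => simp at hi
  | cons j L ih =>
    by_cases hij : j = i
    · subst hij
      rw [antisymm, if_pos (by simp), pow_zero, one_smul, LinearMap.comp_apply, insertion_zero,
        antisymm_degree_zero]
      intro j' hj' h
      rw [Finset.mem_singleton] at h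
      exact hL.notMem (h ▸ hj')
    · rw [antisymm, if_neg (by simpa using hij)]
      exact ih hL.of_cons ((List.mem_cons.1 hi).resolve_left (Ne.symm hij))

-- A closed cochain of degree one is a derivation, hence determined by its values on the variables.
omit [LinearOrder ι] [Fintype ι] [CharZero k] in
theorem exists_bimodDiff_eq_zero {M : Type} [AddCommGroup M] [Module k M]
    {l r : MvPolynomial ι k →ₗ[k] Module.End k M} (h : IsBimod l r)
    {φ : HC k (MvPolynomial ι k) M 1} (hφ : bimodDiff l r 1 φ = 0)
    (hX : ∀ i, cur 0 φ (X i) = 0) : φ = 0 := by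
  have h1 : ∀ a b, const.symm (cur 0 φ (a * b)) =
      l a (const.symm (cur 0 φ b)) + r b (const.symm (cur 0 φ a)) := by
    intro a b
    obtain ⟨m, hm⟩ := exists_const (cur 0 φ a)
    obtain ⟨m', hm'⟩ := exists_const (cur 0 φ b)
    have h2 := congrArg (fun ψ => cur 0 (cur 1 ψ a) b) hφ
    simp only [cur_bimodDiff, cur_rightPart_succ, map_sub, LinearMap.sub_apply, cur_push, hm', hm,
      push_const, cur_mulFirst, cur_rightPart_zero, map_zero, LinearMap.zero_apply] at h2
    rw [sub_sub_eq_add_sub, sub_eq_zero] at h2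
    rw [← h2, hm, hm', ← map_add, LinearEquiv.symm_apply_apply, LinearEquiv.symm_apply_apply,
      LinearEquiv.symm_apply_apply]
  have h2 : const.symm (cur 0 φ 1) = 0 := by
    have := h1 1 1
    rw [mul_one, h.left_one, h.right_one] at this
    simpa using this
  have h3 : ∀ a, const.symm (cur 0 φ a) = 0 := by
    intro a
    induction a using MvPolynomial.induction_on with
    | C t =>
      rw [← mul_one (C t), ← smul_eq_C_mul, map_smul, map_smul, h2, smul_zero]
    | add p q hp hq => rw [map_add, map_add, hp, hq, add_zero]
    | mul_X p i hp => rw [h1, hp, hX, map_zero, map_zero, map_zero, add_zero]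
  refine cur_ext fun a => ?_
  rw [map_zero, LinearMap.zero_apply, ← const.symm.map_eq_zero_iff, h3]

/-- The cochain `(a₁, …, aₚ) ↦ (c ↦ φ(c, a₁, …, aₚ))`. -/
def flipFirst {A M : Type} [CommRing A] [Algebra k A] [AddCommGroup M] [Module k M] {p : ℕ}
    (φ : HC k A M (p + 1)) : HC k A (A →ₗ[k] M) p :=
  MultilinearMap.mk'
    (fun v =>
      { toFun := fun c => cur p φ c v
        map_add' := fun c c' => by simp
        map_smul' := fun t c => by simp })
    (fun v i x y => LinearMap.ext fun c => (cur p φ c).map_update_add v i x y)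
    (fun v i t x => LinearMap.ext fun c => (cur p φ c).map_update_smul v i t x)

-- Coinduced bimodules kill cohomology classes: after the embedding `m ↦ (c ↦ c m)` of `M` into
-- `Hom(A, M)`, a closed cochain is the coboundary of the same cochain with its first argument
-- reread as the argument of the functional.
omit [CharZero k] in
theorem bimodDiff_flipFirst {A M : Type} [CommRing A] [Algebra k A] [AddCommGroup M] [Module k M]
    {l r : A →ₗ[k] Module.End k M} {p : ℕ} {φ : HC k A M (p + 2)} (hφ : bimodDiff l r (p + 2) φ = 0) :
    bimodDiff coindLeft (coindRight r) (p + 1) (flipFirst φ) = push l.flip (p + 2) φ := by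
  have hev : ∀ (q : ℕ) (ψ ψ' : HC k A (A →ₗ[k] M) q),
      (∀ c, push (LinearMap.applyₗ c) q ψ = push (LinearMap.applyₗ c) q ψ') → ψ = ψ' := by
    intro q ψ ψ' h
    ext v c
    exact congrArg (fun χ => χ v) (h c)
  refine cur_ext fun a => hev _ _ _ fun c => ?_
  have h1 : ∀ c, push (LinearMap.applyₗ c) (p + 1) (flipFirst φ) = cur (p + 1) φ c := fun c => rfl
  have h2 : push (LinearMap.applyₗ c) (p + 1) (push (coindLeft a) (p + 1) (flipFirst φ)) =
      cur (p + 1) φ (c * a) := rfl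
  have h3 : push (LinearMap.applyₗ c) (p + 1) (cur (p + 1) (push l.flip (p + 2) φ) a) =
      push (l c) (p + 1) (cur (p + 1) φ a) := rfl
  have h4 := congrArg (fun ψ => cur (p + 1) (cur (p + 2) ψ c) a) hφ
  simp only [cur_bimodDiff, cur_rightPart_succ, map_sub, LinearMap.sub_apply, cur_push,
    cur_mulFirst, map_zero, LinearMap.zero_apply] at h4
  rw [sub_sub_eq_add_sub, sub_eq_zero] at h4
  rw [h3, cur_bimodDiff, map_sub, h2, ← cur_push, ← rightPart_push (r' := r) (coindRight r)
    (LinearMap.applyₗ c) (fun _ _ => rfl), h1, cur_rightPart_succ, ← h4]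
  exact add_sub_cancel_right _ _

/-- Dimension shifting along `0 → M → Hom(A, M) → Q → 0`, with all bimodules treated at once. In
`Hom(A, M)` the cochain has a primitive, which can be corrected by a coboundary to have zero Koszul
part. Its image in `Q` is then closed, one degree lower and again without Koszul part, so it is
exact by induction. Lifting that primitive corrects the first one to take values in `M`. -/
theorem exists_bimodDiff_eq (p : ℕ) : ∀ (M : Type) [AddCommGroup M] [Module k M]
    (l r : MvPolynomial ι k →ₗ[k] Module.End k M), IsBimod l r →
    ∀ φ : HC k (MvPolynomial ι k) M (p + 1), bimodDiff l r (p + 1) φ = 0 →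
      toKoszul (X : ι → MvPolynomial ι k) (p + 1) φ = 0 → ∃ ψ, bimodDiff l r p ψ = φ := by
  induction p with
  | zero =>
    intro M _ _ l r h φ hφ hK
    refine ⟨0, ?_⟩
    rw [map_zero, exists_bimodDiff_eq_zero h hφ fun i => ?_]
    have := congrFun hK {i}
    rw [← const.symm.map_eq_zero_iff]
    exact (antisymm_singleton X (isInitial_decreasingList ι) (by simp [decreasingList]) φ).symm.trans
      this
  | succ p ih =>
    intro M _ _ l r h φ hφ hK
    let A := MvPolynomial ι k
    let η : M →ₗ[k] (A →ₗ[k] M) := l.flip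
    have hη : ∀ m, η m 1 = m := h.left_one
    have hηl : ∀ a m, η (l a m) = coindLeft a (η m) := fun a m =>
      LinearMap.ext fun c => (h.left_mul c a m).symm
    have hηr : ∀ a m, η (r a m) = coindRight r a (η m) := fun a m =>
      LinearMap.ext fun c => h.comm c a m
    have hI := h.coind
    have hsq : ∀ q ψ, bimodDiff coindLeft (coindRight r) (q + 1)
        (bimodDiff coindLeft (coindRight r) q ψ) = 0 :=
      bimodDiff_bimodDiff _ _ hI.left_mul hI.right_mul hI.comm
    -- the Koszul part of the flipped cochain can be removed
    obtain ⟨v, hv, hv'⟩ : ∃ v, IsHomogeneousOfDegree p v ∧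
        koszulDiff (coindDiff r) v = toKoszul (X : ι → A) (p + 1) (flipFirst φ) := by
      refine koszulDiff_coindDiff_exact r (fun i j m => ?_) p
        (isHomogeneousOfDegree_toKoszul _ _ _) ?_
      · rw [← h.right_mul, ← h.right_mul, mul_comm]
      · refine (toKoszul_bimodDiff (X : ι → A) coindLeft (coindRight r) (p + 1) (flipFirst φ)).symm.trans ?_
        rw [bimodDiff_flipFirst hφ, toKoszul_push, hK]
        funext I
        exact map_zero _
    -- Only a cochain with Koszul part `v` is needed here, so any `c` with `cᵢ(xⱼ) = δᵢⱼ` serves and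
    -- no Leibniz rule is required; reading off the coefficient of `xᵢ` is the simplest.
    let c : ι → A →ₗ[k] Module.End k (A →ₗ[k] M) := fun i =>
      LinearMap.toSpanSingleton k _ 1 ∘ₗ MvPolynomial.lcoeff k (Finsupp.single i 1)
    let χ := flipFirst φ - bimodDiff coindLeft (coindRight r) p (ofKoszul c p v)
    have hχ : bimodDiff coindLeft (coindRight r) (p + 1) χ = push η (p + 2) φ := by
      rw [map_sub, hsq, sub_zero, bimodDiff_flipFirst hφ]
    have hχK : toKoszul (X : ι → A) (p + 1) χ = 0 := by
      rw [map_sub, toKoszul_bimodDiff, toKoszul_ofKoszul _ _ _ hv, sub_eq_zero]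
      · exact hv'.symm
      · intro i j
        ext1 f
        simp [c, coeff_X, Finsupp.single_left_inj, eq_comm]
    let S := LinearMap.range η
    obtain ⟨l', r', hQ, hl', hr'⟩ := isBimod_quotient hI S
      (by rintro a _ ⟨m, rfl⟩; exact ⟨l a m, hηl a m⟩)
      (by rintro a _ ⟨m, rfl⟩; exact ⟨r a m, hηr a m⟩)
    obtain ⟨ψ, hψ⟩ := ih _ l' r' hQ (push S.mkQ (p + 1) χ)
      (by
        rw [bimodDiff_push coindLeft (coindRight r) S.mkQ hl' hr', hχ]
        ext v
        simp [S])
      (by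
        rw [toKoszul_push, hχK]
        funext I
        exact map_zero _)
    -- The section is only linear, not a bimodule map; it suffices for lifting the values of `ψ`.
    obtain ⟨s, hs⟩ := S.mkQ.exists_rightInverse_of_surjective S.range_mkQ
    let ξ := χ - bimodDiff coindLeft (coindRight r) p (push s p ψ)
    have hξ : push S.mkQ (p + 1) ξ = 0 := by
      rw [map_sub, ← bimodDiff_push coindLeft (coindRight r) S.mkQ hl' hr', sub_eq_zero, ← hψ]
      congr 1
      ext v
      exact (LinearMap.congr_fun hs _).symm
    -- The values of `ξ` lie in the image of `M`, on which evaluation at `1` inverts the embedding.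
    have hξ' : push η (p + 1) (push (LinearMap.applyₗ 1) (p + 1) ξ) = ξ := by
      ext1 v
      have : S.mkQ (ξ v) = 0 := congrArg (fun ω => ω v) hξ
      rw [Submodule.mkQ_apply, Submodule.Quotient.mk_eq_zero] at this
      obtain ⟨m, hm⟩ := this
      simp only [push_apply, ← hm]
      exact congrArg η (hη m)
    refine ⟨push (LinearMap.applyₗ 1) (p + 1) ξ, ?_⟩
    have h1 : push η (p + 2) (bimodDiff l r (p + 1) (push (LinearMap.applyₗ 1) (p + 1) ξ)) =
        push η (p + 2) φ := by
      rw [← bimodDiff_push l r η hηl hηr, hξ', map_sub, hsq, sub_zero, hχ]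
    ext1 v
    have h2 := congrArg (fun ω => ω v 1) h1
    exact (hη _).symm.trans (h2.trans (hη _))

end DimensionShift

/-! ## The comparison for the bimodule `A g` -/

section QuantumDerivative

variable {N : ℕ} (g : Fin N → ℂˣ)

theorem qderiv_monomial (i : Fin N) (γ : Fin N →₀ ℕ) (t : ℂ) :
    qderiv g i (monomial γ t) =
      monomial (γ - Finsupp.single i 1) (t * ∑ k ∈ Finset.range (γ i), (g i : ℂ) ^ k) := by
  have h : monomial γ t = t • basisMonomials (Fin N) ℂ γ := by
    simp [smul_monomial]
  rw [h, map_smul, qderiv, Module.Basis.constr_basis, smul_monomial, smul_eq_mul]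

theorem qderiv_eq_pderiv {i : Fin N} (hi : g i = 1) (a : PolyAlg N) :
    qderiv g i a = pderiv i a := by
  induction a using MvPolynomial.induction_on' with
  | monomial γ t => rw [qderiv_monomial, pderiv_monomial]; simp [hi]
  | add p q hp hq => rw [map_add, map_add, hp, hq]

theorem qderiv_X (i j : Fin N) : qderiv g i (X j) = if i = j then 1 else 0 := by
  rw [X, qderiv_monomial]
  split_ifs with h
  · subst h; simp
  · simp [Ne.symm h]

/-- The algebra map scaling the variables in a set by `g`. -/
def scale (S : Finset (Fin N)) : PolyAlg N →ₐ[ℂ] PolyAlg N :=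
  aeval (fun j => if j ∈ S then C (g j : ℂ) * X j else X j)

theorem scale_X (S : Finset (Fin N)) (j : Fin N) :
    scale g S (X j) = if j ∈ S then C (g j : ℂ) * X j else X j := by
  simp [scale]

theorem scale_monomial (i : Fin N) (γ : Fin N →₀ ℕ) (t : ℂ) :
    scale g {i} (monomial γ t) = monomial γ (t * (g i : ℂ) ^ γ i) := by
  rw [scale, aeval_monomial, monomial_eq (a := t * _), C_mul, mul_assoc, algebraMap_eq]
  congr 1
  rw [Finsupp.prod_fintype _ _ (by simp), Finsupp.prod_fintype _ _ (by simp),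
    ← Finset.mul_prod_erase _ _ (Finset.mem_univ i), ← Finset.mul_prod_erase _ _ (Finset.mem_univ i)]
  rw [if_pos (by simp), mul_pow, C_pow, mul_assoc]
  congr 2
  refine Finset.prod_congr rfl fun j hj => ?_
  rw [if_neg (by simpa using (Finset.mem_erase.1 hj).1)]

theorem scale_scale {S T : Finset (Fin N)} (h : Disjoint S T) (a : PolyAlg N) :
    scale g S (scale g T a) = scale g (S ∪ T) a := by
  have : (scale g S).comp (scale g T) = scale g (S ∪ T) := by
    refine MvPolynomial.algHom_ext fun j => ?_
    rw [AlgHom.comp_apply, scale_X, scale_X]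
    by_cases hT : j ∈ T
    · have hS : j ∉ S := fun hS => Finset.disjoint_left.1 h hS hT
      simp [hT, scale_X, hS, ← algebraMap_eq]
    · simp [hT, scale_X]
  exact DFunLike.congr_fun this a

/-- On monomials this is the geometric sum: `∂ᵍ_{xᵢ}` is the difference quotient of the scaling of
`xᵢ` by `λᵢ`. -/
theorem sub_scale (i : Fin N) (a : PolyAlg N) :
    a - scale g {i} a = (X i - C (g i : ℂ) * X i) * qderiv g i a := by
  induction a using MvPolynomial.induction_on' with
  | monomial γ t =>
    rw [scale_monomial, qderiv_monomial]
    have h1 : (X i - C (g i : ℂ) * X i : PolyAlg N) = C (1 - (g i : ℂ)) * X i := by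
      rw [map_sub, C_1]; ring
    by_cases h : γ i = 0
    · simp [h]
    · rw [h1, mul_assoc, mul_comm (X i), monomial_sub_mul_X h, C_mul_monomial, sub_eq_iff_eq_add,
        ← map_add]
      congr 1
      have := mul_neg_geom_sum (g i : ℂ) (γ i)
      linear_combination -t * this
  | add p q hp hq =>
    rw [map_add, map_add, mul_add, ← hp, ← hq]; ring

/-- For `λᵢ ≠ 1` the twisted Leibniz rule follows from `sub_scale` by cancelling `(1 - λᵢ) xᵢ` in
the domain `A`. For `λᵢ = 1` the quotient degenerates, and the ordinary Leibniz rule replaces it. -/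
theorem qderiv_mul (i : Fin N) (a b : PolyAlg N) :
    qderiv g i (a * b) = a * qderiv g i b + qderiv g i a * scale g {i} b := by
  by_cases hi : g i = 1
  · have h : scale g {i} b = b := by
      have h0 := sub_scale g i b
      rw [hi] at h0
      exact (sub_eq_zero.1 (by simpa using h0)).symm
    rw [qderiv_eq_pderiv g hi, qderiv_eq_pderiv g hi, qderiv_eq_pderiv g hi, h, pderiv_mul]
    ring
  · have h0 : (X i - C (g i : ℂ) * X i : PolyAlg N) ≠ 0 := by
      have h1 : (X i - C (g i : ℂ) * X i : PolyAlg N) = C (1 - (g i : ℂ)) * X i := by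
        rw [map_sub, C_1]; ring
      rw [h1]
      refine mul_ne_zero ?_ (X_ne_zero i)
      rw [Ne, C_eq_zero, sub_eq_zero]
      exact fun h => hi (Units.ext h.symm)
    refine mul_left_cancel₀ h0 ?_
    have h1 := sub_scale g i (a * b)
    have h2 := sub_scale g i a
    have h3 := sub_scale g i b
    rw [map_mul] at h1
    linear_combination -h1 + a * h3 + scale g {i} b * h2

theorem rho_eq_scale {i : Fin N} {L : List (Fin N)} (hL : IsInitial (i :: L)) :
    rho g i = scale g L.toFinset := by
  refine MvPolynomial.algHom_ext fun j => ?_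
  simp [rho, scale, hL.mem_iff]

theorem act_eq_scale : act g = scale g Finset.univ :=
  MvPolynomial.algHom_ext fun j => by simp [act, scale]

/-- The coefficients `ρᵢ(∂ᵍ_{xᵢ} a)` of the comparison map. -/
def quantumCoeff (i : Fin N) : PolyAlg N →ₗ[ℂ] Module.End ℂ (PolyAlg N) :=
  LinearMap.mul ℂ (PolyAlg N) ∘ₗ (rho g i).toLinearMap ∘ₗ qderiv g i

@[simp] theorem quantumCoeff_apply (i : Fin N) (a m : PolyAlg N) :
    quantumCoeff g i a m = rho g i (qderiv g i a) * m := rfl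

/-- The left action on `A`. -/
abbrev leftAct (N : ℕ) : PolyAlg N →ₗ[ℂ] Module.End ℂ (PolyAlg N) := LinearMap.mul ℂ (PolyAlg N)

/-- The right action on `A` twisted by an endomorphism. -/
def twistedAct (τ : PolyAlg N →ₐ[ℂ] PolyAlg N) : PolyAlg N →ₗ[ℂ] Module.End ℂ (PolyAlg N) :=
  LinearMap.mul ℂ (PolyAlg N) ∘ₗ τ.toLinearMap

@[simp] theorem twistedAct_apply (τ : PolyAlg N →ₐ[ℂ] PolyAlg N) (a m : PolyAlg N) :
    twistedAct τ a m = τ a * m := rfl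

theorem isBimod_act : IsBimod (leftAct N) (twistedAct (act g)) where
  left_one m := by simp
  right_one m := by simp
  left_mul a b m := by simp [mul_assoc]
  right_mul a b m := by simp only [twistedAct_apply, map_mul]; ring
  comm a b m := by simp only [twistedAct_apply, LinearMap.mul_apply']; ring

theorem hochschild_eq (p : ℕ) (φ : Cochain N p) :
    hochschild g p φ = bimodDiff (leftAct N) (twistedAct (act g)) p φ := by
  refine MultilinearMap.ext fun v => ?_
  have h : bimodDiff (leftAct N) (twistedAct (act g)) p φ v =
      v 0 * φ (Fin.tail v) - rightPart (twistedAct (act g)) p φ v := by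
    conv_lhs => rw [← Fin.cons_self_tail v, ← cur_apply, cur_bimodDiff]
    rw [_root_.sub_apply, cur_apply, Fin.cons_self_tail]
    rfl
  rw [h, rightPart_apply]
  simp only [hochschild, leftFace, innerFace, rightFace, LinearMap.coe_mk, AddHom.coe_mk,
    _root_.add_apply, _root_.sum_apply, _root_.smul_apply, MultilinearMap.mk'_apply,
    twistedAct_apply]
  rw [mul_comm (φ (Fin.init v))]
  have h2 : ∀ (n : ℕ) (a : PolyAlg N), ((-1 : ℂ) ^ n) • a = ((-1 : ℤ) ^ n) • a := by
    intro n a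
    rcases neg_one_pow_eq_or ℂ n with h | h <;> rcases Nat.even_or_odd n with h' | h' <;>
      simp [h'.neg_one_pow]
  simp only [h2, pow_succ, mul_neg_one, neg_smul, Finset.sum_neg_distrib]
  abel

theorem curving_eq (W : PolyAlg N) (p : ℕ) (φ : Cochain N (p + 1)) :
    curving W p φ = insertion W p φ := by
  refine MultilinearMap.ext fun v => ?_
  rw [insertion_apply]
  simp only [curving, LinearMap.coe_mk, AddHom.coe_mk, _root_.sum_apply, _root_.smul_apply,
    MultilinearMap.curryMid_apply_apply]
  refine Finset.sum_congr rfl fun i _ => ?_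
  rcases Nat.even_or_odd (i : ℕ) with h' | h' <;> simp [h'.neg_one_pow]

theorem exists_hochschild_eq {p : ℕ} {φ : Cochain N (p + 1)} (hφ : hochschild g (p + 1) φ = 0)
    (hK : toKoszul (X : Fin N → PolyAlg N) (p + 1) φ = 0) : ∃ ψ, hochschild g p ψ = φ := by
  rw [hochschild_eq] at hφ
  obtain ⟨ψ, hψ⟩ := exists_bimodDiff_eq p _ _ _ (isBimod_act g) φ hφ hK
  exact ⟨ψ, by rw [hochschild_eq, hψ]⟩

theorem eq_zero_of_toKoszul_eq_zero {φ : Cochain N 0}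
    (hK : toKoszul (X : Fin N → PolyAlg N) 0 φ = 0) : φ = 0 := by
  rw [← const.symm.map_eq_zero_iff, ← antisymm_degree_zero (X : Fin N → PolyAlg N) (I := ∅)
    (L := decreasingList (Fin N)) (by simp)]
  exact congrFun hK ∅

theorem hochschild_hochschild (p : ℕ) (φ : Cochain N p) :
    hochschild g (p + 1) (hochschild g p φ) = 0 := by
  rw [hochschild_eq, hochschild_eq]
  exact bimodDiff_bimodDiff _ _ (isBimod_act g).left_mul (isBimod_act g).right_mul
    (isBimod_act g).comm p φ

theorem curving_curving (W : PolyAlg N) (p : ℕ) (φ : Cochain N (p + 2)) :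
    curving W p (curving W (p + 1) φ) = 0 := by
  rw [curving_eq, curving_eq, insertion_insertion]

theorem curving_hochschild {W : PolyAlg N} (hW : act g W = W) (p : ℕ) (φ : Cochain N (p + 1)) :
    curving W (p + 1) (hochschild g (p + 1) φ) + hochschild g p (curving W p φ) = 0 := by
  rw [curving_eq, curving_eq, hochschild_eq, hochschild_eq]
  refine (insertion_bimodDiff _ _ _ _ _).trans ?_
  refine MultilinearMap.ext fun v => ?_
  simp [hW]

theorem curving_hochschild_zero {W : PolyAlg N} (hW : act g W = W) (φ : Cochain N 0) :
    curving W 0 (hochschild g 0 φ) = 0 := by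
  rw [curving_eq, hochschild_eq]
  refine (insertion_bimodDiff_zero _ _ _ _).trans ?_
  refine MultilinearMap.ext fun v => ?_
  simp [hW]

/-- The operators `m ↦ xᵢ m - m ᵍxᵢ`. -/
def twistedCommutator (i : Fin N) : Module.End ℂ (PolyAlg N) :=
  leftAct N (X i) - twistedAct (act g) (X i)

theorem twistedCommutator_apply (i : Fin N) (m : PolyAlg N) :
    twistedCommutator g i m = (X i - C (g i : ℂ) * X i) * m := by
  simp [twistedCommutator, act, sub_mul]

theorem toKoszul_hochschild (p : ℕ) (φ : Cochain N p) :
    toKoszul (X : Fin N → PolyAlg N) (p + 1) (hochschild g p φ) =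
      koszulDiff (twistedCommutator g) (toKoszul X p φ) := by
  rw [hochschild_eq]
  exact toKoszul_bimodDiff _ _ _ _ _

theorem toKoszul_ofKoszul_quantumCoeff {p : ℕ} {u : Finset (Fin N) → PolyAlg N}
    (hu : IsHomogeneousOfDegree p u) :
    toKoszul (X : Fin N → PolyAlg N) p (ofKoszul (quantumCoeff g) p u) = u := by
  refine toKoszul_ofKoszul _ _ (fun i j => ?_) hu
  refine LinearMap.ext fun m => ?_
  rw [quantumCoeff_apply, qderiv_X]
  split_ifs <;> simp

/-- The action of `g` is the composite of the scalings of single variables. Switching on `xᵢ` after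
its predecessors changes the right action by `ρᵢ(∂ᵍ_{xᵢ} a) (xᵢ - λᵢ xᵢ)`, so the quantum
coefficients meet the hypotheses of `bimodDiff_ofKoszul`. -/
theorem hochschild_ofKoszul (p : ℕ) (u : Finset (Fin N) → PolyAlg N) :
    hochschild g p (ofKoszul (quantumCoeff g) p u) =
      ofKoszul (quantumCoeff g) (p + 1) (koszulDiff (twistedCommutator g) u) := by
  rw [hochschild_eq]
  have h0 : twistedAct (act g) =
      (fun L : List (Fin N) => twistedAct (scale g L.toFinset)) (decreasingList (Fin N)) := by
    simp only [toFinset_decreasingList, act_eq_scale]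
  rw [h0]
  have hmul : ∀ i (L : List (Fin N)), IsInitial (i :: L) → ∀ a,
      scale g L.toFinset (scale g {i} a) = scale g (i :: L).toFinset a := by
    intro i L hL a
    rw [scale_scale, List.toFinset_cons, Finset.insert_eq, Finset.union_comm]
    simpa using hL.notMem
  refine bimodDiff_ofKoszul (quantumCoeff g) (leftAct N)
    (fun L => twistedAct (scale g L.toFinset)) (twistedCommutator g) ?_ ?_ ?_ ?_ ?_ p u
  · refine LinearMap.ext fun a => LinearMap.ext fun m => ?_
    have : scale g (∅ : Finset (Fin N)) = AlgHom.id ℂ _ :=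
      MvPolynomial.algHom_ext fun j => by simp [scale]
    simp [this]
  · intro i L hL a m
    have h1 := congrArg (scale g L.toFinset) (sub_scale g i a)
    rw [map_sub, hmul i L hL, map_mul, map_sub, map_mul, scale_X, if_neg (by simpa using hL.notMem),
      ← algebraMap_eq, AlgHom.commutes, algebraMap_eq] at h1
    simp only [twistedAct_apply, quantumCoeff_apply, twistedCommutator_apply, rho_eq_scale g hL]
    linear_combination m * h1
  · intro i L hL a b m
    simp only [twistedAct_apply, quantumCoeff_apply, rho_eq_scale g hL, qderiv_mul, map_add, map_mul,
      hmul i L hL]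
    ring
  · intro i a b m
    simp only [LinearMap.mul_apply', quantumCoeff_apply]
    ring
  · intro i j a m
    simp only [twistedCommutator_apply, quantumCoeff_apply]
    ring

theorem curving_ofKoszul (W : PolyAlg N) (p : ℕ) (u : Finset (Fin N) → PolyAlg N) :
    curving W p (ofKoszul (quantumCoeff g) (p + 1) u) =
      ofKoszul (quantumCoeff g) p (koszulCon (fun j => quantumCoeff g j W) u) := by
  rw [curving_eq]
  refine insertion_ofKoszul _ _ (fun i j a b m => ?_) p u
  simp only [quantumCoeff_apply]
  ring

theorem koszulCochain_apply (I : Finset (Fin N)) {L : List (Fin N)} (hL : IsInitial L) (p : ℕ)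
    (e : Fin p ↪o Fin N) (he : ∀ i, i ∈ Set.range e ↔ i ∈ I ∧ i ∈ L) (m : PolyAlg N)
    (v : Fin p → PolyAlg N) :
    koszulCochain (quantumCoeff g) I L p m v =
      m * ∏ k, rho g (e k) (qderiv g (e k) (v k)) := by
  induction L generalizing p with
  | nil =>
    cases p with
    | zero => simp [koszulCochain, const]
    | succ p => exact absurd ((he (e 0)).1 ⟨0, rfl⟩).2 (by simp)
  | cons i L ih =>
    by_cases hi : i ∈ I
    · cases p with
      | zero =>
        obtain ⟨k, -⟩ := (he i).2 ⟨hi, by simp⟩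
        exact k.elim0
      | succ p =>
        -- The list is decreasing, so its head is the largest index and belongs to the outermost cup
        -- product, which takes the last argument.
        have hlast : e (Fin.last p) = i := by
          obtain ⟨k, hk⟩ := (he i).2 ⟨hi, by simp⟩
          refine le_antisymm ?_ (hk ▸ e.monotone (Fin.le_last k))
          rcases List.mem_cons.1 ((he (e (Fin.last p))).1 ⟨_, rfl⟩).2 with h | h
          · exact h.le
          · exact ((hL.mem_iff _).1 h).le
        have he' : ∀ j, j ∈ Set.range (Fin.castSuccOrderEmb.trans e) ↔ j ∈ I ∧ j ∈ L := by
          intro j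
          constructor
          · rintro ⟨k, rfl⟩
            have h1 := (he (e k.castSucc)).1 ⟨_, rfl⟩
            refine ⟨h1.1, (hL.mem_iff _).2 ?_⟩
            rw [← hlast]
            exact e.strictMono (Fin.castSucc_lt_last k)
          · rintro ⟨h1, h2⟩
            obtain ⟨k, rfl⟩ := (he j).2 ⟨h1, List.mem_cons_of_mem _ h2⟩
            cases k using Fin.lastCases with
            | last => exact absurd (hlast ▸ h2) hL.notMem
            | cast k => exact ⟨k, rfl⟩
        have := ih hL.of_cons p (Fin.castSuccOrderEmb.trans e) he' (Fin.init v)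
        simp only [koszulCochain, hi, if_true, LinearMap.comp_apply]
        rw [cup_apply, this, quantumCoeff_apply, Fin.prod_univ_castSucc, hlast]
        simp only [RelEmbedding.coe_trans, Function.comp_apply, Fin.castSuccOrderEmb_apply, Fin.init]
        ring
    · have he' : ∀ j, j ∈ Set.range e ↔ j ∈ I ∧ j ∈ L := by
        intro j
        rw [he]
        refine and_congr_right fun hj => ?_
        rw [List.mem_cons, or_iff_right]
        rintro rfl
        exact hi hj
      rw [← ih hL.of_cons p e he']
      cases p <;> simp [koszulCochain, hi]

theorem thetaCochain_eq (a : FixedPoly g) :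
    thetaCochain g a = ofKoszul (quantumCoeff g) (codimFix g)
      (Pi.single (movingIndices g) (rename Subtype.val a)) := by
  rw [ofKoszul_apply, Finset.sum_eq_single (movingIndices g)]
  · refine MultilinearMap.ext fun v => ?_
    rw [koszulCochain_apply g _ (isInitial_decreasingList (Fin N)) _
      (show Fin (codimFix g) ↪o Fin N from (movingIndices g).orderEmbOfFin rfl), Pi.single_eq_same]
    · rw [thetaCochain, _root_.smul_apply, smul_eq_mul]
      rfl
    · intro i
      simp only [decreasingList, Finset.mem_sort, Finset.mem_univ, and_true]
      exact Set.ext_iff.1 (Finset.range_orderEmbOfFin (movingIndices g) rfl) i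
  · intro J _ hJ
    rw [Pi.single_eq_of_ne hJ, map_zero]
  · simp

end QuantumDerivative

/-! ## Exactness of the Koszul complex of a family generating an ideal of large depth -/

section Depth

variable {R : Type*} [CommRing R] {ι : Type*} [LinearOrder ι] [Fintype ι]

/-- The elements of a list form a weakly regular sequence modulo an ideal. -/
def IsRegularMod : Ideal R → List R → Prop
  | _, [] => True
  | J, z :: zs => (∀ a, z * a ∈ J → a ∈ J) ∧ IsRegularMod (J ⊔ Ideal.span {z}) zs

/-- Contraction of Koszul cochains with a covector. -/
abbrev mulCon (f : ι → R) : (Finset ι → R) →ₗ[R] (Finset ι → R) :=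
  koszulCon fun i => LinearMap.mulLeft R (f i)

theorem mulCon_apply (f : ι → R) (k : Finset ι → R) (I : Finset ι) :
    mulCon f k I = ∑ i ∈ Iᶜ, koszulSign i I • (f i * k (insert i I)) :=
  koszulCon_apply _ _ _

theorem mulCon_mem {J : Ideal R} (f : ι → R) {k : Finset ι → R} (hk : ∀ I, k I ∈ J)
    (I : Finset ι) : mulCon f k I ∈ J := by
  rw [mulCon_apply]
  exact J.sum_mem fun i _ => J.toAddSubgroup.zsmul_mem (J.mul_mem_left _ (hk _)) _

theorem koszulDiff_mulLeft_mem {J : Ideal R} (c : ι → R) {k : Finset ι → R} (hk : ∀ I, k I ∈ J)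
    (I : Finset ι) : koszulDiff (fun i => LinearMap.mulLeft R (c i)) k I ∈ J := by
  rw [koszulDiff_apply]
  exact J.sum_mem fun i _ => J.toAddSubgroup.zsmul_mem (J.mul_mem_left _ (hk _)) _

/-- Depth sensitivity of the Koszul complex, by induction on the regular sequence. If `z = ∑ fⱼ cⱼ`,
then `c ∧ -` is a homotopy for multiplication by `z`. It raises the degree by one while one element
of the sequence moves into `J`, which preserves the inequality; when the sequence is used up, the
degree exceeds the number of available covectors and `k = 0`. -/
theorem mulCon_exact_mod (f : ι → R) (S : Finset ι) (zs : List R)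
    (hz : ∀ z ∈ zs, ∃ c : ι → R, (∀ j ∉ S, c j = 0) ∧ ∑ j, f j * c j = z) :
    ∀ (J : Ideal R), IsRegularMod J zs → ∀ (p : ℕ) (k : Finset ι → R),
      IsHomogeneousOfDegree p k → (∀ I, k I ≠ 0 → I ⊆ S) → (∀ I, mulCon f k I ∈ J) →
      S.card < p + zs.length → ∃ u, ∀ I, k I - mulCon f u I ∈ J := by
  induction zs with
  | nil =>
    intro J _ p k hk hS _ hp
    refine ⟨0, fun I => ?_⟩
    have : k I = 0 := by
      by_contra h
      have h1 := hk I h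
      have h2 := Finset.card_le_card (hS I h)
      simp at hp
      omega
    simp [this]
  | cons z zs ih =>
    intro J hJ p k hk hS hkJ hp
    obtain ⟨c, hc, hcz⟩ := hz z (by simp)
    let T : ι → Module.End R R := fun i => LinearMap.mulLeft R (c i)
    have hH : ∀ w I, (koszulDiff T (mulCon f w) + mulCon f (koszulDiff T w)) I = z * w I := by
      intro w I
      rw [koszulDiff_koszulCon (c := fun _ => 0)]
      · simp [T, ← hcz, Finset.sum_mul, mul_assoc]
      · intro i j
        ext
        simp [T, mul_comm]
    obtain ⟨u, hu⟩ := ih (fun z hz' => hz z (List.mem_cons_of_mem _ hz')) (J ⊔ Ideal.span {z}) hJ.2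
      (p + 1) (koszulDiff T k) (hk.koszulDiff T) (fun I hI => by
        rw [koszulDiff_apply] at hI
        obtain ⟨i, hi, h⟩ := Finset.exists_ne_zero_of_sum_ne_zero hI
        have h1 : i ∈ S := by
          by_contra h2
          exact h (by simp [T, hc i h2])
        have h2 : I.erase i ⊆ S := hS _ fun h2 => h (by simp [h2])
        rw [← Finset.insert_erase hi]
        exact Finset.insert_subset h1 h2)
      (fun I => by
        have h1 := hH k I
        rw [Pi.add_apply, ← eq_sub_iff_add_eq'] at h1
        rw [h1]
        refine Ideal.sub_mem _ (Ideal.mem_sup_right (Ideal.mul_mem_right _ _ (Ideal.mem_span_singleton_self z)))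
          (Ideal.mem_sup_left (koszulDiff_mulLeft_mem c hkJ I)))
      (by simp at hp; omega)
    have hdec : ∀ I, ∃ y j, j ∈ J ∧ koszulDiff T k I = mulCon f u I + z * y + j := by
      intro I
      obtain ⟨j, hj, y, hy, h⟩ := Submodule.mem_sup.1 (hu I)
      obtain ⟨y, rfl⟩ := Ideal.mem_span_singleton'.1 hy
      exact ⟨y, j, hj, by linear_combination -h⟩
    choose y j hj hyj using hdec
    -- Modulo `J`, the induction hypothesis reads `c ∧ k = f ⌟ u + z y`. Contracting once more kills
    -- `u` and leaves `z k = z (f ⌟ y)`; regularity of `z` cancels it, so the quotient `y` is the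
    -- primitive.
    refine ⟨y, fun I => hJ.1 _ ?_⟩
    have h1 : koszulDiff T k = mulCon f u + z • y + j := funext hyj
    have h2 : mulCon f (koszulDiff T k) = z • mulCon f y + mulCon f j := by
      rw [h1, map_add, map_add, map_smul, koszulCon_koszulCon, zero_add]
      intro i j
      ext
      simp [mul_comm]
    have h3 := hH k I
    rw [h2] at h3
    have h4 : z * (k I - mulCon f y I) = koszulDiff T (mulCon f k) I + mulCon f j I := by
      simp only [Pi.add_apply, Pi.smul_apply, smul_eq_mul] at h3
      linear_combination -h3
    rw [h4]
    exact J.add_mem (koszulDiff_mulLeft_mem c hkJ I) (mulCon_mem f hj I)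

theorem mulCon_exact (f : ι → R) (S : Finset ι) (hf : ∀ j ∉ S, f j = 0) (zs : List R)
    (hz : ∀ z ∈ zs, ∃ c : ι → R, (∀ j ∉ S, c j = 0) ∧ ∑ j, f j * c j = z)
    (hreg : IsRegularMod ⊥ zs) (hlen : zs.length = S.card) {p : ℕ} {k : Finset ι → R}
    (hk : IsHomogeneousOfDegree (p + 1) k) (hS : ∀ I, k I ≠ 0 → I ⊆ S) (hk0 : mulCon f k = 0) :
    ∃ u, IsHomogeneousOfDegree (p + 2) u ∧ (∀ I, u I ≠ 0 → I ⊆ S) ∧ mulCon f u = k := by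
  obtain ⟨u, hu⟩ := mulCon_exact_mod f S zs hz ⊥ hreg (p + 1) k hk hS (fun I => by simp [hk0])
    (by omega)
  -- The primitive found above need be neither homogeneous nor supported in `S`; discarding the
  -- other components does not affect its contraction in the relevant degree, since `f` vanishes off
  -- `S`.
  refine ⟨fun I => if I.card = p + 2 ∧ I ⊆ S then u I else 0, fun I hI => ?_, fun I hI => ?_, ?_⟩
  · by_contra h
    exact hI (if_neg fun h' => h h'.1)
  · by_contra h
    exact hI (if_neg fun h' => h h'.2)
  · funext I
    have h1 := hu I
    rw [Ideal.mem_bot, sub_eq_zero] at h1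
    by_cases hI : I.card = p + 1 ∧ I ⊆ S
    · rw [h1, mulCon_apply, mulCon_apply]
      refine Finset.sum_congr rfl fun i hi => ?_
      rw [Finset.mem_compl] at hi
      by_cases hiS : i ∈ S
      · rw [if_pos ⟨by rw [Finset.card_insert_of_notMem hi, hI.1], Finset.insert_subset hiS hI.2⟩]
      · simp [hf i hiS]
    · have h2 : k I = 0 := by
        by_contra h
        exact hI ⟨hk I h, hS I h⟩
      rw [h2, mulCon_apply]
      refine Finset.sum_eq_zero fun i hi => ?_
      rw [Finset.mem_compl] at hi
      rw [if_neg, mul_zero, smul_zero]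
      rintro ⟨h3, h4⟩
      rw [Finset.card_insert_of_notMem hi] at h3
      exact hI ⟨by omega, (Finset.subset_insert i I).trans h4⟩

/-- Membership in a monomial ideal is tested monomial by monomial, and multiplying by a power of
`xᵢ` does not affect divisibility by powers of the other variables. -/
theorem isRegularMod_X_pow {σ : Type*} (n : ℕ) (l : List σ) (hl : l.Nodup) (s : Set σ)
    (hs : ∀ i ∈ l, i ∉ s) :
    IsRegularMod (Ideal.span ((fun e => monomial e (1 : ℂ)) '' ((fun i => Finsupp.single i n) '' s)))
      (l.map fun i => (X i ^ n : MvPolynomial σ ℂ)) := by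
  induction l generalizing s with
  | nil => trivial
  | cons i l ih =>
    refine ⟨fun a ha => ?_, ?_⟩
    · rw [mem_ideal_span_monomial_image] at ha ⊢
      intro γ hγ
      obtain ⟨_, ⟨j, hj, rfl⟩, h⟩ := ha (Finsupp.single i n + γ) (by
        change _ ∈ (X i ^ n * a).support
        rw [mem_support_iff, X_pow_eq_monomial, coeff_monomial_mul, one_mul]
        exact mem_support_iff.1 hγ)
      refine ⟨_, ⟨j, hj, rfl⟩, ?_⟩
      have hij : i ≠ j := fun h => hs i (by simp) (h ▸ hj)
      rw [Finsupp.single_le_iff] at h ⊢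
      simpa [hij] using h
    · have h1 : Ideal.span ((fun e => monomial e (1 : ℂ)) '' ((fun i => Finsupp.single i n) '' s)) ⊔
          Ideal.span {(X i ^ n : MvPolynomial σ ℂ)} =
          Ideal.span ((fun e => monomial e (1 : ℂ)) '' ((fun i => Finsupp.single i n) '' insert i s)) := by
        rw [← Ideal.span_union, Set.image_insert_eq, Set.image_insert_eq, X_pow_eq_monomial,
          Set.union_singleton]
      rw [h1]
      refine ih (List.nodup_cons.1 hl).2 (insert i s) fun j hj h => ?_
      rcases h with rfl | h
      · exact (List.nodup_cons.1 hl).1 hj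
      · exact hs j (List.mem_cons_of_mem _ hj) h

end Depth

/-! ## The Koszul complexes of `A` and of `A_g` -/

section FixedPart

variable {N : ℕ} (g : Fin N → ℂˣ)

theorem mem_movingIndices {i : Fin N} : i ∈ movingIndices g ↔ g i ≠ 1 := by
  simp [movingIndices]

theorem restrict_X (i : Fin N) :
    restrict g (X i) = if h : g i = 1 then X ⟨i, h⟩ else 0 := by
  simp [restrict]

theorem restrict_rename (a : FixedPoly g) :
    restrict g (rename Subtype.val a : PolyAlg N) = a := by
  have : (restrict g).comp (rename Subtype.val) = AlgHom.id ℂ (FixedPoly g) := by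
    refine MvPolynomial.algHom_ext fun i => ?_
    simp [restrict_X, i.2]
  exact DFunLike.congr_fun this a

theorem restrict_commutator (i : Fin N) :
    restrict g (X i - C (g i : ℂ) * X i) = 0 := by
  rw [map_sub, map_mul, restrict_X, ← algebraMap_eq, AlgHom.commutes]
  split_ifs with h <;> simp [h]

theorem restrict_rho (i : Fin N) (a : PolyAlg N) : restrict g (rho g i a) = restrict g a := by
  have : (restrict g).comp (rho g i) = restrict g := by
    refine MvPolynomial.algHom_ext fun j => ?_
    rw [AlgHom.comp_apply, rho, aeval_X]
    split_ifs with h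
    · have h := restrict_commutator g j
      rw [map_sub, sub_eq_zero] at h
      exact h.symm
    · rfl
  exact DFunLike.congr_fun this a

theorem restrict_pderiv (j : {i : Fin N // g i = 1}) (a : PolyAlg N) :
    restrict g (pderiv j.1 a) = pderiv j (restrict g a) := by
  induction a using MvPolynomial.induction_on with
  | C t => rw [pderiv_C, map_zero, ← algebraMap_eq, AlgHom.commutes, algebraMap_eq, pderiv_C]
  | add p q hp hq => simp [hp, hq]
  | mul_X p i hp =>
    rw [pderiv_mul, map_add, map_mul, map_mul, map_mul, pderiv_mul, hp, restrict_X]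
    congr 2
    by_cases h : i = j.1
    · subst h
      simp [j.2]
    · rw [pderiv_X_of_ne h, map_zero]
      split_ifs with h'
      · rw [pderiv_X_of_ne fun h1 => h (congrArg Subtype.val h1)]
      · rw [map_zero]

/-- The kernel of restriction is the ideal generated by the moving variables. -/
theorem coeff_eq_zero_of_restrict_eq_zero {a : PolyAlg N} (ha : restrict g a = 0)
    {γ : Fin N →₀ ℕ} (hγ : ∀ i ∈ movingIndices g, γ i = 0) : coeff γ a = 0 := by
  let I : Ideal (PolyAlg N) := Ideal.span (X '' (movingIndices g : Set (Fin N)))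
  have h : (Ideal.Quotient.mkₐ ℂ I).comp ((rename Subtype.val).comp (restrict g)) =
      Ideal.Quotient.mkₐ ℂ I := by
    refine MvPolynomial.algHom_ext fun i => ?_
    rw [AlgHom.comp_apply, AlgHom.comp_apply, restrict_X]
    split_ifs with h
    · simp
    · rw [map_zero, map_zero, eq_comm]
      refine Ideal.Quotient.eq_zero_iff_mem.2 (Ideal.subset_span ⟨i, ?_, rfl⟩)
      simpa [mem_movingIndices] using h
  have h1 := DFunLike.congr_fun h a
  rw [AlgHom.comp_apply, AlgHom.comp_apply, ha, map_zero, map_zero, eq_comm] at h1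
  have h2 : a ∈ I := Ideal.Quotient.eq_zero_iff_mem.1 h1
  by_contra h3
  obtain ⟨i, hi, h4⟩ := mem_ideal_span_X_image.1 h2 γ (mem_support_iff.2 h3)
  exact h4 (hγ i hi)

/-- The Koszul cochain of `A_g` obtained by removing the moving covectors and restricting. -/
def fixedPart : (Finset (Fin N) → PolyAlg N) →ₗ[ℂ] (Finset (Fin N) → FixedPoly g) where
  toFun k J := if Disjoint J (movingIndices g) then restrict g (k (J ∪ movingIndices g)) else 0
  map_add' k k' := by ext1 J; by_cases h : Disjoint J (movingIndices g) <;> simp [h]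
  map_smul' c k := by ext1 J; by_cases h : Disjoint J (movingIndices g) <;> simp [h]

theorem fixedPart_apply (k : Finset (Fin N) → PolyAlg N) (J : Finset (Fin N)) :
    fixedPart g k J =
      if Disjoint J (movingIndices g) then restrict g (k (J ∪ movingIndices g)) else 0 := rfl

/-- A section of `fixedPart` on cochains supported on the fixed covectors. -/
def inflate (u : Finset (Fin N) → FixedPoly g) (I : Finset (Fin N)) : PolyAlg N :=
  if movingIndices g ⊆ I then rename Subtype.val (u (I \ movingIndices g)) else 0

theorem fixedPart_inflate {u : Finset (Fin N) → FixedPoly g}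
    (hu : ∀ J, u J ≠ 0 → Disjoint J (movingIndices g)) : fixedPart g (inflate g u) = u := by
  funext J
  rw [fixedPart_apply]
  split_ifs with h
  · rw [inflate, if_pos Finset.subset_union_right, restrict_rename,
      Finset.union_sdiff_cancel_right h]
  · by_contra h1
    exact h (hu J (Ne.symm h1))

theorem isHomogeneousOfDegree_inflate {u : Finset (Fin N) → FixedPoly g} {p : ℕ}
    (hu : ∀ J, u J ≠ 0 → J.card + codimFix g = p) : IsHomogeneousOfDegree p (inflate g u) := by
  intro I hI
  rw [inflate] at hI
  split_ifs at hI with h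
  · rw [← hu _ fun h1 => hI (by rw [h1, map_zero]), codimFix, Finset.card_sdiff_add_card_eq_card h]
  · exact absurd rfl hI

theorem twistedCommutator_of_fixed {i : Fin N} (hi : g i = 1) : twistedCommutator g i = 0 := by
  refine LinearMap.ext fun m => ?_
  rw [twistedCommutator_apply, hi]
  simp

theorem koszulDiff_inflate (u : Finset (Fin N) → FixedPoly g) :
    koszulDiff (twistedCommutator g) (inflate g u) = 0 := by
  funext I
  rw [koszulDiff_apply]
  refine Finset.sum_eq_zero fun i _ => ?_
  by_cases hi : g i = 1
  · simp [twistedCommutator_of_fixed g hi]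
  · rw [inflate, if_neg, map_zero, smul_zero]
    exact fun h => Finset.notMem_erase i I (h ((mem_movingIndices g).2 hi))

/-- Every coefficient `(1 - λᵢ) xᵢ` of the differential vanishes on `Fix(g)`: either `λᵢ = 1`, or
`xᵢ` is a moving coordinate. -/
theorem fixedPart_koszulDiff (k : Finset (Fin N) → PolyAlg N) :
    fixedPart g (koszulDiff (twistedCommutator g) k) = 0 := by
  funext J
  rw [fixedPart_apply]
  split_ifs with h
  · rw [koszulDiff_apply, map_sum]
    refine Finset.sum_eq_zero fun i _ => ?_
    rw [map_zsmul, twistedCommutator_apply, map_mul, restrict_commutator, zero_mul, smul_zero]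
  · rfl

/-- The coefficients `±∂ⱼ W_g` of the contraction on the Koszul cochains of `A_g`. -/
def jacCoeff (W : PolyAlg N) (j : Fin N) : FixedPoly g :=
  if h : g j = 1 then koszulSign j (movingIndices g) • pderiv ⟨j, h⟩ (restrict g W) else 0

/-- All moving `eᵢ` are already present, so only fixed `j` contribute. There `∂ᵍ_{xⱼ}` is the
ordinary derivative and `ρⱼ(g)` is invisible after restriction, which leaves `∂ⱼ W_g` up to the sign
of moving `eⱼ` past the smaller moving covectors. -/
theorem fixedPart_koszulCon (W : PolyAlg N) (k : Finset (Fin N) → PolyAlg N) :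
    fixedPart g (koszulCon (fun j => quantumCoeff g j W) k) =
      mulCon (jacCoeff g W) (fixedPart g k) := by
  funext J
  rw [fixedPart_apply, mulCon_apply]
  split_ifs with h
  · rw [koszulCon_apply, map_sum, Finset.compl_union]
    symm
    refine (Finset.sum_subset Finset.inter_subset_left fun i hi hi' => ?_).symm.trans
      (Finset.sum_congr rfl fun i hi => ?_)
    · have h1 : g i ≠ 1 := fun h1 => hi' (Finset.mem_inter.2 ⟨hi, by simp [mem_movingIndices, h1]⟩)
      rw [jacCoeff, dif_neg h1, zero_mul, smul_zero]
    · have h1 : i ∉ movingIndices g := by simpa using (Finset.mem_inter.1 hi).2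
      have h2 : g i = 1 := by simpa [mem_movingIndices] using h1
      rw [jacCoeff, dif_pos h2, fixedPart_apply, if_pos (Finset.disjoint_insert_left.2 ⟨h1, h⟩),
        map_zsmul, quantumCoeff_apply, map_mul, restrict_rho, qderiv_eq_pderiv g h2,
        restrict_pderiv g ⟨i, h2⟩, koszulSign_union i h, Finset.insert_union, smul_mul_assoc,
        smul_smul]
  · refine (Finset.sum_eq_zero fun i _ => ?_).symm
    rw [fixedPart_apply, if_neg, mul_zero, smul_zero]
    exact fun h' => h (h'.mono_left (Finset.subset_insert i J))

/-- Operators conjugate to the twisted commutators. -/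
def commutatorHomotopy (i : Fin N) : Module.End ℂ (PolyAlg N) :=
  (1 - (g i : ℂ))⁻¹ • (pderiv i).toLinearMap

theorem commutatorHomotopy_apply (i : Fin N) (a : PolyAlg N) :
    commutatorHomotopy g i a = (1 - (g i : ℂ))⁻¹ • pderiv i a := rfl

theorem twistedCommutator_eq (i : Fin N) (m : PolyAlg N) :
    twistedCommutator g i m = (1 - (g i : ℂ)) • (X i * m) := by
  rw [twistedCommutator_apply, smul_eq_C_mul, map_sub, C_1]
  ring

theorem twistedCommutator_mul_comm (i j : Fin N) :
    twistedCommutator g i * twistedCommutator g j = twistedCommutator g j * twistedCommutator g i := by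
  refine LinearMap.ext fun m => ?_
  simp only [Module.End.mul_apply, twistedCommutator_apply]
  ring

/-- For a moving index this is `[xᵢ, ∂ᵢ] = -1`. For a fixed index both operators are zero, by the
convention `0⁻¹ = 0`. -/
theorem twistedCommutator_mul_commutatorHomotopy (i j : Fin N) :
    twistedCommutator g i * commutatorHomotopy g j =
      commutatorHomotopy g j * twistedCommutator g i +
        if i = j then algebraMap ℂ _ (if i ∈ movingIndices g then (-1 : ℂ) else 0) else 0 := by
  refine LinearMap.ext fun m => ?_
  rw [LinearMap.add_apply, Module.End.mul_apply, Module.End.mul_apply, commutatorHomotopy_apply,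
    commutatorHomotopy_apply, twistedCommutator_eq, twistedCommutator_eq, Derivation.map_smul,
    pderiv_mul]
  by_cases hij : i = j
  · subst hij
    rw [if_pos rfl, pderiv_X_self, Module.algebraMap_end_apply]
    by_cases hi : g i = 1
    · simp [hi, mem_movingIndices]
    · have h1 : (1 - (g i : ℂ)) ≠ 0 := by
        rw [sub_ne_zero]
        exact fun h => hi (Units.ext h.symm)
      rw [if_pos ((mem_movingIndices g).2 hi), mul_smul_comm, smul_smul, smul_smul,
        mul_inv_cancel₀ h1, inv_mul_cancel₀ h1]
      simp
  · rw [if_neg hij, pderiv_X_of_ne hij, LinearMap.zero_apply, zero_mul, zero_add, add_zero,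
      mul_smul_comm, smul_comm]

/-- The weight of `x^γ e_I`: the eigenvalue of the Euler operator. -/
def eulerWeight (I : Finset (Fin N)) (γ : Fin N →₀ ℕ) : ℕ :=
  ∑ i ∈ movingIndices g, γ i + (movingIndices g \ I).card

/-- Each moving `i` contributes `γᵢ + 1`, diminished by one if `i ∈ I`. The total vanishes exactly
when `x^γ` has no moving variable and `I` contains all moving indices, which is what `fixedPart`
retains. -/
theorem coeff_euler (k : Finset (Fin N) → PolyAlg N) (I : Finset (Fin N)) (γ : Fin N →₀ ℕ) :
    coeff γ ((koszulDiff (twistedCommutator g) (koszulCon (commutatorHomotopy g) k) +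
      koszulCon (commutatorHomotopy g) (koszulDiff (twistedCommutator g) k)) I) =
        eulerWeight g I γ * coeff γ (k I) := by
  rw [koszulDiff_koszulCon _ _ _ (twistedCommutator_mul_commutatorHomotopy g), coeff_add, coeff_smul,
    coeff_sum]
  have h1 : ∀ i, coeff γ (commutatorHomotopy g i (twistedCommutator g i (k I))) =
      if i ∈ movingIndices g then ((γ i : ℂ) + 1) * coeff γ (k I) else 0 := by
    intro i
    by_cases hi : g i = 1
    · simp [hi, mem_movingIndices, commutatorHomotopy_apply, twistedCommutator_of_fixed]
    · have h1 : (1 - (g i : ℂ)) ≠ 0 := by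
        rw [sub_ne_zero]
        exact fun h => hi (Units.ext h.symm)
      rw [if_pos ((mem_movingIndices g).2 hi), commutatorHomotopy_apply, twistedCommutator_eq, Derivation.map_smul, smul_smul,
        inv_mul_cancel₀ h1, one_smul, coeff_pderiv, mul_comm (X i), coeff_mul_X, mul_comm]
  simp only [h1]
  rw [← Finset.sum_filter, ← Finset.sum_filter, Finset.filter_mem_eq_inter,
    Finset.filter_mem_eq_inter, Finset.univ_inter, ← Finset.sum_mul, Finset.sum_add_distrib,
    smul_eq_mul, ← add_mul, eulerWeight, Finset.sum_const, Finset.sum_const]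
  have h2 := Finset.card_sdiff_add_card_inter (movingIndices g) I
  rw [Finset.inter_comm] at h2
  rw [← h2]
  push_cast
  simp only [nsmul_eq_mul]
  push_cast
  ring

theorem coeff_eq_zero_of_fixedPart_eq_zero {k : Finset (Fin N) → PolyAlg N}
    (hk : fixedPart g k = 0) {I : Finset (Fin N)} {γ : Fin N →₀ ℕ} (h : eulerWeight g I γ = 0) :
    coeff γ (k I) = 0 := by
  rw [eulerWeight, Nat.add_eq_zero_iff, Finset.sum_eq_zero_iff, Finset.card_eq_zero,
    Finset.sdiff_eq_empty_iff_subset] at h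
  refine coeff_eq_zero_of_restrict_eq_zero g ?_ h.1
  have h1 := congrFun hk (I \ movingIndices g)
  rwa [fixedPart_apply, if_pos Finset.sdiff_disjoint, Finset.sdiff_union_of_subset h.2] at h1

theorem exists_koszulDiff_twistedCommutator_eq {k : Finset (Fin N) → PolyAlg N}
    (hk : koszulDiff (twistedCommutator g) k = 0) (hq : fixedPart g k = 0) :
    ∃ v : Finset (Fin N) → PolyAlg N,
      koszulDiff (twistedCommutator g) (koszulCon (commutatorHomotopy g) v) = k ∧
        ∀ I, k I = 0 → v I = 0 := by
  -- This is division by the Euler weight. Terms of weight zero have zero coefficient in `k`, since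
  -- its fixed part vanishes, so the default value of the inverse is harmless.
  let v : Finset (Fin N) → PolyAlg N := fun I =>
    ∑ γ ∈ (k I).support, monomial γ ((eulerWeight g I γ : ℂ)⁻¹ * coeff γ (k I))
  have hv : ∀ I γ, coeff γ (v I) = (eulerWeight g I γ : ℂ)⁻¹ * coeff γ (k I) := by
    intro I γ
    simp only [v, coeff_sum, coeff_monomial, Finset.sum_ite_eq']
    split_ifs with h
    · rfl
    · rw [notMem_support_iff.1 h, mul_zero]
  refine ⟨v, exists_koszulDiff_eq _ _ (twistedCommutator_mul_comm g) hk ?_ fun h => ?_, fun I h => ?_⟩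
  · refine funext fun I => MvPolynomial.ext _ _ fun γ => ?_
    rw [coeff_euler, hv]
    by_cases h : eulerWeight g I γ = 0
    · rw [coeff_eq_zero_of_fixedPart_eq_zero g hq h, mul_zero, mul_zero]
    · rw [mul_inv_cancel_left₀ (Nat.cast_ne_zero.2 h)]
  · refine funext fun I => MvPolynomial.ext _ _ fun γ => ?_
    have h1 := coeff_euler g (koszulDiff (twistedCommutator g) v) I γ
    rw [Pi.add_apply, h, koszulDiff_koszulDiff _ (twistedCommutator_mul_comm g), map_zero] at h1
    rw [Pi.zero_apply, coeff_zero]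
    by_cases h2 : eulerWeight g I γ = 0
    · exact coeff_eq_zero_of_fixedPart_eq_zero g (fixedPart_koszulDiff g v) h2
    · exact (mul_eq_zero.1 (h1.symm.trans (by simp))).resolve_left (Nat.cast_ne_zero.2 h2)
  · simp [v, h]

end FixedPart

/-! ## Finiteness of the Jacobian ring of the restricted potential -/

section Jacobian

variable {N : ℕ}

/-- Scaling of the variables. -/
def scaling (c : Fin N → ℂ) : PolyAlg N →ₐ[ℂ] PolyAlg N :=
  aeval fun i => C (c i) * X i

theorem scaling_X (c : Fin N → ℂ) (i : Fin N) : scaling c (X i) = C (c i) * X i :=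
  aeval_X _ i

theorem eval_scaling (c x : Fin N → ℂ) (a : PolyAlg N) :
    eval x (scaling c a) = eval (fun i => c i * x i) a := by
  induction a using MvPolynomial.induction_on with
  | C t => simp
  | add p q hp hq => simp [hp, hq]
  | mul_X p i hp => simp [hp, scaling_X]

theorem pderiv_scaling (c : Fin N → ℂ) (i : Fin N) (a : PolyAlg N) :
    pderiv i (scaling c a) = C (c i) * scaling c (pderiv i a) := by
  induction a using MvPolynomial.induction_on with
  | C t => simp
  | add p q hp hq => simp only [map_add, hp, hq]; ring
  | mul_X p j hp =>
    rw [map_mul, pderiv_mul, hp, scaling_X, pderiv_C_mul, pderiv_mul, map_add, map_mul, map_mul,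
      scaling_X]
    by_cases hij : j = i
    · subst hij
      simp
      ring
    · rw [pderiv_X_of_ne hij]
      simp
      ring

theorem act_eq_self {W : PolyAlg N} {g : Fin N → ℂˣ} (hg : g ∈ symmetryGroup W) : act g W = W :=
  MvPolynomial.funext fun x => (eval_scaling _ x W).trans (hg x)

/-- Differentiating the invariance of `W` at a fixed point gives `(λᵢ - 1) ∂ᵢW(v) = 0`. -/
theorem eval_pderiv_of_moving {W : PolyAlg N} {g : Fin N → ℂˣ} (hg : g ∈ symmetryGroup W)
    {v : Fin N → ℂ} (hv : v ∈ fixedLocus g) {i : Fin N} (hi : g i ≠ 1) :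
    eval v (pderiv i W) = 0 := by
  have h := congrArg (eval v) (pderiv_scaling (fun i => (g i : ℂ)) i W)
  rw [map_mul, eval_scaling, eval_C] at h
  have h1 : scaling (fun i => (g i : ℂ)) W = W := act_eq_self hg
  have h2 : (fun i => (g i : ℂ) * v i) = v := funext hv
  rw [h1, h2] at h
  by_contra h3
  exact hi (Units.ext (mul_right_cancel₀ h3 (by simpa using h.symm)))

/-- The one-parameter group `t ↦ (t^{q₁}, …, t^{q_N})`. -/
def weightScaling (q : Fin N → ℚ) (t : ℝ) (i : Fin N) : ℂ := ((t ^ (q i : ℝ) : ℝ) : ℂ)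

theorem scaling_eq_of_isWeightedHomogeneous {W : PolyAlg N} {q : Fin N → ℚ}
    (hW : IsWeightedHomogeneous q W 1) {t : ℝ} (ht : 0 < t) :
    scaling (weightScaling q t) W = C (t : ℂ) * W := by
  have key : ∀ γ : Fin N →₀ ℕ, Finsupp.weight q γ = 1 →
      scaling (weightScaling q t) (monomial γ (coeff γ W)) =
        C (t : ℂ) * monomial γ (coeff γ W) := by
    intro γ hγ
    rw [scaling, aeval_monomial, monomial_eq, algebraMap_eq, Finsupp.prod_fintype _ _ (by simp),
      Finsupp.prod_fintype _ _ (by simp)]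
    have h1 : ∏ i, weightScaling q t i ^ γ i = (t : ℂ) := by
      rw [Finsupp.weight_apply, Finsupp.sum_fintype _ _ (by simp)] at hγ
      have h2 : ∏ i, (t ^ (q i : ℝ)) ^ γ i = t := by
        have h3 : ∀ i, (t ^ (q i : ℝ)) ^ γ i = t ^ (((γ i • q i : ℚ)) : ℝ) := by
          intro i
          rw [← Real.rpow_natCast, ← Real.rpow_mul ht.le]
          congr 1
          push_cast [nsmul_eq_mul]
          ring
        simp only [h3]
        rw [← Real.rpow_sum_of_pos ht, ← Rat.cast_sum, hγ, Rat.cast_one, Real.rpow_one]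
      conv_rhs => rw [← h2]
      simp [weightScaling]
    conv_rhs => rw [← h1]
    simp only [mul_pow, Finset.prod_mul_distrib, map_prod, map_pow]
    ring
  conv_lhs => rw [W.as_sum]
  conv_rhs => rw [W.as_sum]
  rw [map_sum, Finset.mul_sum]
  exact Finset.sum_congr rfl fun γ hγ => key γ (hW (mem_support_iff.1 hγ))

/-- The critical locus is stable under the one-parameter group of the weights, and positive weights
carry every point to the origin as `t → 0⁺`. A nonzero critical point would thus yield nonzero
critical points arbitrarily close to the origin. -/
theorem eq_zero_of_eval_pderiv_eq_zero {W : PolyAlg N} {q : Fin N → ℚ} (hq : ∀ i, 0 < q i)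
    (hW : IsWeightedHomogeneous q W 1) (hiso : HasIsolatedCriticalPoint W) {v : Fin N → ℂ}
    (hv : ∀ i, eval v (pderiv i W) = 0) : v = 0 := by
  by_contra hv0
  have h1 : Filter.Tendsto (fun t : ℝ => fun i => weightScaling q t i * v i) (𝓝[>] 0) (𝓝[≠] 0) := by
    refine tendsto_nhdsWithin_iff.2 ⟨?_, ?_⟩
    · refine tendsto_pi_nhds.2 fun i => ?_
      have h2 : (0 : ℝ) < (q i : ℝ) := by exact_mod_cast hq i
      have h3 : Filter.Tendsto (fun t : ℝ => t ^ (q i : ℝ)) (𝓝[>] 0) (𝓝 0) := by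
        have := (Real.continuous_rpow_const h2.le).tendsto 0
        rw [Real.zero_rpow h2.ne'] at this
        exact this.mono_left nhdsWithin_le_nhds
      have h4 := ((Complex.continuous_ofReal.tendsto 0).comp h3).mul_const (v i)
      simpa [weightScaling] using h4
    · filter_upwards [self_mem_nhdsWithin] with t ht h
      refine hv0 (funext fun i => ?_)
      have h2 := congrFun h i
      refine (mul_eq_zero.1 h2).resolve_left ?_
      exact Complex.ofReal_ne_zero.2 (Real.rpow_pos_of_pos ht _).ne'
  obtain ⟨t, ⟨i, hi⟩, ht⟩ := ((h1.eventually hiso.2).and self_mem_nhdsWithin).exists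
  have ht : 0 < t := ht
  refine hi ?_
  have h2 := congrArg (eval v) (pderiv_scaling (weightScaling q t) i W)
  rw [scaling_eq_of_isWeightedHomogeneous hW ht, pderiv_C_mul, map_mul, map_mul, eval_scaling, eval_C,
    eval_C, hv, mul_zero] at h2
  refine (mul_eq_zero.1 h2.symm).resolve_left ?_
  exact Complex.ofReal_ne_zero.2 (Real.rpow_pos_of_pos ht _).ne'

/-- A common zero of the `∂ⱼ W_g`, extended by zero, is a critical point of `W`, hence the origin;
so by the Nullstellensatz every fixed coordinate lies in the radical of the Jacobian ideal. -/
theorem exists_X_pow_mem {W : PolyAlg N} {q : Fin N → ℚ} (hq : ∀ i, 0 < q i)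
    (hW : IsWeightedHomogeneous q W 1) (hiso : HasIsolatedCriticalPoint W) {g : Fin N → ℂˣ}
    (hg : g ∈ symmetryGroup W) :
    ∃ n, ∀ i : {i : Fin N // g i = 1},
      (X i ^ n : FixedPoly g) ∈ Ideal.span (Set.range fun j => pderiv j (restrict g W)) := by
  have h1 : ∀ i : {i : Fin N // g i = 1},
      ∃ n, (X i ^ n : FixedPoly g) ∈ Ideal.span (Set.range fun j => pderiv j (restrict g W)) := by
    intro i
    change X i ∈ Ideal.radical _
    rw [← vanishingIdeal_zeroLocus_eq_radical (K := ℂ), mem_vanishingIdeal_iff]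
    intro w hw
    let v : Fin N → ℂ := fun i => if h : g i = 1 then w ⟨i, h⟩ else 0
    have hv : v ∈ fixedLocus g := by
      intro i
      by_cases h : g i = 1 <;> simp [v, h]
    have hvw : (fun i : {i : Fin N // g i = 1} => v i) = w := by
      funext i
      simp [v, i.2]
    have h2 : v = 0 := by
      refine eq_zero_of_eval_pderiv_eq_zero hq hW hiso fun i => ?_
      by_cases hi : g i = 1
      · rw [← eval_restrict g _ v hv, hvw, restrict_pderiv g ⟨i, hi⟩]
        have := hw _ (Ideal.subset_span ⟨⟨i, hi⟩, rfl⟩)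
        simpa [aeval_eq_eval] using this
      · exact eval_pderiv_of_moving hg hv hi
    rw [aeval_X, ← hvw, h2]
    rfl
  choose n hn using h1
  -- The sum of the individual exponents is a common exponent for all coordinates.
  refine ⟨∑ i, n i, fun i => ?_⟩
  rw [← Finset.add_sum_erase _ _ (Finset.mem_univ i), pow_add]
  exact Ideal.mul_mem_right _ _ (hn i)

theorem mulCon_jacCoeff_exact {W : PolyAlg N} {q : Fin N → ℚ} (hq : ∀ i, 0 < q i)
    (hW : IsWeightedHomogeneous q W 1) (hiso : HasIsolatedCriticalPoint W) {g : Fin N → ℂˣ}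
    (hg : g ∈ symmetryGroup W) {p : ℕ} {k : Finset (Fin N) → FixedPoly g}
    (hk : IsHomogeneousOfDegree (p + 1) k) (hS : ∀ I, k I ≠ 0 → Disjoint I (movingIndices g))
    (hk0 : mulCon (jacCoeff g W) k = 0) :
    ∃ u, IsHomogeneousOfDegree (p + 2) u ∧ (∀ I, u I ≠ 0 → Disjoint I (movingIndices g)) ∧
      mulCon (jacCoeff g W) u = k := by
  obtain ⟨n, hn⟩ := exists_X_pow_mem hq hW hiso hg
  have hsub : ∀ I : Finset (Fin N), I ⊆ (movingIndices g)ᶜ ↔ Disjoint I (movingIndices g) :=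
    fun I => Finset.subset_compl_iff_disjoint_right
  simp only [← hsub] at hS ⊢
  refine mulCon_exact (jacCoeff g W) (movingIndices g)ᶜ (fun j hj => ?_)
    ((Finset.univ : Finset {i : Fin N // g i = 1}).toList.map fun i => X i ^ n) ?_ ?_ ?_ hk hS hk0
  · rw [Finset.notMem_compl, mem_movingIndices] at hj
    rw [jacCoeff, dif_neg hj]
  · intro z hz
    obtain ⟨i, -, rfl⟩ := List.mem_map.1 hz
    obtain ⟨c, hc⟩ := (Ideal.mem_span_range_iff_exists_fun).1 (hn i)
    -- The sign is the one in `jacCoeff`, so the two cancel in each product.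
    refine ⟨fun j => if h : g j = 1 then koszulSign j (movingIndices g) • c ⟨j, h⟩ else 0,
      fun j hj => ?_, ?_⟩
    · rw [Finset.notMem_compl, mem_movingIndices] at hj
      exact dif_neg hj
    · rw [← hc, ← Finset.sum_subset (Finset.subset_univ (Finset.univ.filter fun j => g j = 1))]
      · rw [Finset.sum_subtype _ (p := fun j => g j = 1) (by simp)]
        refine Finset.sum_congr rfl fun j _ => ?_
        beta_reduce
        rw [jacCoeff, dif_pos j.2, dif_pos j.2, smul_mul_smul_comm, koszulSign_mul_self, one_smul,
          mul_comm]
      · intro j _ hj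
        have : g j ≠ 1 := by simpa using hj
        rw [jacCoeff, dif_neg this, zero_mul]
  · have := isRegularMod_X_pow n (Finset.univ : Finset {i : Fin N // g i = 1}).toList
      (Finset.nodup_toList _) ∅ (by simp)
    simpa using this
  · rw [List.length_map, Finset.length_toList, Finset.card_univ, Fintype.card_subtype]
    congr 1
    ext i
    simp [mem_movingIndices]

end Jacobian

/-! ## Leading parts of Hochschild cochains -/

section LeadingPart

variable {N : ℕ} (g : Fin N → ℂˣ)

/-- The Koszul cochain of `A_g` attached to a Hochschild cochain. -/
def leadingPart (p : ℕ) : Cochain N p →ₗ[ℂ] (Finset (Fin N) → FixedPoly g) :=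
  fixedPart g ∘ₗ toKoszul (X : Fin N → PolyAlg N) p

theorem leadingPart_apply (p : ℕ) (φ : Cochain N p) :
    leadingPart g p φ = fixedPart g (toKoszul X p φ) := rfl

theorem leadingPart_support {p : ℕ} {φ : Cochain N p} {J : Finset (Fin N)}
    (h : leadingPart g p φ J ≠ 0) : Disjoint J (movingIndices g) ∧ J.card + codimFix g = p := by
  rw [leadingPart_apply, fixedPart_apply] at h
  split_ifs at h with hJ
  · refine ⟨hJ, ?_⟩
    rw [codimFix, ← Finset.card_union_of_disjoint hJ]
    exact isHomogeneousOfDegree_toKoszul _ p φ _ fun h1 => h (by rw [h1, map_zero])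
  · exact absurd rfl h

theorem leadingPart_hochschild (p : ℕ) (φ : Cochain N p) :
    leadingPart g (p + 1) (hochschild g p φ) = 0 := by
  rw [leadingPart_apply, toKoszul_hochschild, fixedPart_koszulDiff]

/-- The Euler operator makes the Koszul part exact; lifting its primitive by `ofKoszul` and
subtracting leaves a closed cochain without Koszul part, to which dimension shifting applies. -/
theorem exists_hochschild_eq_of_leadingPart {p : ℕ} {φ : Cochain N (p + 1)}
    (hφ : hochschild g (p + 1) φ = 0) (hs : leadingPart g (p + 1) φ = 0) :
    ∃ ψ, hochschild g p ψ = φ := by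
  have hk : koszulDiff (twistedCommutator g) (toKoszul X (p + 1) φ) = 0 := by
    rw [← toKoszul_hochschild, hφ, map_zero]
  obtain ⟨v, hv, hv'⟩ := exists_koszulDiff_twistedCommutator_eq g hk hs
  have hw : IsHomogeneousOfDegree p (koszulCon (commutatorHomotopy g) v) :=
    IsHomogeneousOfDegree.koszulCon _ fun I hI =>
      isHomogeneousOfDegree_toKoszul _ (p + 1) φ I fun h => hI (hv' I h)
  obtain ⟨ψ, hψ⟩ := exists_hochschild_eq g
    (φ := φ - hochschild g p (ofKoszul (quantumCoeff g) p (koszulCon (commutatorHomotopy g) v)))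
    (by rw [map_sub, hφ, hochschild_hochschild, sub_zero])
    (by rw [map_sub, toKoszul_hochschild, toKoszul_ofKoszul_quantumCoeff g hw, hv, sub_self])
  exact ⟨ψ + ofKoszul (quantumCoeff g) p (koszulCon (commutatorHomotopy g) v), by
    rw [map_add, hψ, sub_add_cancel]⟩

theorem eq_zero_of_leadingPart {φ : Cochain N 0} (hφ : hochschild g 0 φ = 0)
    (hs : leadingPart g 0 φ = 0) : φ = 0 := by
  have hk : koszulDiff (twistedCommutator g) (toKoszul X 0 φ) = 0 := by
    rw [← toKoszul_hochschild, hφ, map_zero]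
  obtain ⟨v, hv, hv'⟩ := exists_koszulDiff_twistedCommutator_eq g hk hs
  refine eq_zero_of_toKoszul_eq_zero ?_
  rw [← hv, IsHomogeneousOfDegree.koszulCon_eq_zero _ fun I hI =>
      isHomogeneousOfDegree_toKoszul _ 0 φ I fun h => hI (hv' I h), map_zero]

theorem leadingPart_ofKoszul {p : ℕ} {u : Finset (Fin N) → PolyAlg N}
    (hu : IsHomogeneousOfDegree p u) :
    leadingPart g p (ofKoszul (quantumCoeff g) p u) = fixedPart g u := by
  rw [leadingPart_apply, toKoszul_ofKoszul_quantumCoeff g hu]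

theorem exists_leadingPart_eq {p : ℕ} {u : Finset (Fin N) → FixedPoly g}
    (hu : ∀ J, u J ≠ 0 → Disjoint J (movingIndices g) ∧ J.card + codimFix g = p) :
    ∃ φ : Cochain N p, hochschild g p φ = 0 ∧ leadingPart g p φ = u := by
  refine ⟨ofKoszul (quantumCoeff g) p (inflate g u), ?_, ?_⟩
  · rw [hochschild_ofKoszul, koszulDiff_inflate, map_zero]
  · rw [leadingPart_ofKoszul g (isHomogeneousOfDegree_inflate g fun J hJ => (hu J hJ).2),
      fixedPart_inflate g fun J hJ => (hu J hJ).1]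

theorem leadingPart_curving_hochschild {W : PolyAlg N} (hW : act g W = W) (p : ℕ)
    (ψ : Cochain N p) : leadingPart g p (curving W p (hochschild g p ψ)) = 0 := by
  cases p with
  | zero => rw [curving_hochschild_zero g hW, map_zero]
  | succ p =>
    rw [eq_neg_of_add_eq_zero_left (curving_hochschild g hW p ψ), map_neg, leadingPart_hochschild,
      neg_zero]

/-- A closed cochain is cohomologous to `ofKoszul` of its Koszul part, on which the curving is a
contraction. The difference `∂_H ψ` plays no role, since `d_W ∂_H ψ = -∂_H d_W ψ` has no leading
part (it is zero in the lowest degree). -/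
theorem leadingPart_curving {W : PolyAlg N} (hW : act g W = W) {p : ℕ} {φ : Cochain N (p + 1)}
    (hφ : hochschild g (p + 1) φ = 0) :
    leadingPart g p (curving W p φ) = mulCon (jacCoeff g W) (leadingPart g (p + 1) φ) := by
  have hk := isHomogeneousOfDegree_toKoszul (X : Fin N → PolyAlg N) (p + 1) φ
  obtain ⟨ψ, hψ⟩ := exists_hochschild_eq g
    (φ := φ - ofKoszul (quantumCoeff g) (p + 1) (toKoszul X (p + 1) φ))
    (by rw [map_sub, hφ, hochschild_ofKoszul, ← toKoszul_hochschild, hφ, map_zero, map_zero,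
      sub_zero])
    (by rw [map_sub, toKoszul_ofKoszul_quantumCoeff g hk, sub_self])
  have h1 := leadingPart_curving_hochschild g hW p ψ
  rw [hψ, map_sub, map_sub, sub_eq_zero] at h1
  rw [h1, curving_ofKoszul, leadingPart_ofKoszul g (hk.koszulCon _), fixedPart_koszulCon,
    leadingPart_apply]

theorem inflate_single (a : FixedPoly g) :
    inflate g (Pi.single ∅ a) = Pi.single (movingIndices g) (rename Subtype.val a) := by
  funext I
  rw [inflate]
  split_ifs with h
  · by_cases hI : I = movingIndices g
    · subst hI
      simp
    · rw [Pi.single_eq_of_ne hI, Pi.single_eq_of_ne, map_zero]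
      exact fun h1 => hI ((Finset.sdiff_eq_empty_iff_subset.1 h1).antisymm h)
  · rw [Pi.single_eq_of_ne]
    rintro rfl
    exact h le_rfl

theorem thetaCochain_eq_inflate (a : FixedPoly g) :
    thetaCochain g a = ofKoszul (quantumCoeff g) (codimFix g) (inflate g (Pi.single ∅ a)) := by
  rw [thetaCochain_eq, inflate_single]

theorem hochschild_thetaCochain (a : FixedPoly g) :
    hochschild g (codimFix g) (thetaCochain g a) = 0 := by
  rw [thetaCochain_eq_inflate, hochschild_ofKoszul, koszulDiff_inflate, map_zero]

theorem eq_empty_of_single_ne_zero {a : FixedPoly g} {J : Finset (Fin N)}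
    (h : (Pi.single ∅ a : Finset (Fin N) → FixedPoly g) J ≠ 0) : J = ∅ := by
  by_contra h1
  exact h (Pi.single_eq_of_ne h1 _)

theorem leadingPart_thetaCochain (a : FixedPoly g) :
    leadingPart g (codimFix g) (thetaCochain g a) = Pi.single ∅ a := by
  rw [thetaCochain_eq_inflate, leadingPart_ofKoszul, fixedPart_inflate]
  · intro J hJ
    rw [eq_empty_of_single_ne_zero g hJ]
    exact Finset.disjoint_empty_left _
  · refine isHomogeneousOfDegree_inflate g fun J hJ => ?_
    rw [eq_empty_of_single_ne_zero g hJ, Finset.card_empty, zero_add]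

end LeadingPart

/-! ## The curved complex -/

section Curved

variable {N : ℕ} (g : Fin N → ℂˣ) (W : PolyAlg N)

theorem hochschildDiff_zero_apply (Ω : CompactCochain N) : hochschildDiff g Ω 0 = 0 := by
  suffices h : DirectSum.component ℂ ℕ (fun p => Cochain N p) 0 ∘ₗ hochschildDiff g = 0 from
    LinearMap.congr_fun h Ω
  refine DirectSum.linearMap_ext _ fun p => LinearMap.ext fun φ => ?_
  simp [hochschildDiff, DirectSum.component.of]

theorem hochschildDiff_succ_apply (Ω : CompactCochain N) (p : ℕ) :
    hochschildDiff g Ω (p + 1) = hochschild g p (Ω p) := by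
  suffices h : DirectSum.component ℂ ℕ (fun p => Cochain N p) (p + 1) ∘ₗ hochschildDiff g =
      hochschild g p ∘ₗ DirectSum.component ℂ ℕ (fun p => Cochain N p) p from
    LinearMap.congr_fun h Ω
  refine DirectSum.linearMap_ext _ fun q => LinearMap.ext fun φ => ?_
  by_cases h : p = q
  · subst h
    simp [hochschildDiff]
  · simp [hochschildDiff, DirectSum.component.of, Ne.symm h]

theorem curvingDiff_apply (Ω : CompactCochain N) (p : ℕ) :
    curvingDiff W Ω p = curving W p (Ω (p + 1)) := by
  suffices h : DirectSum.component ℂ ℕ (fun p => Cochain N p) p ∘ₗ curvingDiff W =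
      curving W p ∘ₗ DirectSum.component ℂ ℕ (fun p => Cochain N p) (p + 1) from
    LinearMap.congr_fun h Ω
  refine DirectSum.linearMap_ext _ fun q => LinearMap.ext fun φ => ?_
  cases q with
  | zero => simp [curvingDiff, DirectSum.component.of]
  | succ q =>
    by_cases h : p = q
    · subst h
      simp [curvingDiff]
    · simp [curvingDiff, DirectSum.component.of, Ne.symm h]

theorem curvedDiff_zero_apply (Ω : CompactCochain N) :
    curvedDiff g W Ω 0 = curving W 0 (Ω 1) := by
  rw [curvedDiff, LinearMap.add_apply, DirectSum.add_apply, hochschildDiff_zero_apply,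
    curvingDiff_apply, zero_add]

theorem curvedDiff_succ_apply (Ω : CompactCochain N) (p : ℕ) :
    curvedDiff g W Ω (p + 1) = hochschild g p (Ω p) + curving W (p + 1) (Ω (p + 2)) := by
  rw [curvedDiff, LinearMap.add_apply, DirectSum.add_apply, hochschildDiff_succ_apply,
    curvingDiff_apply]

end Curved

/-! ### Removing top components in the curved complex -/

section CurvedCohomology

variable {N : ℕ} (g : Fin N → ℂˣ) {W : PolyAlg N}

/-- The inclusion of `Cᵖ(A, A g)`. -/
abbrev incl (p : ℕ) : Cochain N p →ₗ[ℂ] CompactCochain N :=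
  DirectSum.lof ℂ ℕ (fun p => Cochain N p) p

theorem incl_apply_self (p : ℕ) (φ : Cochain N p) : incl p φ p = φ :=
  DirectSum.lof_apply ℂ p φ

theorem incl_apply_of_ne {p n : ℕ} (h : n ≠ p) (φ : Cochain N p) : incl p φ n = 0 :=
  DirectSum.of_eq_of_ne p n φ h

theorem compactCochain_ext {Ω Ω' : CompactCochain N} (h : ∀ p, Ω p = Ω' p) : Ω = Ω' :=
  DFinsupp.ext h

theorem exists_forall_lt_eq_zero (Ω : CompactCochain N) : ∃ n, ∀ p, n < p → Ω p = 0 := by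
  induction Ω using DirectSum.induction_on with
  | zero => exact ⟨0, fun p _ => rfl⟩
  | of q φ => exact ⟨q, fun p hp => incl_apply_of_ne hp.ne' φ⟩
  | add Ω Ω' h h' =>
    obtain ⟨n, hn⟩ := h
    obtain ⟨n', hn'⟩ := h'
    refine ⟨max n n', fun p hp => ?_⟩
    rw [DirectSum.add_apply, hn p (lt_of_le_of_lt (le_max_left _ _) hp),
      hn' p (lt_of_le_of_lt (le_max_right _ _) hp), add_zero]

theorem curvedDiff_curvedDiff (hW : act g W = W) (Ω : CompactCochain N) :
    curvedDiff g W (curvedDiff g W Ω) = 0 := by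
  refine compactCochain_ext fun p => ?_
  rw [DirectSum.zero_apply]
  rcases p with _ | _ | p
  · rw [curvedDiff_zero_apply, curvedDiff_succ_apply, map_add, curving_hochschild_zero g hW,
      curving_curving, zero_add]
  · rw [curvedDiff_succ_apply, curvedDiff_zero_apply, curvedDiff_succ_apply, map_add,
      curving_curving, add_zero]
    exact (add_comm _ _).trans (curving_hochschild g hW 0 (Ω 1))
  · rw [curvedDiff_succ_apply, curvedDiff_succ_apply, curvedDiff_succ_apply, map_add, map_add,
      hochschild_hochschild, curving_curving, add_zero, zero_add]
    exact (add_comm _ _).trans (curving_hochschild g hW (p + 1) (Ω (p + 2)))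

theorem curvedDiff_apply_of_hochschild_eq_zero {p n : ℕ} {φ : Cochain N p}
    (hφ : hochschild g p φ = 0) (h : p ≠ n + 1) : curvedDiff g W (incl p φ) n = 0 := by
  cases n with
  | zero => rw [curvedDiff_zero_apply, incl_apply_of_ne h.symm, map_zero]
  | succ n =>
    rw [curvedDiff_succ_apply, incl_apply_of_ne h.symm, map_zero, add_zero]
    by_cases h1 : n = p
    · subst h1
      rw [incl_apply_self, hφ]
    · rw [incl_apply_of_ne h1, map_zero]

theorem curvedDiff_incl_apply {p n : ℕ} (φ : Cochain N p) (h : p + 1 < n) :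
    curvedDiff g W (incl p φ) n = 0 := by
  cases n with
  | zero => omega
  | succ n =>
    rw [curvedDiff_succ_apply, incl_apply_of_ne (by omega), incl_apply_of_ne (by omega), map_zero,
      map_zero, add_zero]

theorem curvedDiff_incl_apply_self (p : ℕ) (φ : Cochain N (p + 1)) :
    curvedDiff g W (incl (p + 1) φ) p = curving W p φ := by
  cases p with
  | zero => rw [curvedDiff_zero_apply, incl_apply_self]
  | succ p =>
    rw [curvedDiff_succ_apply, incl_apply_self, incl_apply_of_ne (by omega), map_zero, zero_add]

theorem curvedDiff_incl_apply_succ (p : ℕ) (φ : Cochain N p) :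
    curvedDiff g W (incl p φ) (p + 1) = hochschild g p φ := by
  rw [curvedDiff_succ_apply, incl_apply_self, incl_apply_of_ne (by omega), map_zero, add_zero]

/-- The top component of a cocycle is closed for the Hochschild differential. -/
theorem hochschild_top_eq_zero {Ω : CompactCochain N} {n : ℕ}
    (h : curvedDiff g W Ω (n + 1) = 0) (h0 : Ω (n + 2) = 0) : hochschild g n (Ω n) = 0 := by
  rwa [curvedDiff_succ_apply, h0, map_zero, add_zero] at h

/-- Removing a top component with vanishing leading part. -/
theorem exists_sub_curvedDiff_apply_eq_zero {Ω : CompactCochain N} {n : ℕ}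
    (h : hochschild g n (Ω n) = 0) (hs : leadingPart g n (Ω n) = 0) (h0 : ∀ p, n < p → Ω p = 0) :
    ∃ η : CompactCochain N, (∀ p, n ≤ p → η p = 0) ∧
      ∀ p, n ≤ p → (Ω - curvedDiff g W η) p = 0 := by
  cases n with
  | zero =>
    refine ⟨0, fun _ _ => rfl, fun p hp => ?_⟩
    rw [map_zero, sub_zero]
    rcases hp.eq_or_lt with rfl | hp
    · exact eq_zero_of_leadingPart g h hs
    · exact h0 p hp
  | succ n =>
    obtain ⟨ψ, hψ⟩ := exists_hochschild_eq_of_leadingPart g h hs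
    refine ⟨incl n ψ, fun p hp => incl_apply_of_ne (by omega) ψ, fun p hp => ?_⟩
    rw [DirectSum.sub_apply]
    rcases hp.eq_or_lt with rfl | hp
    · rw [curvedDiff_incl_apply_succ, hψ, sub_self]
    · rw [h0 p hp, curvedDiff_incl_apply g ψ hp, sub_zero]

/-- The curved complex is exact below degree `N - N_g`. -/
theorem exists_curvedDiff_eq_of_lt_codimFix (hW : act g W = W) {n : ℕ} (hn : n ≤ codimFix g)
    {Ω : CompactCochain N} (hΩ : curvedDiff g W Ω = 0) (h0 : ∀ p, n ≤ p → Ω p = 0) :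
    ∃ Φ : CompactCochain N, (∀ p, n ≤ p → Φ p = 0) ∧ curvedDiff g W Φ = Ω := by
  induction n generalizing Ω with
  | zero =>
    refine ⟨0, fun _ _ => rfl, ?_⟩
    rw [map_zero]
    exact (compactCochain_ext fun p => h0 p p.zero_le).symm
  | succ n ih =>
    obtain ⟨η, hη, hη'⟩ := exists_sub_curvedDiff_apply_eq_zero g (W := W) (Ω := Ω) (n := n)
      (hochschild_top_eq_zero g (W := W) (by rw [hΩ]; rfl) (h0 _ (by omega)))
      -- A nonzero leading part would have degree `n - (N - N_g)`, which is negative here.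
      (funext fun J => by
        by_contra h
        have := (leadingPart_support g h).2
        omega) (fun p hp => h0 p hp)
    obtain ⟨Φ, hΦ, hΦ'⟩ := ih (by omega)
      (by rw [map_sub, curvedDiff_curvedDiff g hW, hΩ, sub_zero]) hη'
    refine ⟨Φ + η, fun p hp => ?_, by rw [map_add, hΦ', sub_add_cancel]⟩
    rw [DirectSum.add_apply, hΦ p (by omega), hη p (by omega), add_zero]

/-- Exactness of the contraction with `dW_g` in positive degrees. -/
def JacobianExact (W : PolyAlg N) : Prop :=
  ∀ ⦃p : ℕ⦄ ⦃k : Finset (Fin N) → FixedPoly g⦄, IsHomogeneousOfDegree (p + 1) k →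
    (∀ I, k I ≠ 0 → Disjoint I (movingIndices g)) → mulCon (jacCoeff g W) k = 0 →
    ∃ u, IsHomogeneousOfDegree (p + 2) u ∧ (∀ I, u I ≠ 0 → Disjoint I (movingIndices g)) ∧
      mulCon (jacCoeff g W) u = k

/-- A cochain whose differential vanishes from degree `b ≥ N - N_g` on can be truncated to
degrees at most `b`. -/
theorem exists_sub_curvedDiff_apply_eq_zero_of_lt (hW : act g W = W) (hJ : JacobianExact g W) {b : ℕ}
    (hb : codimFix g ≤ b) {Ω : CompactCochain N} (hΩ : ∀ p, b ≤ p → curvedDiff g W Ω p = 0) :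
    ∃ η : CompactCochain N, ∀ p, b < p → (Ω - curvedDiff g W η) p = 0 := by
  obtain ⟨n, hn⟩ := exists_forall_lt_eq_zero Ω
  -- From here on `n` measures how far the top degree lies above `b`, and the induction lowers it by
  -- one.
  replace hn : ∀ p, b + n < p → Ω p = 0 := fun p hp => hn p (by omega)
  induction n generalizing Ω with
  | zero => exact ⟨0, fun p hp => by rw [map_zero, sub_zero]; exact hn p hp⟩
  | succ n ih =>
    have h1 : hochschild g (b + n + 1) (Ω (b + n + 1)) = 0 :=
      hochschild_top_eq_zero g (W := W) (hΩ _ (by omega)) (hn _ (by omega))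
    -- Up to sign, the curving of the top component is the Hochschild coboundary of the component
    -- two degrees lower, so its leading part vanishes.
    have h2 : leadingPart g (b + n) (curving W (b + n) (Ω (b + n + 1))) = 0 := by
      have h3 := hΩ (b + n) (by omega)
      generalize b + n = c at h3 ⊢
      cases c with
      | zero => rw [← curvedDiff_zero_apply g, h3, map_zero]
      | succ c =>
        rw [curvedDiff_succ_apply] at h3
        rw [eq_neg_of_add_eq_zero_right h3, map_neg, leadingPart_hochschild, neg_zero]
    rw [leadingPart_curving g hW h1] at h2
    -- The top leading part has degree `b + n + 1 - (N - N_g)`, positive because `b ≥ N - N_g`. It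
    -- is therefore a contraction of some `u`, and a closed `χ` one degree above the top realising
    -- `u` cancels it through `d_W χ`.
    obtain ⟨u, hu, hu', hu''⟩ := hJ (p := b + n - codimFix g)
      (fun J hJ => by have := (leadingPart_support g hJ).2; omega)
      (fun J hJ => (leadingPart_support g hJ).1) h2
    obtain ⟨χ, hχ, hχ'⟩ := exists_leadingPart_eq g (p := b + n + 2) (u := u)
      (fun J hJ => ⟨hu' J hJ, by have := hu J hJ; omega⟩)
    obtain ⟨η, hη, hη'⟩ := exists_sub_curvedDiff_apply_eq_zero g (W := W)
      (Ω := Ω - curvedDiff g W (incl (b + n + 2) χ)) (n := b + n + 1)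
      (by
        rw [DirectSum.sub_apply, curvedDiff_incl_apply_self, map_sub, h1, zero_sub,
          eq_neg_of_add_eq_zero_right (curving_hochschild g hW _ χ), hχ, map_zero, neg_zero, neg_zero])
      (by
        rw [DirectSum.sub_apply, curvedDiff_incl_apply_self, map_sub, leadingPart_curving g hW hχ, hχ',
          hu'', sub_self])
      (fun p hp => by
        rw [DirectSum.sub_apply, hn p (by omega),
          curvedDiff_apply_of_hochschild_eq_zero g hχ (by omega), sub_zero])
    obtain ⟨ξ, hξ⟩ := ih (Ω := Ω - curvedDiff g W (incl (b + n + 2) χ) - curvedDiff g W η)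
      (fun p hp => by
        rw [map_sub, map_sub, curvedDiff_curvedDiff g hW, curvedDiff_curvedDiff g hW, sub_zero,
          sub_zero, hΩ p hp])
      (fun p hp => hη' p (by omega))
    refine ⟨incl (b + n + 2) χ + η + ξ, fun p hp => ?_⟩
    rw [map_add, map_add, ← sub_sub, ← sub_sub]
    exact hξ p hp

end CurvedCohomology

/-! ### The isomorphism with the Jacobian ring and its parity -/

section MainIsomorphism

variable {N : ℕ} (g : Fin N → ℂˣ) {W : PolyAlg N}

theorem mulCon_jacCoeff_empty_mem (u : Finset (Fin N) → FixedPoly g) :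
    mulCon (jacCoeff g W) u ∅ ∈ Ideal.span (Set.range fun j => pderiv j (restrict g W)) := by
  rw [mulCon_apply]
  refine Ideal.sum_mem _ fun i _ => zsmul_mem (Ideal.mul_mem_right _ _ ?_) _
  rw [jacCoeff]
  split_ifs with h
  · have h1 : pderiv (⟨i, h⟩ : {i : Fin N // g i = 1}) (restrict g W) ∈
        Ideal.span (Set.range fun j => pderiv j (restrict g W)) := Ideal.subset_span ⟨_, rfl⟩
    exact zsmul_mem h1 _
  · exact zero_mem _

theorem exists_mulCon_jacCoeff_empty_eq {a : FixedPoly g}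
    (ha : a ∈ Ideal.span (Set.range fun j => pderiv j (restrict g W))) :
    ∃ u : Finset (Fin N) → FixedPoly g, (∀ J, u J ≠ 0 → Disjoint J (movingIndices g) ∧ J.card = 1) ∧
      mulCon (jacCoeff g W) u ∅ = a := by
  obtain ⟨c, rfl⟩ := Ideal.mem_span_range_iff_exists_fun.1 ha
  -- The signs undo those of `jacCoeff`; the remaining sign, relative to the empty set, is `1`.
  let d : Fin N → FixedPoly g :=
    fun j => if h : g j = 1 then koszulSign j (movingIndices g) • c ⟨j, h⟩ else 0
  refine ⟨fun J => if J.card = 1 then ∑ j ∈ J, d j else 0, fun J hJ => ?_, ?_⟩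
  · by_cases h : J.card = 1
    · refine ⟨?_, h⟩
      obtain ⟨j, rfl⟩ := Finset.card_eq_one.1 h
      rw [Finset.disjoint_singleton_left, mem_movingIndices, not_not]
      by_contra h1
      exact hJ (by simp [d, h1])
    · exact absurd (if_neg h) hJ
  · rw [mulCon_apply, Finset.compl_empty,
      ← Finset.sum_subset (Finset.subset_univ (Finset.univ.filter fun j => g j = 1)),
      Finset.sum_subtype _ (p := fun j => g j = 1) (by simp)]
    · refine Finset.sum_congr rfl fun j _ => ?_
      simp only [insert_empty_eq, Finset.card_singleton, if_true, Finset.sum_singleton]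
      simp only [d]
      rw [jacCoeff, dif_pos j.2, dif_pos j.2, smul_mul_smul_comm, koszulSign_mul_self, one_smul,
        mul_comm]
      simp [koszulSign]
    · intro j _ hj
      have : g j ≠ 1 := by simpa using hj
      rw [jacCoeff, dif_neg this, zero_mul, smul_zero]

/-- The polynomial on `Fix(g)` given by the leading part of the component in degree `N - N_g`. -/
def leadingValue : CompactCochain N →ₗ[ℂ] FixedPoly g :=
  LinearMap.proj ∅ ∘ₗ leadingPart g (codimFix g) ∘ₗ
    DirectSum.component ℂ ℕ (fun p => Cochain N p) (codimFix g)

theorem leadingValue_apply (Ω : CompactCochain N) :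
    leadingValue g Ω = leadingPart g (codimFix g) (Ω (codimFix g)) ∅ := rfl

theorem leadingPart_codimFix_eq_zero {φ : Cochain N (codimFix g)}
    (h : leadingPart g (codimFix g) φ ∅ = 0) : leadingPart g (codimFix g) φ = 0 := by
  refine funext fun J => ?_
  by_contra hJ
  have h1 := (leadingPart_support g hJ).2
  obtain rfl : J = ∅ := Finset.card_eq_zero.1 (by omega)
  exact hJ h

variable (W) in
/-- The cocycles without components above degree `N - N_g`. -/
def truncatedCocycles : Submodule ℂ (cocycles g W) where
  carrier := {φ | ∀ p, codimFix g < p → (φ : CompactCochain N) p = 0}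
  add_mem' := by
    intro φ ψ hφ hψ p hp
    rw [Submodule.coe_add, DirectSum.add_apply, hφ p hp, hψ p hp, add_zero]
  zero_mem' := fun p _ => rfl
  smul_mem' := by
    intro c φ hφ p hp
    rw [Submodule.coe_smul, DirectSum.smul_apply, hφ p hp, smul_zero]

variable (W) in
/-- The class of the leading value of a truncated cocycle in the Jacobian ring. -/
def jacobianClass : truncatedCocycles g W →ₗ[ℂ] Jac (restrict g W) :=
  (Ideal.Quotient.mkₐ ℂ _).toLinearMap ∘ₗ leadingValue g ∘ₗ (cocycles g W).subtype ∘ₗ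
    (truncatedCocycles g W).subtype

theorem jacobianClass_apply (φ : truncatedCocycles g W) :
    jacobianClass g W φ = Ideal.Quotient.mk _ (leadingValue g (φ : cocycles g W)) := rfl

variable (W) in
/-- The cohomology class of a truncated cocycle. -/
def cohomologyClass : truncatedCocycles g W →ₗ[ℂ] HHc g W :=
  Submodule.mkQ _ ∘ₗ (truncatedCocycles g W).subtype

theorem cohomologyClass_apply (φ : truncatedCocycles g W) :
    cohomologyClass g W φ = HHc.cls φ.1 := rfl

theorem mem_cocycles {Ω : CompactCochain N} : Ω ∈ cocycles g W ↔ curvedDiff g W Ω = 0 := Iff.rfl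

theorem curvedDiff_coe (φ : cocycles g W) : curvedDiff g W φ = 0 := φ.2

theorem HHc.cls_eq_cls_iff {φ ψ : cocycles g W} :
    HHc.cls φ = HHc.cls ψ ↔
      ∃ η, curvedDiff g W η = (φ : CompactCochain N) - (ψ : CompactCochain N) :=
  Submodule.Quotient.eq _

theorem HHc.cls_eq_zero_iff {φ : cocycles g W} :
    HHc.cls φ = 0 ↔ ∃ η, curvedDiff g W η = (φ : CompactCochain N) :=
  Submodule.Quotient.mk_eq_zero _

/-- As `θ_g(a)` is `∂_H`-closed, its curved differential lives below degree `N - N_g`, where closed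
cochains are exact; subtracting a primitive from that range leaves the top component untouched. -/
theorem exists_truncatedCocycle (hW : act g W = W) (a : FixedPoly g) :
    ∃ φ : truncatedCocycles g W, (φ.1 : CompactCochain N) (codimFix g) = thetaCochain g a := by
  obtain ⟨Φ, hΦ, hΦ'⟩ := exists_curvedDiff_eq_of_lt_codimFix g hW le_rfl
    (Ω := curvedDiff g W (incl (codimFix g) (thetaCochain g a))) (curvedDiff_curvedDiff g hW _)
    (fun p hp => curvedDiff_apply_of_hochschild_eq_zero g (hochschild_thetaCochain g a) (by omega))
  refine ⟨⟨⟨incl (codimFix g) (thetaCochain g a) - Φ, ?_⟩, fun p hp => ?_⟩, ?_⟩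
  · rw [mem_cocycles, map_sub, hΦ', sub_self]
  · change (incl (codimFix g) (thetaCochain g a) - Φ) p = 0
    rw [DirectSum.sub_apply, incl_apply_of_ne hp.ne', hΦ p hp.le, sub_zero]
  · change (incl (codimFix g) (thetaCochain g a) - Φ) (codimFix g) = _
    rw [DirectSum.sub_apply, incl_apply_self, hΦ _ le_rfl, sub_zero]

theorem leadingValue_of_apply_eq {Ω : CompactCochain N} {a : FixedPoly g}
    (h : Ω (codimFix g) = thetaCochain g a) : leadingValue g Ω = a := by
  rw [leadingValue_apply, h, leadingPart_thetaCochain, Pi.single_eq_same]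

theorem leadingPart_hochschildDiff (Ω : CompactCochain N) (p : ℕ) :
    leadingPart g p (hochschildDiff g Ω p) = 0 := by
  cases p with
  | zero => rw [hochschildDiff_zero_apply, map_zero]
  | succ p => rw [hochschildDiff_succ_apply, leadingPart_hochschild]

/-- Leading parts do not see `∂_H`-coboundaries, so prescribing the top component up to cohomology
is enough. -/
theorem leadingValue_of_hasLeadingTerm {Ω : CompactCochain N} {a : FixedPoly g}
    (h : HasLeadingTerm g a Ω) : leadingValue g Ω = a := by
  obtain ⟨Φ, hΦ⟩ := h.2
  have h1 := leadingPart_hochschildDiff g Φ (codimFix g)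
  rw [hΦ, DirectSum.lof_apply, map_sub, leadingPart_thetaCochain, sub_eq_zero] at h1
  rw [leadingValue_apply, h1, Pi.single_eq_same]

theorem jacobianClass_surjective (hW : act g W = W) : Function.Surjective (jacobianClass g W) := by
  intro c
  obtain ⟨a, rfl⟩ := Ideal.Quotient.mk_surjective c
  obtain ⟨φ, hφ⟩ := exists_truncatedCocycle g hW a
  exact ⟨φ, by rw [jacobianClass_apply, leadingValue_of_apply_eq g hφ]⟩

theorem exists_truncatedCocycle_cls_eq (hW : act g W = W) (hJ : JacobianExact g W)
    (φ : cocycles g W) :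
    ∃ (ψ : truncatedCocycles g W) (η : CompactCochain N),
      ((ψ : cocycles g W) : CompactCochain N) = φ - curvedDiff g W η := by
  obtain ⟨η, hη⟩ := exists_sub_curvedDiff_apply_eq_zero_of_lt g hW hJ le_rfl
    (Ω := (φ : CompactCochain N)) (fun p _ => by rw [curvedDiff_coe]; rfl)
  refine ⟨⟨⟨φ - curvedDiff g W η, ?_⟩, hη⟩, η, rfl⟩
  rw [mem_cocycles, map_sub, curvedDiff_coe, curvedDiff_curvedDiff g hW, sub_zero]

theorem cohomologyClass_surjective (hW : act g W = W) (hJ : JacobianExact g W) :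
    Function.Surjective (cohomologyClass g W) := by
  intro c
  obtain ⟨φ, rfl⟩ := Submodule.Quotient.mk_surjective _ c
  obtain ⟨ψ, η, h⟩ := exists_truncatedCocycle_cls_eq g hW hJ φ
  exact ⟨ψ, (HHc.cls_eq_cls_iff g).2 ⟨-η, by
    rw [Submodule.subtype_apply, h, map_neg]; abel⟩⟩

/-- If the leading value is a contraction of some `u`, a closed `χ` of degree `N - N_g + 1` with
leading part `u` cancels it. The top component is then removable, and what remains lies in the exact
range. Exactness of the Jacobian contraction is not needed in this direction. -/
theorem cohomologyClass_eq_zero (hW : act g W = W) {φ : truncatedCocycles g W}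
    (h : jacobianClass g W φ = 0) : cohomologyClass g W φ = 0 := by
  rw [cohomologyClass_apply, HHc.cls_eq_zero_iff]
  rw [jacobianClass_apply, Ideal.Quotient.eq_zero_iff_mem, leadingValue_apply] at h
  obtain ⟨u, hu, hu'⟩ := exists_mulCon_jacCoeff_empty_eq g h
  obtain ⟨χ, hχ, hχ'⟩ := exists_leadingPart_eq g (p := codimFix g + 1) (u := u)
    (fun J hJ => ⟨(hu J hJ).1, by have := (hu J hJ).2; omega⟩)
  have h0 : ∀ p, codimFix g < p → (φ.1 : CompactCochain N) p = 0 := φ.2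
  have h1 : hochschild g (codimFix g) ((φ.1 : CompactCochain N) (codimFix g)) = 0 :=
    hochschild_top_eq_zero g (W := W) (by rw [curvedDiff_coe]; rfl) (h0 _ (by omega))
  obtain ⟨η, -, hη⟩ := exists_sub_curvedDiff_apply_eq_zero g (W := W)
    (Ω := φ.1 - curvedDiff g W (incl (codimFix g + 1) χ)) (n := codimFix g)
    (by
      rw [DirectSum.sub_apply, curvedDiff_incl_apply_self, map_sub, h1, zero_sub,
        eq_neg_of_add_eq_zero_right (curving_hochschild g hW _ χ), hχ, map_zero, neg_zero, neg_zero])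
    (leadingPart_codimFix_eq_zero g (by
      rw [DirectSum.sub_apply, curvedDiff_incl_apply_self, map_sub, Pi.sub_apply,
        leadingPart_curving g hW hχ, hχ', hu', sub_self]))
    (fun p hp => by
      rw [DirectSum.sub_apply, h0 p hp, curvedDiff_apply_of_hochschild_eq_zero g hχ (by omega),
        sub_zero])
  obtain ⟨Φ, -, hΦ⟩ := exists_curvedDiff_eq_of_lt_codimFix g hW le_rfl (by
    rw [map_sub, map_sub, curvedDiff_coe, curvedDiff_curvedDiff g hW, curvedDiff_curvedDiff g hW,
      sub_zero, sub_zero]) hη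
  exact ⟨Φ + η + incl (codimFix g + 1) χ, by rw [map_add, map_add, hΦ]; abel⟩

/-- A primitive can be truncated to degrees at most `N - N_g + 1`. Its top component is then closed,
and contributes to the leading value only through a contraction with `dW_g`, which lies in the
Jacobian ideal. -/
theorem jacobianClass_eq_zero (hW : act g W = W) (hJ : JacobianExact g W)
    {φ : truncatedCocycles g W} (h : cohomologyClass g W φ = 0) : jacobianClass g W φ = 0 := by
  rw [cohomologyClass_apply, HHc.cls_eq_zero_iff] at h
  rw [jacobianClass_apply, Ideal.Quotient.eq_zero_iff_mem, leadingValue_apply]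
  have h0 : ∀ p, codimFix g < p → (φ.1 : CompactCochain N) p = 0 := φ.2
  obtain ⟨ψ, hψ⟩ := h
  obtain ⟨η, hη⟩ := exists_sub_curvedDiff_apply_eq_zero_of_lt g hW hJ (Nat.le_succ (codimFix g))
    (Ω := ψ) (fun p hp => by rw [hψ]; exact h0 p hp)
  have h1 : curvedDiff g W (ψ - curvedDiff g W η) = φ.1 := by
    rw [map_sub, curvedDiff_curvedDiff g hW, sub_zero, hψ]
  rw [← h1]
  generalize ψ - curvedDiff g W η = Ω at h1 hη
  have h2 : hochschild g (codimFix g + 1) (Ω (codimFix g + 1)) = 0 :=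
    hochschild_top_eq_zero g (W := W) (by rw [h1]; exact h0 _ (by omega)) (hη _ (by simp))
  have h3 : leadingPart g (codimFix g) (curvedDiff g W Ω (codimFix g)) =
      leadingPart g (codimFix g) (curving W (codimFix g) (Ω (codimFix g + 1))) := by
    rw [curvedDiff, LinearMap.add_apply, DirectSum.add_apply, map_add, leadingPart_hochschildDiff,
      zero_add, curvingDiff_apply]
  rw [h3, leadingPart_curving g hW h2]
  exact mulCon_jacCoeff_empty_mem g _

theorem jacobianClass_eq_iff (hW : act g W = W) (hJ : JacobianExact g W)
    (φ ψ : truncatedCocycles g W) :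
    jacobianClass g W φ = jacobianClass g W ψ ↔ cohomologyClass g W φ = cohomologyClass g W ψ := by
  rw [← sub_eq_zero, ← map_sub, ← sub_eq_zero (a := cohomologyClass g W φ), ← map_sub]
  exact ⟨cohomologyClass_eq_zero g hW, jacobianClass_eq_zero g hW hJ⟩

/-- The isomorphism between the targets of two surjections with the same fibres. -/
def equivOfFibresEq {R V A B : Type*} [Semiring R] [AddCommMonoid V] [Module R V] [AddCommMonoid A]
    [Module R A] [AddCommMonoid B] [Module R B] (f : V →ₗ[R] A) (f' : V →ₗ[R] B)
    (hf : Function.Surjective f) (hf' : Function.Surjective f')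
    (h : ∀ v w, f v = f w ↔ f' v = f' w) : A ≃ₗ[R] B where
  toFun a := f' (Function.surjInv hf a)
  invFun b := f (Function.surjInv hf' b)
  map_add' a b := by
    rw [← map_add, ← h, map_add]
    simp only [Function.surjInv_eq]
  map_smul' c a := by
    rw [RingHom.id_apply, ← map_smul, ← h, map_smul]
    simp only [Function.surjInv_eq]
  left_inv _ := ((h _ _).2 (Function.surjInv_eq hf' _)).trans (Function.surjInv_eq hf _)
  right_inv _ := ((h _ _).1 (Function.surjInv_eq hf _)).trans (Function.surjInv_eq hf' _)

theorem equivOfFibresEq_apply {R V A B : Type*} [Semiring R] [AddCommMonoid V] [Module R V]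
    [AddCommMonoid A] [Module R A] [AddCommMonoid B] [Module R B] (f : V →ₗ[R] A) (f' : V →ₗ[R] B)
    (hf : Function.Surjective f) (hf' : Function.Surjective f')
    (h : ∀ v w, f v = f w ↔ f' v = f' w) (v : V) : equivOfFibresEq f f' hf hf' h (f v) = f' v :=
  (h _ _).1 (Function.surjInv_eq hf _)

/-- The isomorphism `Θ_g`. -/
def jacobianEquiv (hW : act g W = W) (hJ : JacobianExact g W) :
    Jac (restrict g W) ≃ₗ[ℂ] HHc g W :=
  equivOfFibresEq (jacobianClass g W) (cohomologyClass g W) (jacobianClass_surjective g hW)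
    (cohomologyClass_surjective g hW hJ) (jacobianClass_eq_iff g hW hJ)

theorem jacobianEquiv_jacobianClass (hW : act g W = W) (hJ : JacobianExact g W)
    (φ : truncatedCocycles g W) :
    jacobianEquiv g hW hJ (jacobianClass g W φ) = HHc.cls φ.1 :=
  equivOfFibresEq_apply (jacobianClass g W) (cohomologyClass g W) _ _ _ φ

/-- The part of a cochain in the degrees of parity `s`. -/
def parityProj (N : ℕ) (s : ZMod 2) : CompactCochain N →ₗ[ℂ] CompactCochain N :=
  DFinsupp.filterLinearMap ℂ (fun p => Cochain N p) fun p : ℕ => (p : ZMod 2) = s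

theorem parityProj_apply (s : ZMod 2) (Ω : CompactCochain N) (p : ℕ) :
    parityProj N s Ω p = if (p : ZMod 2) = s then Ω p else 0 :=
  DFinsupp.filter_apply _ _ _

theorem curvedDiff_parityProj (s : ZMod 2) (Ω : CompactCochain N) :
    curvedDiff g W (parityProj N s Ω) = parityProj N (s + 1) (curvedDiff g W Ω) := by
  refine compactCochain_ext fun p => ?_
  have h2 : (2 : ZMod 2) = 0 := rfl
  cases p with
  | zero =>
    rw [parityProj_apply, curvedDiff_zero_apply, curvedDiff_zero_apply, parityProj_apply]
    have : ((1 : ℕ) : ZMod 2) = s ↔ ((0 : ℕ) : ZMod 2) = s + 1 := by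
      constructor
      · rintro rfl
        rfl
      · intro h; push_cast at h ⊢; linear_combination h + h2
    simp only [this]
    split_ifs <;> simp
  | succ p =>
    rw [parityProj_apply, curvedDiff_succ_apply, curvedDiff_succ_apply, parityProj_apply,
      parityProj_apply]
    have h3 : (p : ZMod 2) = s ↔ ((p + 1 : ℕ) : ZMod 2) = s + 1 := by
      push_cast; exact (add_left_inj 1).symm
    have h4 : ((p + 2 : ℕ) : ZMod 2) = s ↔ ((p + 1 : ℕ) : ZMod 2) = s + 1 := by
      rw [← h3]; push_cast; rw [h2, add_zero]
    simp only [h3, h4]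
    split_ifs <;> simp

/-- Projecting a truncated cocycle to the parity of `N - N_g` keeps the component that determines
its class. -/
theorem parityPart_eq_top (hW : act g W = W) (hJ : JacobianExact g W) :
    HHc.parityPart g W (codimFix g : ZMod 2) = ⊤ := by
  rw [eq_top_iff]
  rintro c -
  obtain ⟨φ, rfl⟩ := cohomologyClass_surjective g hW hJ c
  let ψ : truncatedCocycles g W := ⟨⟨parityProj N (codimFix g) φ.1, by
    rw [mem_cocycles, curvedDiff_parityProj, curvedDiff_coe, map_zero]⟩,
    fun p hp => by
      change parityProj N (codimFix g) φ.1 p = 0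
      rw [parityProj_apply, φ.2 p hp, ite_self]⟩
  have h1 : jacobianClass g W ψ = jacobianClass g W φ := by
    rw [jacobianClass_apply, jacobianClass_apply, leadingValue_apply, leadingValue_apply]
    change Ideal.Quotient.mk _ (leadingPart g _ (parityProj N (codimFix g) φ.1 (codimFix g)) ∅) = _
    rw [parityProj_apply, if_pos rfl]
  refine ⟨ψ.1, fun p hp => ?_, ?_⟩
  · change parityProj N (codimFix g) φ.1 p = 0
    rw [parityProj_apply, if_neg hp]
  · rw [← jacobianEquiv_jacobianClass g hW hJ, h1, jacobianEquiv_jacobianClass]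
    rfl

theorem parityPart_eq_bot (hW : act g W = W) (hJ : JacobianExact g W) {s : ZMod 2}
    (hs : s ≠ codimFix g) : HHc.parityPart g W s = ⊥ := by
  rw [eq_bot_iff]
  rintro _ ⟨φ, hφ, rfl⟩
  have hφ' : parityProj N s (φ : CompactCochain N) = φ := compactCochain_ext fun p => by
    rw [parityProj_apply]
    split_ifs with h
    · rfl
    · exact (hφ p h).symm
  obtain ⟨ψ, η, hψ⟩ := exists_truncatedCocycle_cls_eq g hW hJ φ
  -- Truncation may spoil homogeneity, so the result is projected back to parity `s`. The projection
  -- has no component of degree `N - N_g`, so its leading value is zero.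
  let χ : truncatedCocycles g W := ⟨⟨parityProj N s ψ.1, by
    rw [mem_cocycles, curvedDiff_parityProj, curvedDiff_coe, map_zero]⟩,
    fun p hp => by
      change parityProj N s ψ.1 p = 0
      rw [parityProj_apply, ψ.2 p hp, ite_self]⟩
  have h1 : jacobianClass g W χ = 0 := by
    rw [jacobianClass_apply, leadingValue_apply]
    change Ideal.Quotient.mk _ (leadingPart g _ (parityProj N s ψ.1 (codimFix g)) ∅) = _
    rw [parityProj_apply, if_neg hs.symm, map_zero]
    exact map_zero _
  obtain ⟨ξ, hξ⟩ := (HHc.cls_eq_zero_iff g).1 (cohomologyClass_eq_zero g hW h1)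
  rw [Submodule.mem_bot, HHc.cls_eq_zero_iff]
  refine ⟨ξ + parityProj N (s + 1) η, ?_⟩
  have h2 : s + 1 + 1 = s := by
    have h2 : (2 : ZMod 2) = 0 := rfl
    linear_combination h2
  rw [map_add, hξ, curvedDiff_parityProj, h2]
  change parityProj N s ψ.1 + _ = _
  rw [hψ, map_sub, hφ', sub_add_cancel]

end MainIsomorphism

end

end OrbifoldLG

open OrbifoldLG
theorem mainTheorem7 (N : ℕ) (W : PolyAlg N) (q : Fin N → ℚ) (hq : ∀ i, 0 < q i)
    (hW : IsWeightedHomogeneous q W 1) (hiso : HasIsolatedCriticalPoint W)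
    (G : Subgroup (Fin N → ℂˣ)) (hG : G ≤ symmetryGroup W) (g : Fin N → ℂˣ) (hg : g ∈ G) :
    ∃ Θ : Jac (restrict g W) ≃ₗ[ℂ] HHc g W,
      (∀ s : ZMod 2,
        (shift (evenGrading (Jac (restrict g W)))
          ((N : ZMod 2) - (Module.finrank ℂ (fixedLocus g) : ZMod 2)) s).map Θ.toLinearMap =
            HHc.parityPart g W s) ∧
      ∀ a : FixedPoly g,
        (∃ φ : cocycles g W, HasLeadingTerm g a φ) ∧
        ∀ φ : cocycles g W, HasLeadingTerm g a φ →
          Θ (Ideal.Quotient.mk _ a) = HHc.cls φ := by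
  have hg' := hG hg
  have hact := act_eq_self hg'
  have hJ : JacobianExact g W := fun _ _ => mulCon_jacCoeff_exact hq hW hiso hg'
  refine ⟨jacobianEquiv g hact hJ, fun s => ?_, fun a => ⟨?_, fun φ hφ => ?_⟩⟩
  · have h1 : (N : ZMod 2) - (Module.finrank ℂ (fixedLocus g) : ZMod 2) = codimFix g := by
      rw [sub_eq_iff_eq_add, add_comm, ← Nat.cast_add, finrank_add_codimFix]
    have h2 : s + (codimFix g : ZMod 2) = 0 ↔ s = codimFix g := by
      rw [add_eq_zero_iff_eq_neg, ZMod.neg_eq_self_mod_two]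
    rw [h1, shift, evenGrading]
    by_cases hs : s = codimFix g
    · rw [if_pos (h2.2 hs), hs, parityPart_eq_top g hact hJ, Submodule.map_top]
      exact LinearEquiv.range _
    · rw [if_neg fun h => hs (h2.1 h), parityPart_eq_bot g hact hJ hs, Submodule.map_bot]
  · obtain ⟨φ, hφ⟩ := exists_truncatedCocycle g hact a
    exact ⟨φ.1, φ.2, by rw [hφ, sub_self, map_zero]; exact zero_mem _⟩
  · have h := jacobianEquiv_jacobianClass g hact hJ ⟨φ, hφ.1⟩
    rwa [jacobianClass_apply, leadingValue_of_hasLeadingTerm g hφ] at h
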